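/- Let $(M,g)$ be a complete smooth Riemannian manifold without boundary (second countable), let $\phi:M\to\mathbb R$ be smooth, and let $\mathcal L_\phi u=\Delta u-\langle\nabla u,\nabla\phi\rangle$ be the drift Laplacian, acting componentwise on $\mathbb R^N$-valued functions. Integrals over $M$ are with respect to the Riemannian volume, $|\nabla f|^2=\sum_{\alpha}|\nabla f_\alpha|^2$ for $f=(f_1,\dots,f_N)$, and $\|f\|_{W^{1,2}_\phi}^2=\int_M(|f|^2+|\nabla f|^2)\,e^{-\phi}$. Let $a<b$ and let $u:M\times[a,b]\to\mathbb R^N$ be smooth, with $u(\cdot,t)\in W^{1,2}_\phi$ for each $t\in[a,b]$ and $\sup_{t\in[a,b]}\|\partial_tu(\cdot,t)\|_{W^{1,2}_\phi}<\infty$. Let $C:[a,b]\to\mathbb R$ be a function such that $$|(\partial_t-\mathcal L_\phi)u|\le C(t)\,(|u|+|\nabla u|)\qquad\text{on } M\times[a,b].$$ Set $$I(t)=\int_M|u|^2e^{-\phi},\qquad D(t)=-\int_M|\nabla u|^2e^{-\phi},\qquad U(t)=\frac{D(t)}{I(t)}.$$ Then at every $t\in[a,b]$ for which $u(\cdot,t)$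 is not identically zero, $U$ and $\log(1-U)$ are differentiable (one-sidedly at the end points of $[a,b]$) and $$U'(t)\ge C(t)^2\,(U(t)-1),\qquad [\log(1-U)]'(t)\le C(t)^2 .$$ -/

import Mathlib

open Set MeasureTheory Manifold Bundle
open scoped ContDiff ENNReal

noncomputable section

namespace DriftHeat

/-- The model space `ℝⁿ` with its Euclidean norm. -/
abbrev Eucl (n : ℕ) : Type := EuclideanSpace ℝ (Fin n)

section Riemannian

variable {n : ℕ} {M : Type*} [TopologicalSpace M] [ChartedSpace (Eucl n) M]
  [IsManifold (𝓡 n) ∞ M] [RiemannianBundle (fun x : M => TangentSpace (𝓡 n) x)]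

/-- The coordinate vector field `∂ᵢ` of the chart around `x₀`, at the point with coordinates `z`:
the image of the `i`-th standard basis vector under the differential of the inverse chart. -/
def coordVector (x₀ : M) (z : Eucl n) (i : Fin n) :
    TangentSpace (𝓡 n) ((extChartAt (𝓡 n) x₀).symm z) :=
  mfderiv (𝓡 n) (𝓡 n) ((extChartAt (𝓡 n) x₀).symm : Eucl n → M) z
    (EuclideanSpace.single i (1 : ℝ) : Eucl n)

/-- The metric coefficients `gᵢⱼ = g(∂ᵢ, ∂ⱼ)` in the chart around `x₀`. -/
def gram (x₀ : M) (z : Eucl n) : Matrix (Fin n) (Fin n) ℝ :=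
  Matrix.of fun i j => inner ℝ (coordVector x₀ z i) (coordVector x₀ z j)

/-- The Riemannian volume density `√(det gᵢⱼ)` in the chart around `x₀`. -/
def volDensity (x₀ : M) (z : Eucl n) : ℝ := √(gram x₀ z).det

/-- The Riemannian volume of the domain of the chart around `x₀`: the measure `√(det gᵢⱼ) dz` on
the range of the chart, carried over to `M`. -/
def chartVolume [MeasurableSpace M] (x₀ : M) : Measure M :=
  ((volume.restrict (extChartAt (𝓡 n) x₀).target).withDensity
    fun z => ENNReal.ofReal (volDensity x₀ z)).map (extChartAt (𝓡 n) x₀).symm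

variable (n M) in
/-- The Riemannian volume measure. The measures `chartVolume x₀` agree on overlaps of chart
domains, and (on a second countable manifold) their least upper bound is the measure on `M`
that restricts to each of them. -/
def riemannianVolume [MeasurableSpace M] : Measure M := ⨆ x₀ : M, chartVolume (n := n) x₀

/-- The inner product of tangent vectors makes each tangent space complete. -/
instance tangentComplete (x : M) : CompleteSpace (TangentSpace (𝓡 n) x) := by
  have : FiniteDimensional ℝ (TangentSpace (𝓡 n) x) :=
    inferInstanceAs (FiniteDimensional ℝ (Eucl n))
  exact FiniteDimensional.complete ℝ _

/-- The Riemannian gradient of a function: `g(∇f, v) = df(v)`. -/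
def grad (f : M → ℝ) (x : M) : TangentSpace (𝓡 n) x :=
  (InnerProductSpace.toDual ℝ (TangentSpace (𝓡 n) x)).symm (mfderiv (𝓡 n) 𝓘(ℝ, ℝ) f x)

/-- The vector field `X` in the chart around `x₀`: the vector of its components `Xⁱ` with respect
to the coordinate vector fields `∂ᵢ`, as a function of the coordinates `z`. -/
def coordField (x₀ : M) (X : (x : M) → TangentSpace (𝓡 n) x) (z : Eucl n) : Eucl n :=
  mfderiv (𝓡 n) (𝓡 n) (extChartAt (𝓡 n) x₀ : M → Eucl n) ((extChartAt (𝓡 n) x₀).symm z)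
    (X ((extChartAt (𝓡 n) x₀).symm z))

/-- The Riemannian divergence `(det g)^(-1/2) ∑ᵢ ∂ᵢ ((det g)^(1/2) Xⁱ)` of a vector field,
computed at `x` in the chart around `x`. -/
def divergence (X : (x : M) → TangentSpace (𝓡 n) x) (x : M) : ℝ :=
  (volDensity x (extChartAt (𝓡 n) x x))⁻¹ *
    ∑ i : Fin n, fderiv ℝ (fun z : Eucl n => volDensity x z * coordField x X z i)
      (extChartAt (𝓡 n) x x) (EuclideanSpace.single i (1 : ℝ))

/-- The Laplace-Beltrami operator `Δ f = div ∇f`. -/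
def laplacian (f : M → ℝ) (x : M) : ℝ := divergence (n := n) (grad f) x

variable {N : ℕ}

/-- The drift Laplacian `L_φ u = Δ u - ⟨∇u, ∇φ⟩` of an `ℝᴺ`-valued function, component by
component. -/
def driftLaplacian (φ : M → ℝ) (u : M → Eucl N) (x : M) : Eucl N :=
  WithLp.toLp 2 fun α => laplacian (n := n) (fun y => u y α) x -
    inner ℝ (grad (n := n) (fun y => u y α) x) (grad (n := n) φ x)

/-- `|∇u| = (∑_α |∇u_α|²)^(1/2)` for an `ℝᴺ`-valued function `u`. -/
def gradNorm (u : M → Eucl N) (x : M) : ℝ :=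
  √(∑ α : Fin N, ‖grad (n := n) (fun y => u y α) x‖ ^ 2)

/-- `‖f‖² = ∫ (|f|² + |∇f|²) e^{-φ}`, the squared norm of `W^{1,2}_φ`, in `[0, ∞]`. A smooth
function belongs to `W^{1,2}_φ` if and only if this is finite: its weak gradient is its classical
one. -/
def sobolevSq [MeasurableSpace M] (φ : M → ℝ) (f : M → Eucl N) : ℝ≥0∞ :=
  ∫⁻ x, ENNReal.ofReal ((‖f x‖ ^ 2 + gradNorm (n := n) f x ^ 2) * Real.exp (-φ x))
    ∂(riemannianVolume n M)

/-- `I = ∫ |f|² e^{-φ}` for one time slice `f`. -/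
def sliceI [MeasurableSpace M] (φ : M → ℝ) (f : M → Eucl N) : ℝ :=
  ∫ x, ‖f x‖ ^ 2 * Real.exp (-φ x) ∂(riemannianVolume n M)

/-- `D = -∫ |∇f|² e^{-φ}` for one time slice `f`. -/
def sliceD [MeasurableSpace M] (φ : M → ℝ) (f : M → Eucl N) : ℝ :=
  -∫ x, gradNorm (n := n) f x ^ 2 * Real.exp (-φ x) ∂(riemannianVolume n M)

/-- The frequency `U(t) = D(t) / I(t)` of `u : M × ℝ → ℝᴺ`. -/
def frequency [MeasurableSpace M] (φ : M → ℝ) (u : M → ℝ → Eucl N) (t : ℝ) : ℝ :=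
  sliceD (n := n) φ (fun x => u x t) / sliceI (n := n) φ (fun x => u x t)

end Riemannian

end DriftHeat

end

/-! Write `v = ∂_t u`, `L = 𝓛_φ u`, `E = v - L`, with norms and inner products in `L²(e^{-φ} dV)`.
Differentiation under the integral gives `I' = 2⟨u, v⟩`, and Green's identity gives `D = ⟨u, L⟩` and
`D' = -2∫⟨∇u, ∇v⟩e^{-φ} = 2⟨v, L⟩`. Hence `I² U' = D' I - D I' = 2⟨v, L⟩‖u‖² - 2⟨u, L⟩⟨u, v⟩`.
Polarising in `v + L` and `v - L`, the right side is `½(‖v + L‖²‖u‖² - ⟨u, v + L⟩²) - ½(‖E‖²‖u‖² -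
⟨u, E⟩²)`, which by Cauchy–Schwarz is at least `-½‖E‖² I` (`neg_norm_sub_sq_mul_le`). The hypothesis
and `(x + y)² ≤ 2x² + 2y²` give `‖E‖² ≤ 2C²(I - D)`, so `U' ≥ C²(U - 1)`. Since `U ≤ 0`, dividing by
`1 - U > 0` gives the bound for `log (1 - U)`.

Two analytic points need work. The first is differentiating `I` and `D` with no pointwise dominating
function, only a uniform `W^{1,2}_φ` bound on `v`. By Cauchy–Schwarz in time, the difference
quotients are bounded in `L²`; they converge pointwise, hence weakly, and this suffices
(`hasDerivWithinAt_integral_norm_sq`).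

The second is integration by parts without boundary terms (`integral_green`). Here `L` lies in `L²`
because `v` and `E` do, so all the products involved are integrable. Completeness enters through
Hopf–Rinow: compact sets have compact closed thickenings, so there are compactly supported
`1`-Lipschitz cutoffs, equal to `1` on larger and larger compact sets. Such cutoffs are only
Lipschitz, so they are handled in charts by Rademacher's theorem and a partition of unity.

Underneath lies the chart calculus: the chart volumes agree on overlaps, and the coordinate formula
for `Δ` does not depend on the chart. -/

open Filter Topology

namespace DriftHeat

/-! ### Metric and gradient in local coordinates -/

section Coordinates

variable {n : ℕ} {M : Type*} [TopologicalSpace M] [ChartedSpace (Eucl n) M]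

/-- The differential of the inverse chart around `x₀`, with the Euclidean space as its source. -/
noncomputable def chartDeriv (x₀ : M) (z : Eucl n) :
    Eucl n →L[ℝ] TangentSpace (𝓡 n) ((extChartAt (𝓡 n) x₀).symm z) :=
  mfderiv (𝓡 n) (𝓡 n) ((extChartAt (𝓡 n) x₀).symm : Eucl n → M) z

theorem eucl_eq_sum (v : Eucl n) : v = ∑ i, v i • (EuclideanSpace.single i (1 : ℝ) : Eucl n) := by
  simpa using ((EuclideanSpace.basisFun (Fin n) ℝ).sum_repr v).symm

theorem map_eucl_eq_sum {F : Type*} [AddCommGroup F] [Module ℝ F] [TopologicalSpace F]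
    (T : Eucl n →L[ℝ] F) (v : Eucl n) : T v = ∑ i, v i • T (EuclideanSpace.single i (1 : ℝ)) := by
  conv_lhs => rw [eucl_eq_sum v]
  simp only [map_sum, map_smul]

theorem chartDeriv_eq_sum (x₀ : M) (z v : Eucl n) :
    chartDeriv x₀ z v = ∑ i, v i • coordVector x₀ z i :=
  map_eucl_eq_sum (chartDeriv x₀ z) v

theorem isOpen_chart_target (x₀ : M) : IsOpen (extChartAt (𝓡 n) x₀).target :=
  isOpen_extChartAt_target x₀

section Smooth

variable [IsManifold (𝓡 n) ∞ M] {x₀ : M} {z : Eucl n}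

theorem mdifferentiableAt_chart_symm (hz : z ∈ (extChartAt (𝓡 n) x₀).target) :
    MDifferentiableAt (𝓡 n) (𝓡 n) ((extChartAt (𝓡 n) x₀).symm : Eucl n → M) z := by
  have := mdifferentiableWithinAt_extChartAt_symm hz
  simpa [mdifferentiableWithinAt_univ] using this

/-- The differentials of a chart and of its inverse are mutually inverse. This form lets components
be identified without naming the inverse differential. -/
theorem coordField_eq_iff (hz : z ∈ (extChartAt (𝓡 n) x₀).target)
    (X : (x : M) → TangentSpace (𝓡 n) x) (v : Eucl n) :
    coordField x₀ X z = v ↔ chartDeriv x₀ z v = X ((extChartAt (𝓡 n) x₀).symm z) := by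
  have h1 := mfderiv_extChartAt_comp_mfderivWithin_extChartAt_symm hz
  have h2 := mfderivWithin_extChartAt_symm_comp_mfderiv_extChartAt'
    ((extChartAt (𝓡 n) x₀).map_target hz)
  rw [(extChartAt (𝓡 n) x₀).right_inv hz] at h2
  rw [ModelWithCorners.range_eq_univ, mfderivWithin_univ] at h1 h2
  constructor
  · rintro rfl
    exact congr($h2 (X ((extChartAt (𝓡 n) x₀).symm z)))
  · intro h
    have h3 : coordField x₀ X z = mfderiv (𝓡 n) (𝓡 n) (extChartAt (𝓡 n) x₀ : M → Eucl n)
      ((extChartAt (𝓡 n) x₀).symm z) (X ((extChartAt (𝓡 n) x₀).symm z)) := rfl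
    rw [h3, ← h]
    exact congr($h1 v)

theorem chartDeriv_coordField (hz : z ∈ (extChartAt (𝓡 n) x₀).target)
    (X : (x : M) → TangentSpace (𝓡 n) x) :
    chartDeriv x₀ z (coordField x₀ X z) = X ((extChartAt (𝓡 n) x₀).symm z) :=
  (coordField_eq_iff hz X _).1 rfl

theorem mfderiv_chartDeriv (hz : z ∈ (extChartAt (𝓡 n) x₀).target) {f : M → ℝ}
    (hf : MDifferentiableAt (𝓡 n) 𝓘(ℝ, ℝ) f ((extChartAt (𝓡 n) x₀).symm z)) (v : Eucl n) :
    mfderiv (𝓡 n) 𝓘(ℝ, ℝ) f ((extChartAt (𝓡 n) x₀).symm z) (chartDeriv x₀ z v) =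
      fderiv ℝ (f ∘ (extChartAt (𝓡 n) x₀).symm) z v := by
  have h := mfderiv_comp z hf (mdifferentiableAt_chart_symm hz)
  rw [mfderiv_eq_fderiv] at h
  exact congr($h.symm v)

theorem contDiffOn_comp_chart_symm {f : M → ℝ} (hf : ContMDiff (𝓡 n) 𝓘(ℝ, ℝ) ∞ f) (x₀ : M) :
    ContDiffOn ℝ ∞ (f ∘ (extChartAt (𝓡 n) x₀).symm) (extChartAt (𝓡 n) x₀).target := by
  rw [← contMDiffOn_iff_contDiffOn]
  exact hf.comp_contMDiffOn (contMDiffOn_extChartAt_symm x₀)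

omit [IsManifold (𝓡 n) ∞ M] in
theorem continuous_of_comp_chart_symm {Y : Type*} [TopologicalSpace Y] {F : M → Y}
    (h : ∀ x₀ : M, ContinuousOn (F ∘ (extChartAt (𝓡 n) x₀).symm) (extChartAt (𝓡 n) x₀).target) :
    Continuous F := by
  rw [continuous_iff_continuousAt]
  intro x
  have h1 : ContinuousAt (F ∘ (extChartAt (𝓡 n) x).symm) (extChartAt (𝓡 n) x x) :=
    (h x).continuousAt (extChartAt_target_mem_nhds x)
  have h2 := h1.comp (continuousAt_extChartAt (I := 𝓡 n) x)
  refine h2.congr ?_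
  filter_upwards [extChartAt_source_mem_nhds (I := 𝓡 n) x] with y hy
  simp only [Function.comp_apply]
  rw [(extChartAt (𝓡 n) x).left_inv hy]

variable [RiemannianBundle (fun x : M => TangentSpace (𝓡 n) x)]

omit [IsManifold (𝓡 n) ∞ M] in
theorem inner_chartDeriv (x₀ : M) (z v w : Eucl n) :
    inner ℝ (chartDeriv x₀ z v) (chartDeriv x₀ z w) = ∑ i, ∑ j, v i * w j * gram x₀ z i j := by
  rw [chartDeriv_eq_sum, chartDeriv_eq_sum, sum_inner]
  refine Finset.sum_congr rfl fun i _ => ?_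
  rw [inner_sum]
  refine Finset.sum_congr rfl fun j _ => ?_
  rw [real_inner_smul_left, real_inner_smul_right, gram, Matrix.of_apply, mul_assoc]

theorem gram_posDef (hz : z ∈ (extChartAt (𝓡 n) x₀).target) : (gram x₀ z).PosDef := by
  apply Matrix.posDef_gram_of_linearIndependent (𝕜 := ℝ) (v := coordVector x₀ z)
  rw [Fintype.linearIndependent_iff]
  intro g hg i
  -- A vanishing combination of the `∂ᵢ` exhibits its coefficient vector as the components of the
  -- zero field; these are unique, so the coefficients vanish.
  have h := chartDeriv_eq_sum x₀ z (WithLp.toLp 2 g)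
  simp only at h
  rw [hg] at h
  have h1 := (coordField_eq_iff hz (fun _ => 0) _).2 h
  have h2 := (coordField_eq_iff hz (fun _ => 0) 0).2 (map_zero _)
  exact congr($(h1.symm.trans h2) i)

theorem volDensity_pos (hz : z ∈ (extChartAt (𝓡 n) x₀).target) : 0 < volDensity x₀ z :=
  Real.sqrt_pos.2 (gram_posDef hz).det_pos

omit [IsManifold (𝓡 n) ∞ M] in
theorem inner_grad (f : M → ℝ) (x : M) (v : TangentSpace (𝓡 n) x) :
    inner ℝ (grad (n := n) f x) v = mfderiv (𝓡 n) 𝓘(ℝ, ℝ) f x v :=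
  InnerProductSpace.toDual_symm_apply

theorem inner_grad_chartDeriv (hz : z ∈ (extChartAt (𝓡 n) x₀).target) {f : M → ℝ}
    (hf : MDifferentiableAt (𝓡 n) 𝓘(ℝ, ℝ) f ((extChartAt (𝓡 n) x₀).symm z)) (v : Eucl n) :
    inner ℝ (grad (n := n) f ((extChartAt (𝓡 n) x₀).symm z)) (chartDeriv x₀ z v) =
      fderiv ℝ (f ∘ (extChartAt (𝓡 n) x₀).symm) z v := by
  rw [inner_grad, mfderiv_chartDeriv hz hf]

theorem inner_grad_eq_fderiv (hz : z ∈ (extChartAt (𝓡 n) x₀).target) {f : M → ℝ}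
    (hf : MDifferentiableAt (𝓡 n) 𝓘(ℝ, ℝ) f ((extChartAt (𝓡 n) x₀).symm z))
    (X : (x : M) → TangentSpace (𝓡 n) x) :
    inner ℝ (grad (n := n) f ((extChartAt (𝓡 n) x₀).symm z)) (X ((extChartAt (𝓡 n) x₀).symm z)) =
      fderiv ℝ (f ∘ (extChartAt (𝓡 n) x₀).symm) z (coordField x₀ X z) := by
  rw [← inner_grad_chartDeriv hz hf, chartDeriv_coordField hz]

/-- This is `⟨∇f, ∂ᵢ⟩ = ∂ᵢ f` with `∇f` expanded in the `∂ⱼ`; inverting the Gram matrix then gives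
the usual `gⁱʲ ∂ⱼ f`. -/
theorem gram_mulVec_coordField_grad (hz : z ∈ (extChartAt (𝓡 n) x₀).target) {f : M → ℝ}
    (hf : MDifferentiableAt (𝓡 n) 𝓘(ℝ, ℝ) f ((extChartAt (𝓡 n) x₀).symm z)) :
    (gram x₀ z).mulVec (coordField x₀ (grad (n := n) f) z).ofLp = fun i =>
      fderiv ℝ (f ∘ (extChartAt (𝓡 n) x₀).symm) z (EuclideanSpace.single i 1) := by
  ext i
  rw [← inner_grad_chartDeriv hz hf, ← chartDeriv_coordField hz (grad f), inner_chartDeriv]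
  simp only [Matrix.mulVec, dotProduct]
  refine Finset.sum_congr rfl fun j _ => ?_
  rw [Finset.sum_eq_single i]
  · have := (gram_posDef hz).isHermitian.apply i j
    simp only [star_trivial] at this
    rw [← this]
    simp [mul_comm]
  · intro k _ hk
    simp [hk]
  · simp

theorem coordField_grad_eq (hz : z ∈ (extChartAt (𝓡 n) x₀).target) {f : M → ℝ}
    (hf : MDifferentiableAt (𝓡 n) 𝓘(ℝ, ℝ) f ((extChartAt (𝓡 n) x₀).symm z)) (i : Fin n) :
    coordField x₀ (grad (n := n) f) z i = ∑ j, (gram x₀ z)⁻¹ i j *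
      fderiv ℝ (f ∘ (extChartAt (𝓡 n) x₀).symm) z (EuclideanSpace.single j 1) := by
  have h := gram_mulVec_coordField_grad hz hf
  have h2 := congrArg (fun w => (gram x₀ z)⁻¹.mulVec w) h
  simp only [Matrix.mulVec_mulVec] at h2
  rw [Matrix.nonsing_inv_mul _ (gram_posDef hz).det_pos.ne'.isUnit, Matrix.one_mulVec] at h2
  rw [h2]
  rfl

variable [IsContMDiffRiemannianBundle (𝓡 n) ∞ (Eucl n) (fun x : M => TangentSpace (𝓡 n) x)]

theorem contDiffOn_gram (x₀ : M) (i j : Fin n) :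
    ContDiffOn ℝ ∞ (fun z => gram x₀ z i j) (extChartAt (𝓡 n) x₀).target := by
  rw [← contMDiffOn_iff_contDiffOn]
  have key : ∀ i : Fin n, ContMDiffOn (𝓡 n) ((𝓡 n).prod 𝓘(ℝ, Eucl n)) ∞
     (fun z => (⟨(extChartAt (𝓡 n) x₀).symm z, coordVector x₀ z i⟩ : TangentBundle (𝓡 n) M))
     (extChartAt (𝓡 n) x₀).target := by
    intro i
    -- The field `∂ᵢ` is the image of a constant section under the tangent map of the inverse chart,
    -- hence smooth.
    have h1 := (contMDiffOn_extChartAt_symm (I := 𝓡 n) (n := ∞) x₀).contMDiffOn_tangentMapWithin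
      (m := ∞) le_rfl (isOpen_extChartAt_target x₀).uniqueMDiffOn
    have h2 : ContMDiff (𝓡 n) ((𝓡 n).prod 𝓘(ℝ, Eucl n)) ∞
        (fun z : Eucl n => (⟨z, (EuclideanSpace.single i (1 : ℝ) : Eucl n)⟩ :
          TangentBundle (𝓡 n) (Eucl n))) :=
      contMDiff_vectorSpace_iff_contDiff.2 contDiff_const
    refine (h1.comp h2.contMDiffOn (fun z hz => hz)).congr fun z hz => ?_
    simp only [Function.comp_apply, tangentMapWithin]
    rw [mfderivWithin_of_isOpen (isOpen_extChartAt_target x₀) hz]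
    rfl
  exact (key i).inner_bundle (key j)

theorem contDiffOn_gram_det (x₀ : M) :
    ContDiffOn ℝ ∞ (fun z => (gram x₀ z).det) (extChartAt (𝓡 n) x₀).target := by
  simp only [Matrix.det_apply']
  refine ContDiffOn.sum fun σ _ => contDiffOn_const.mul (contDiffOn_prod fun i _ => ?_)
  exact contDiffOn_gram x₀ _ _

theorem contDiffOn_volDensity (x₀ : M) :
    ContDiffOn ℝ ∞ (volDensity x₀) (extChartAt (𝓡 n) x₀).target :=
  (contDiffOn_gram_det x₀).sqrt fun _ hz => (gram_posDef hz).det_pos.ne'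

theorem contDiffOn_gram_inv (x₀ : M) (i j : Fin n) :
    ContDiffOn ℝ ∞ (fun z => (gram x₀ z)⁻¹ i j) (extChartAt (𝓡 n) x₀).target := by
  have h : ∀ z : Eucl n, (gram x₀ z)⁻¹ i j = (gram x₀ z).det⁻¹ * (gram x₀ z).adjugate i j := by
    intro z
    rw [Matrix.inv_def, Ring.inverse_eq_inv', Matrix.smul_apply, smul_eq_mul]
  simp only [h]
  refine ((contDiffOn_gram_det x₀).inv fun _ hz => (gram_posDef hz).det_pos.ne').mul ?_
  simp only [Matrix.adjugate_apply, Matrix.det_apply']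
  refine ContDiffOn.sum fun σ _ => contDiffOn_const.mul (contDiffOn_prod fun k _ => ?_)
  by_cases hk : σ k = j
  · simp only [Matrix.updateRow_apply, hk, if_true]
    exact contDiffOn_const
  · simp only [Matrix.updateRow_apply, hk, if_false]
    exact contDiffOn_gram x₀ _ _

theorem contDiffOn_coordField_grad {f : M → ℝ} (hf : ContMDiff (𝓡 n) 𝓘(ℝ, ℝ) ∞ f) (x₀ : M)
    (i : Fin n) :
    ContDiffOn ℝ ∞ (fun z => coordField x₀ (grad (n := n) f) z i)
      (extChartAt (𝓡 n) x₀).target := by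
  refine ContDiffOn.congr ?_
    fun z hz => coordField_grad_eq hz (hf.mdifferentiable (by simp) _) i
  refine ContDiffOn.sum fun j _ => (contDiffOn_gram_inv x₀ i j).mul ?_
  have := (contDiffOn_comp_chart_symm hf x₀).fderiv_of_isOpen (m := ∞) (isOpen_chart_target x₀)
    (by simp)
  exact this.clm_apply contDiffOn_const

theorem continuous_inner_grad {f g : M → ℝ} (hf : ContMDiff (𝓡 n) 𝓘(ℝ, ℝ) ∞ f)
    (hg : ContMDiff (𝓡 n) 𝓘(ℝ, ℝ) ∞ g) :
    Continuous fun x => inner ℝ (grad (n := n) f x) (grad (n := n) g x) := by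
  refine continuous_of_comp_chart_symm (n := n) fun x₀ => ?_
  have h : ContinuousOn (fun z => fderiv ℝ (f ∘ (extChartAt (𝓡 n) x₀).symm) z
      (coordField x₀ (grad (n := n) g) z)) (extChartAt (𝓡 n) x₀).target := by
    have h1 := (contDiffOn_comp_chart_symm hf x₀).continuousOn_fderiv_of_isOpen
      (isOpen_chart_target x₀) (by simp)
    have h2 : ContinuousOn (coordField x₀ (grad (n := n) g)) (extChartAt (𝓡 n) x₀).target :=
      (contDiffOn_euclidean.2 fun i => contDiffOn_coordField_grad hg x₀ i).continuousOn
    exact h1.clm_apply h2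
  exact h.congr fun z hz => inner_grad_eq_fderiv hz (hf.mdifferentiable (by simp) _) _

end Smooth

end Coordinates

end DriftHeat

namespace DriftHeat

/-! ### The Riemannian volume measure -/

section Volume

variable {n : ℕ} {M : Type*} [TopologicalSpace M] [ChartedSpace (Eucl n) M]
  [IsManifold (𝓡 n) ∞ M] [RiemannianBundle (fun x : M => TangentSpace (𝓡 n) x)]

omit [IsManifold (𝓡 n) ∞ M] in
-- All tangent spaces share the underlying type `Eucl n`, but the inner product depends on the base
-- point; this transports it along an equality of points.
theorem inner_tangentSpace_congr {x y : M} (h : x = y) (v w : Eucl n) :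
    @inner ℝ (TangentSpace (𝓡 n) x) _ v w = @inner ℝ (TangentSpace (𝓡 n) y) _ v w := by
  subst h
  rfl

/-- The transition map from the chart around `x₀` to the chart around `x₁`. -/
noncomputable def transition (x₀ x₁ : M) (z : Eucl n) : Eucl n :=
  extChartAt (𝓡 n) x₁ ((extChartAt (𝓡 n) x₀).symm z)

omit [RiemannianBundle (fun x : M => TangentSpace (𝓡 n) x)] in
theorem differentiableAt_transition {x₀ x₁ : M} {z : Eucl n}
    (hz : z ∈ (extChartAt (𝓡 n) x₀).target)
    (hz' : (extChartAt (𝓡 n) x₀).symm z ∈ (extChartAt (𝓡 n) x₁).source) :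
    DifferentiableAt ℝ (transition (n := n) x₀ x₁) z := by
  rw [← mdifferentiableAt_iff_differentiableAt]
  refine MDifferentiableAt.comp z (mdifferentiableAt_extChartAt (I := 𝓡 n) ?_)
    (mdifferentiableAt_chart_symm hz)
  rwa [extChartAt_source] at hz'

omit [IsManifold (𝓡 n) ∞ M] [RiemannianBundle (fun x : M => TangentSpace (𝓡 n) x)] in
theorem symm_transition {x₀ x₁ : M} {z : Eucl n}
    (hz' : (extChartAt (𝓡 n) x₀).symm z ∈ (extChartAt (𝓡 n) x₁).source) :
    (extChartAt (𝓡 n) x₁).symm (transition x₀ x₁ z) = (extChartAt (𝓡 n) x₀).symm z :=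
  (extChartAt (𝓡 n) x₁).left_inv hz'

/-- Near `z` one inverse chart is the other composed with the transition map, so the chain rule
applies. -/
theorem inner_chartDeriv_transition {x₀ x₁ : M} {z : Eucl n}
    (hz : z ∈ (extChartAt (𝓡 n) x₀).target)
    (hz' : (extChartAt (𝓡 n) x₀).symm z ∈ (extChartAt (𝓡 n) x₁).source) (v w : Eucl n) :
    inner ℝ (chartDeriv x₀ z v) (chartDeriv x₀ z w) =
      inner ℝ (chartDeriv x₁ (transition x₀ x₁ z) (fderiv ℝ (transition (n := n) x₀ x₁) z v))
        (chartDeriv x₁ (transition x₀ x₁ z) (fderiv ℝ (transition (n := n) x₀ x₁) z w)) := by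
  have hev : ((extChartAt (𝓡 n) x₀).symm : Eucl n → M) =ᶠ[𝓝 z]
      (extChartAt (𝓡 n) x₁).symm ∘ transition x₀ x₁ := by
    have hc : ContinuousAt (extChartAt (𝓡 n) x₀).symm z :=
      (mdifferentiableAt_chart_symm hz).continuousAt
    filter_upwards [hc.preimage_mem_nhds ((isOpen_extChartAt_source x₁).mem_nhds hz')] with y hy
    exact (symm_transition hy).symm
  have ht : transition x₀ x₁ z ∈ (extChartAt (𝓡 n) x₁).target :=
    (extChartAt (𝓡 n) x₁).map_source hz'
  have key : ∀ v : Eucl n, (chartDeriv x₀ z v : Eucl n) =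
      chartDeriv x₁ (transition x₀ x₁ z) (fderiv ℝ (transition (n := n) x₀ x₁) z v) := by
    intro v
    have h1 := hev.mfderiv_eq (I := 𝓡 n) (I' := 𝓡 n)
    have h2 := mfderiv_comp z (mdifferentiableAt_chart_symm ht)
      (differentiableAt_transition hz hz').mdifferentiableAt
    rw [mfderiv_eq_fderiv] at h2
    exact (congr($h1 v)).trans congr($h2 v)
  exact (congrArg₂ (@inner ℝ (TangentSpace (𝓡 n) ((extChartAt (𝓡 n) x₀).symm z)) _)
    (key v) (key w)).trans (inner_tangentSpace_congr (symm_transition hz').symm _ _)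

/-- The Gram matrices satisfy `G₀ = Aᵀ G₁ A` with `A` the Jacobian of the transition map; take
determinants and square roots. -/
theorem volDensity_transition {x₀ x₁ : M} {z : Eucl n}
    (hz : z ∈ (extChartAt (𝓡 n) x₀).target)
    (hz' : (extChartAt (𝓡 n) x₀).symm z ∈ (extChartAt (𝓡 n) x₁).source) :
    volDensity x₀ z =
      |(fderiv ℝ (transition (n := n) x₀ x₁) z).det| * volDensity x₁ (transition x₀ x₁ z) := by
  set T := fderiv ℝ (transition (n := n) x₀ x₁) z with hT
  set A : Matrix (Fin n) (Fin n) ℝ :=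
    Matrix.of fun i j => T (EuclideanSpace.single j (1 : ℝ)) i with hA
  have hdet : A.det = T.det := by
    rw [ContinuousLinearMap.det,
      ← LinearMap.det_toMatrix (EuclideanSpace.basisFun (Fin n) ℝ).toBasis]
    congr 1
  have hG : gram x₀ z = A.transpose * gram x₁ (transition x₀ x₁ z) * A := by
    ext i j
    have h1 : gram x₀ z i j = inner ℝ (chartDeriv x₀ z (EuclideanSpace.single i (1 : ℝ)))
      (chartDeriv x₀ z (EuclideanSpace.single j (1 : ℝ))) := rfl
    rw [h1, inner_chartDeriv_transition hz hz', inner_chartDeriv]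
    simp only [Matrix.mul_apply, Finset.sum_mul, Matrix.transpose_apply, hA, Matrix.of_apply]
    rw [Finset.sum_comm]
    refine Finset.sum_congr rfl fun k _ => Finset.sum_congr rfl fun l _ => ?_
    ring
  rw [volDensity, hG, Matrix.det_mul, Matrix.det_mul, Matrix.det_transpose, hdet, volDensity,
    mul_comm, ← mul_assoc, Real.sqrt_mul (mul_self_nonneg _), Real.sqrt_mul_self_eq_abs]

variable [MeasurableSpace M] [BorelSpace M]
 [IsContMDiffRiemannianBundle (𝓡 n) ∞ (Eucl n) (fun x : M => TangentSpace (𝓡 n) x)]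

omit [IsManifold (𝓡 n) ∞ M] [RiemannianBundle (fun x : M => TangentSpace (𝓡 n) x)]
  [IsContMDiffRiemannianBundle (𝓡 n) ∞ (Eucl n) (fun x : M => TangentSpace (𝓡 n) x)] in
theorem aemeasurable_chart_symm (x₀ : M) : AEMeasurable ((extChartAt (𝓡 n) x₀).symm : Eucl n → M)
    (volume.restrict (extChartAt (𝓡 n) x₀).target) :=
  (continuousOn_extChartAt_symm x₀).aemeasurable (isOpen_chart_target x₀).measurableSet

omit [IsManifold (𝓡 n) ∞ M] [RiemannianBundle (fun x : M => TangentSpace (𝓡 n) x)]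
  [IsContMDiffRiemannianBundle (𝓡 n) ∞ (Eucl n) (fun x : M => TangentSpace (𝓡 n) x)] in
theorem measurableSet_chart_preimage (x₀ : M) {A : Set M} (hA : MeasurableSet A) :
    MeasurableSet ((extChartAt (𝓡 n) x₀).target ∩ (extChartAt (𝓡 n) x₀).symm ⁻¹' A) := by
  classical
  have hm : Measurable ((extChartAt (𝓡 n) x₀).target.piecewise (extChartAt (𝓡 n) x₀).symm
      (fun _ : Eucl n => x₀)) :=
    (continuousOn_extChartAt_symm x₀).measurable_piecewise continuousOn_const
      (isOpen_chart_target x₀).measurableSet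
  convert (isOpen_chart_target x₀).measurableSet.inter (hm hA) using 1
  ext z
  simp only [mem_inter_iff, mem_preimage, and_congr_right_iff]
  intro hz
  rw [piecewise_eq_of_mem _ _ _ hz]

omit [MeasurableSpace M] [BorelSpace M] in
theorem aemeasurable_ofReal_volDensity (x₀ : M) :
    AEMeasurable (fun z => ENNReal.ofReal (volDensity (n := n) x₀ z))
      (volume.restrict (extChartAt (𝓡 n) x₀).target) :=
  ((contDiffOn_volDensity x₀).continuousOn.aemeasurable
    (isOpen_chart_target x₀).measurableSet).ennreal_ofReal

omit [IsManifold (𝓡 n) ∞ M]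
  [IsContMDiffRiemannianBundle (𝓡 n) ∞ (Eucl n) (fun x : M => TangentSpace (𝓡 n) x)] in
theorem chartVolume_apply (x₀ : M) {A : Set M} (hA : MeasurableSet A) :
    chartVolume (n := n) x₀ A = ∫⁻ z in (extChartAt (𝓡 n) x₀).target ∩
      (extChartAt (𝓡 n) x₀).symm ⁻¹' A, ENNReal.ofReal (volDensity x₀ z) := by
  have h0 := aemeasurable_chart_symm (n := n) x₀
  rw [chartVolume, Measure.map_apply_of_aemeasurable
    (h0.mono_ac (withDensity_absolutelyContinuous _ _)) hA]
  rw [withDensity_apply₀ _ ?_, Measure.restrict_restrict₀, inter_comm]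
  · exact h0.nullMeasurableSet_preimage hA
  · exact h0.nullMeasurableSet_preimage hA

omit
  [IsContMDiffRiemannianBundle (𝓡 n) ∞ (Eucl n) (fun x : M => TangentSpace (𝓡 n) x)] in
-- Change of variables under the transition map: its Jacobian is exactly the ratio of the two
-- densities.
theorem chartVolume_overlap (x₀ x₁ : M) {A : Set M} (hA : MeasurableSet A)
    (h₀ : A ⊆ (extChartAt (𝓡 n) x₀).source) (h₁ : A ⊆ (extChartAt (𝓡 n) x₁).source) :
    chartVolume (n := n) x₀ A = chartVolume (n := n) x₁ A := by
  rw [chartVolume_apply x₀ hA, chartVolume_apply x₁ hA]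
  set V := (extChartAt (𝓡 n) x₀).target ∩ (extChartAt (𝓡 n) x₀).symm ⁻¹' A with hV
  have hmV : MeasurableSet V := measurableSet_chart_preimage x₀ hA
  have himg : transition x₀ x₁ '' V =
      (extChartAt (𝓡 n) x₁).target ∩ (extChartAt (𝓡 n) x₁).symm ⁻¹' A := by
    ext w
    constructor
    · rintro ⟨z, hz, rfl⟩
      refine ⟨(extChartAt (𝓡 n) x₁).map_source (h₁ hz.2), ?_⟩
      rw [mem_preimage, symm_transition (h₁ hz.2)]
      exact hz.2
    · rintro ⟨hw, hwA⟩
      refine ⟨extChartAt (𝓡 n) x₀ ((extChartAt (𝓡 n) x₁).symm w),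
        ⟨(extChartAt (𝓡 n) x₀).map_source (h₀ hwA), ?_⟩, ?_⟩
      · rw [mem_preimage, (extChartAt (𝓡 n) x₀).left_inv (h₀ hwA)]
        exact hwA
      · rw [transition, (extChartAt (𝓡 n) x₀).left_inv (h₀ hwA),
          (extChartAt (𝓡 n) x₁).right_inv hw]
  have hinj : InjOn (transition (n := n) x₀ x₁) V := by
    intro z hz w hw h
    have := congrArg (extChartAt (𝓡 n) x₁).symm h
    rw [symm_transition (h₁ hz.2), symm_transition (h₁ hw.2)] at this
    exact (extChartAt (𝓡 n) x₀).symm.injOn hz.1 hw.1 this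
  rw [← himg, lintegral_image_eq_lintegral_abs_det_fderiv_mul volume hmV
    (fun z hz => (differentiableAt_transition hz.1 (h₁ hz.2)).hasFDerivAt.hasFDerivWithinAt) hinj]
  refine setLIntegral_congr_fun hmV fun z hz => ?_
  rw [volDensity_transition hz.1 (h₁ hz.2), ENNReal.ofReal_mul (abs_nonneg _)]

omit [IsManifold (𝓡 n) ∞ M]
  [IsContMDiffRiemannianBundle (𝓡 n) ∞ (Eucl n) (fun x : M => TangentSpace (𝓡 n) x)] in
theorem chartVolume_compl_source (x₀ : M) :
    chartVolume (n := n) x₀ (extChartAt (𝓡 n) x₀).sourceᶜ = 0 := by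
  rw [chartVolume_apply x₀ (isOpen_extChartAt_source x₀).measurableSet.compl]
  have : (extChartAt (𝓡 n) x₀).target ∩
      (extChartAt (𝓡 n) x₀).symm ⁻¹' (extChartAt (𝓡 n) x₀).sourceᶜ = ∅ := by
    ext z
    simp only [mem_inter_iff, mem_preimage, mem_compl_iff, mem_empty_iff_false, iff_false, not_and,
      not_not]
    exact fun hz => (extChartAt (𝓡 n) x₀).map_target hz
  rw [this, Measure.restrict_empty, lintegral_zero_measure]

omit [IsManifold (𝓡 n) ∞ M] [BorelSpace M]
  [IsContMDiffRiemannianBundle (𝓡 n) ∞ (Eucl n) (fun x : M => TangentSpace (𝓡 n) x)] in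
theorem chartVolume_le_riemannianVolume (x₀ : M) (A : Set M) :
    chartVolume (n := n) x₀ A ≤ riemannianVolume n M A :=
  Measure.le_iff'.1 (le_iSup (fun x : M => chartVolume (n := n) x) x₀) A

omit
  [IsContMDiffRiemannianBundle (𝓡 n) ∞ (Eucl n) (fun x : M => TangentSpace (𝓡 n) x)] in
-- This makes the supremum of the chart measures computable: within one chart domain no other chart
-- contributes more, by agreement on overlaps.
theorem riemannianVolume_restrict_source (x₀ : M) :
    (riemannianVolume n M).restrict (extChartAt (𝓡 n) x₀).source =
      chartVolume (n := n) x₀ := by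
  set S := (extChartAt (𝓡 n) x₀).source with hS
  have hmS : MeasurableSet S := (isOpen_extChartAt_source x₀).measurableSet
  -- The right side is an upper bound for every chart measure, hence for their least upper bound.
  have hle : riemannianVolume n M ≤ chartVolume (n := n) x₀ + (riemannianVolume n M).restrict Sᶜ := by
    refine iSup_le fun x => Measure.le_iff.2 fun A hA => ?_
    rw [← measure_inter_add_sdiff A hmS, Measure.add_apply, Measure.restrict_apply hA, sdiff_eq]
    refine add_le_add ?_ (chartVolume_le_riemannianVolume (n := n) x _)
    set B := A ∩ S ∩ (extChartAt (𝓡 n) x).source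
    have h1 : chartVolume (n := n) x (A ∩ S) = chartVolume (n := n) x B := by
      have hnull : chartVolume (n := n) x ((A ∩ S) \ (extChartAt (𝓡 n) x).source) = 0 :=
        measure_mono_null (fun y hy => hy.2) (chartVolume_compl_source (n := n) x)
      rw [← measure_inter_add_sdiff (A ∩ S) (isOpen_extChartAt_source (I := 𝓡 n) x).measurableSet,
        hnull, add_zero]
    rw [h1, chartVolume_overlap (n := n) x x₀
      ((hA.inter hmS).inter (isOpen_extChartAt_source x).measurableSet)
      (fun y hy => hy.2) (fun y hy => hy.1.2)]
    exact measure_mono fun y hy => hy.1.1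
  apply le_antisymm
  · have h1 := Measure.restrict_mono (subset_refl S) hle
    rw [Measure.restrict_add, Measure.restrict_restrict hmS, inter_compl_self,
      Measure.restrict_empty, add_zero] at h1
    exact h1.trans Measure.restrict_le_self
  · refine Measure.le_iff.2 fun A hA => ?_
    rw [Measure.restrict_apply hA, ← measure_inter_add_sdiff A hmS,
      measure_mono_null (s := A \ S) (t := Sᶜ) (fun y hy => hy.2)
        (chartVolume_compl_source x₀), add_zero]
    exact chartVolume_le_riemannianVolume x₀ _

theorem setIntegral_source_eq (x₀ : M) {F : M → ℝ}
    (hF : AEStronglyMeasurable F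
      ((riemannianVolume n M).restrict (extChartAt (𝓡 n) x₀).source)) :
    ∫ x in (extChartAt (𝓡 n) x₀).source, F x ∂(riemannianVolume n M) =
      ∫ z in (extChartAt (𝓡 n) x₀).target, volDensity x₀ z * F ((extChartAt (𝓡 n) x₀).symm z) := by
  rw [riemannianVolume_restrict_source] at hF ⊢
  have h0 := (aemeasurable_chart_symm (n := n) x₀).mono_ac
    (withDensity_absolutelyContinuous _ (fun z => ENNReal.ofReal (volDensity x₀ z)))
  rw [chartVolume, integral_map h0 hF, integral_withDensity_eq_integral_toReal_smul₀
    (aemeasurable_ofReal_volDensity x₀) (Eventually.of_forall fun _ => ENNReal.ofReal_lt_top)]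
  refine integral_congr_ae (Eventually.of_forall fun z => ?_)
  simp only [smul_eq_mul]
  rw [ENNReal.toReal_ofReal (show 0 ≤ volDensity x₀ z from Real.sqrt_nonneg _)]

instance isLocallyFiniteMeasure_riemannianVolume :
    IsLocallyFiniteMeasure (riemannianVolume n M) := by
  refine ⟨fun x => ?_⟩
  have hT := extChartAt_target_mem_nhds (I := 𝓡 n) x
  obtain ⟨r, hr, hrT⟩ := Metric.nhds_basis_closedBall.mem_iff.1 hT
  have hmem : (extChartAt (𝓡 n) x).source ∩
      (extChartAt (𝓡 n) x) ⁻¹' (Metric.ball (extChartAt (𝓡 n) x x) r) ∈ 𝓝 x :=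
    inter_mem (extChartAt_source_mem_nhds x)
      ((continuousAt_extChartAt x).preimage_mem_nhds (Metric.ball_mem_nhds _ hr))
  have hopen : IsOpen ((extChartAt (𝓡 n) x).source ∩
      (extChartAt (𝓡 n) x) ⁻¹' (Metric.ball (extChartAt (𝓡 n) x x) r)) :=
    (continuousOn_extChartAt x).isOpen_inter_preimage (isOpen_extChartAt_source x)
      Metric.isOpen_ball
  refine ⟨_, hmem, ?_⟩
  rw [← inter_eq_self_of_subset_left (inter_subset_left (s := (extChartAt (𝓡 n) x).source)
    (t := (extChartAt (𝓡 n) x) ⁻¹' (Metric.ball (extChartAt (𝓡 n) x x) r))),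
    ← Measure.restrict_apply hopen.measurableSet, riemannianVolume_restrict_source,
    chartVolume_apply x hopen.measurableSet]
  have hint : IntegrableOn (volDensity x) (Metric.closedBall (extChartAt (𝓡 n) x x) r) :=
    ((contDiffOn_volDensity x).continuousOn.mono hrT).integrableOn_compact
      (isCompact_closedBall _ _)
  refine lt_of_le_of_lt (lintegral_mono_set ?_) hint.lintegral_lt_top
  rintro z ⟨hz, -, hz2⟩
  rw [mem_preimage, (extChartAt (𝓡 n) x).right_inv hz] at hz2
  exact Metric.ball_subset_closedBall hz2

/-- The density is positive. This lets continuous functions that agree almost everywhere be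
identified, and makes `I` positive when the slice is not identically zero. -/
instance isOpenPosMeasure_riemannianVolume :
    (riemannianVolume n M).IsOpenPosMeasure := by
  refine ⟨fun U hU hne h0 => ?_⟩
  obtain ⟨x, hx⟩ := hne
  have h1 : chartVolume (n := n) x U = 0 := by
    rw [← riemannianVolume_restrict_source]
    exact le_antisymm ((Measure.restrict_apply_le _ _).trans h0.le) zero_le
  rw [chartVolume_apply x hU.measurableSet] at h1
  have hV : IsOpen ((extChartAt (𝓡 n) x).target ∩ (extChartAt (𝓡 n) x).symm ⁻¹' U) :=
    (continuousOn_extChartAt_symm x).isOpen_inter_preimage (isOpen_chart_target x) hU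
  have hVne : ((extChartAt (𝓡 n) x).target ∩ (extChartAt (𝓡 n) x).symm ⁻¹' U).Nonempty :=
    ⟨extChartAt (𝓡 n) x x, mem_extChartAt_target x, by simpa using hx⟩
  have h2 := (setLIntegral_eq_zero_iff' hV.measurableSet
    ((aemeasurable_ofReal_volDensity x).mono_set inter_subset_left)).1 h1
  have h3 : ∀ᵐ z ∂(volume : Measure (Eucl n)), z ∉ (extChartAt (𝓡 n) x).target ∩
      (extChartAt (𝓡 n) x).symm ⁻¹' U := by
    filter_upwards [h2] with z hz hzV
    exact absurd (hz hzV) (ENNReal.ofReal_pos.2 (volDensity_pos hzV.1)).ne'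
  have h4 : volume ((extChartAt (𝓡 n) x).target ∩ (extChartAt (𝓡 n) x).symm ⁻¹' U) = 0 := by
    rw [← compl_mem_ae_iff]
    exact h3
  exact (hV.measure_pos volume hVne).ne' h4

end Volume

end DriftHeat

/-! ### The Laplacian in charts and its weak form -/

namespace DriftHeat

theorem integrable_lineDeriv_mul {n : ℕ} {h g : Eucl n → ℝ} {K : NNReal} (hh : LipschitzWith K h)
    (hg : Continuous g) (hgc : HasCompactSupport g) (v : Eucl n) :
    Integrable (fun z => lineDeriv ℝ h z v * g z) :=
  (hg.integrable_of_hasCompactSupport hgc).bdd_mul (c := K * ‖v‖)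
    (measurable_lineDeriv hh.continuous).aestronglyMeasurable
    (Eventually.of_forall fun _ => norm_lineDeriv_le_of_lipschitz ℝ hh)

/-- The divergence theorem for a `C¹` vector field with compact support, tested against a Lipschitz
function. -/
theorem integral_lipschitz_mul_div {n : ℕ} {h : Eucl n → ℝ} {K : NNReal} (hh : LipschitzWith K h)
    {Y : Eucl n → Eucl n} (hY : ContDiff ℝ 1 Y) (hYc : HasCompactSupport Y) :
    ∫ z, h z * ∑ i, fderiv ℝ (fun z => Y z i) z (EuclideanSpace.single i 1) =
      -∫ z, fderiv ℝ h z (Y z) := by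
  have hYi : ∀ i, ContDiff ℝ 1 (fun z => Y z i) := fun i => contDiff_euclidean.1 hY i
  have hYci : ∀ i, HasCompactSupport (fun z => Y z i) := fun i =>
    hYc.comp_left (g := fun y : Eucl n => y i) rfl
  -- Rademacher: almost everywhere the total derivative exists and is assembled from the line
  -- derivatives, for which one-dimensional integration by parts is available.
  have hdiff : ∀ᵐ z : Eucl n, fderiv ℝ h z (Y z) =
      ∑ i, lineDeriv ℝ h z (EuclideanSpace.single i 1) * Y z i := by
    filter_upwards [hh.ae_differentiableAt] with z hz
    rw [map_eucl_eq_sum (fderiv ℝ h z) (Y z)]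
    refine Finset.sum_congr rfl fun i _ => ?_
    rw [hz.lineDeriv_eq_fderiv, smul_eq_mul, mul_comm]
  rw [integral_congr_ae hdiff, integral_finsetSum _ fun i _ =>
    integrable_lineDeriv_mul hh (hYi i).continuous (hYci i) _, ← Finset.sum_neg_distrib]
  simp only [Finset.mul_sum]
  rw [integral_finsetSum]
  · refine Finset.sum_congr rfl fun i _ => ?_
    obtain ⟨D, hD⟩ := (hYi i).lipschitzWith_of_hasCompactSupport (hYci i) one_ne_zero
    rw [hh.integral_lineDeriv_mul_eq hD (hYci i), ← integral_neg]
    refine integral_congr_ae (Eventually.of_forall fun z => ?_)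
    simp only [lineDeriv_neg]
    rw [((hYi i).differentiable one_ne_zero z).lineDeriv_eq_fderiv]
    ring
  · intro i _
    refine Continuous.integrable_of_hasCompactSupport
      (hh.continuous.mul (((hYi i).continuous_fderiv one_ne_zero).clm_apply continuous_const)) ?_
    exact ((hYci i).fderiv_apply ℝ _).mul_left

section Laplacian

variable {n : ℕ} {M : Type*} [TopologicalSpace M] [ChartedSpace (Eucl n) M]
  [RiemannianBundle (fun x : M => TangentSpace (𝓡 n) x)]

/-- The expression of `Δ f` in the chart around `x₀`. -/
noncomputable def coordLaplacian (x₀ : M) (f : M → ℝ) (z : Eucl n) : ℝ :=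
  (volDensity x₀ z)⁻¹ * ∑ i : Fin n, fderiv ℝ
    (fun z : Eucl n => volDensity x₀ z * coordField x₀ (grad (n := n) f) z i) z
      (EuclideanSpace.single i (1 : ℝ))

theorem laplacian_eq_coordLaplacian (f : M → ℝ) (x : M) :
    laplacian (n := n) f x = coordLaplacian x f (extChartAt (𝓡 n) x x) := rfl

variable [IsManifold (𝓡 n) ∞ M]
  [IsContMDiffRiemannianBundle (𝓡 n) ∞ (Eucl n) (fun x : M => TangentSpace (𝓡 n) x)]

theorem contDiffOn_volDensity_mul_coordField {f : M → ℝ} (hf : ContMDiff (𝓡 n) 𝓘(ℝ, ℝ) ∞ f)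
    (x₀ : M) (i : Fin n) :
    ContDiffOn ℝ ∞ (fun z => volDensity x₀ z * coordField x₀ (grad (n := n) f) z i)
      (extChartAt (𝓡 n) x₀).target :=
  (contDiffOn_volDensity x₀).mul (contDiffOn_coordField_grad hf x₀ i)

theorem continuousOn_coordLaplacian {f : M → ℝ} (hf : ContMDiff (𝓡 n) 𝓘(ℝ, ℝ) ∞ f) (x₀ : M) :
    ContinuousOn (coordLaplacian (n := n) x₀ f) (extChartAt (𝓡 n) x₀).target := by
  refine ((contDiffOn_volDensity x₀).continuousOn.inv₀
    fun z hz => (volDensity_pos hz).ne').mul (continuousOn_finsetSum _ fun i _ => ?_)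
  exact ((contDiffOn_volDensity_mul_coordField hf x₀ i).continuousOn_fderiv_of_isOpen
    (isOpen_chart_target x₀) (by simp)).clm_apply continuousOn_const

/-- The field `ρ √(det g) ∇f`, extended by zero outside the chart, is `C¹` with compact support, and
its Euclidean divergence is `√(det g) (ρ Δf + ⟨∇ρ, ∇f⟩)`. The Lipschitz divergence theorem therefore
applies to it. -/
theorem integral_lipschitz_mul_coordLaplacian [T2Space M] (x₀ : M) {f ρ : M → ℝ}
    (hf : ContMDiff (𝓡 n) 𝓘(ℝ, ℝ) ∞ f) (hρ : ContMDiff (𝓡 n) 𝓘(ℝ, ℝ) ∞ ρ)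
    (hρc : HasCompactSupport ρ) (hρs : tsupport ρ ⊆ (extChartAt (𝓡 n) x₀).source)
    {h : Eucl n → ℝ} {K : NNReal} (hh : LipschitzWith K h) :
    ∫ z in (extChartAt (𝓡 n) x₀).target, volDensity x₀ z *
        (h z * (ρ ((extChartAt (𝓡 n) x₀).symm z) * coordLaplacian x₀ f z +
        inner ℝ (grad (n := n) ρ ((extChartAt (𝓡 n) x₀).symm z))
          (grad (n := n) f ((extChartAt (𝓡 n) x₀).symm z)))) =
      -∫ z in (extChartAt (𝓡 n) x₀).target, volDensity x₀ z *
        (ρ ((extChartAt (𝓡 n) x₀).symm z) *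
          fderiv ℝ h z (coordField x₀ (grad (n := n) f) z)) := by
  classical
  set T := (extChartAt (𝓡 n) x₀).target with hT
  have hTo : IsOpen T := isOpen_chart_target x₀
  set ψ := (extChartAt (𝓡 n) x₀).symm with hψ
  set Y : Eucl n → Eucl n := T.indicator fun z =>
    (ρ (ψ z) * volDensity x₀ z) • coordField x₀ (grad (n := n) f) z with hY
  set S : Set (Eucl n) := extChartAt (𝓡 n) x₀ '' tsupport ρ with hS
  have hSc : IsCompact S := hρc.isCompact.image_of_continuousOn
    ((continuousOn_extChartAt x₀).mono hρs)
  have hY0 : ∀ z ∉ S, Y z = 0 := by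
    intro z hz
    rw [hY, indicator_apply]
    split_ifs with hzT
    · have : ρ (ψ z) = 0 := by
        by_contra hne
        exact hz ⟨ψ z, subset_tsupport _ hne, (extChartAt (𝓡 n) x₀).right_inv hzT⟩
      rw [this, zero_mul, zero_smul]
    · rfl
  have hYT : ∀ z ∈ T, Y =ᶠ[𝓝 z] fun z =>
      (ρ (ψ z) * volDensity x₀ z) • coordField x₀ (grad (n := n) f) z := by
    intro z hz
    filter_upwards [hTo.mem_nhds hz] with w hw
    rw [hY, indicator_of_mem hw]
  have hYsm : ContDiff ℝ 1 Y := by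
    rw [contDiff_iff_contDiffAt]
    intro z
    -- `Y` is smooth near the compact image of the support of `ρ`, which lies in the open target,
    -- and it vanishes near every other point.
    by_cases hz : z ∈ S
    · have hzT : z ∈ T := by
        obtain ⟨x, hx, rfl⟩ := hz
        exact (extChartAt (𝓡 n) x₀).map_source (hρs hx)
      refine ContDiffAt.congr_of_eventuallyEq ?_ (hYT z hzT)
      have h1 : ContDiffOn ℝ ∞ (fun z => (ρ (ψ z) * volDensity x₀ z) •
          coordField x₀ (grad (n := n) f) z) T :=
        ((contDiffOn_comp_chart_symm hρ x₀).mul (contDiffOn_volDensity x₀)).smul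
          (contDiffOn_euclidean.2 fun i => contDiffOn_coordField_grad hf x₀ i)
      exact (h1.contDiffAt (hTo.mem_nhds hzT)).of_le (by simp)
    · refine ContDiffAt.congr_of_eventuallyEq (contDiffAt_const (c := 0)) ?_
      filter_upwards [hSc.isClosed.isOpen_compl.mem_nhds hz] with w hw using hY0 w hw
  have hYc : HasCompactSupport Y := HasCompactSupport.intro hSc hY0
  have key := integral_lipschitz_mul_div hh hYsm hYc
  have hleft : ∀ z, z ∉ T → h z * ∑ i, fderiv ℝ (fun z => Y z i) z (EuclideanSpace.single i 1)
      = 0 := by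
    intro z hz
    have hzS : z ∉ S := by
      rintro ⟨x, hx, rfl⟩
      exact hz ((extChartAt (𝓡 n) x₀).map_source (hρs hx))
    rw [Finset.sum_eq_zero, mul_zero]
    intro i _
    have : (fun z => Y z i) =ᶠ[𝓝 z] fun _ => 0 := by
      filter_upwards [hSc.isClosed.isOpen_compl.mem_nhds hzS] with w hw
      rw [hY0 w hw]
      rfl
    rw [this.fderiv_eq]
    simp
  have hright : ∀ z, z ∉ T → fderiv ℝ h z (Y z) = 0 := by
    intro z hz
    rw [hY, indicator_of_notMem hz, map_zero]
  have e1 := setIntegral_eq_integral_of_forall_compl_eq_zero (μ := volume) hleft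
  have e2 := setIntegral_eq_integral_of_forall_compl_eq_zero (μ := volume) hright
  rw [← e1, ← e2] at key
  refine Eq.trans (setIntegral_congr_fun hTo.measurableSet ?_) (key.trans ?_)
  rotate_left
  · congr 1
    refine setIntegral_congr_fun hTo.measurableSet fun z hz => ?_
    simp only [hY, indicator_of_mem hz, map_smul, smul_eq_mul]
    ring
  · intro z hz
    have hρd : DifferentiableAt ℝ (ρ ∘ ψ) z :=
      ((contDiffOn_comp_chart_symm hρ x₀).contDiffAt (hTo.mem_nhds hz)).differentiableAt (by simp)
    have hXd : ∀ i, DifferentiableAt ℝ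
        (fun z => volDensity x₀ z * coordField x₀ (grad (n := n) f) z i) z := fun i =>
      ((contDiffOn_volDensity_mul_coordField hf x₀ i).contDiffAt
        (hTo.mem_nhds hz)).differentiableAt (by simp)
    have h1 : ∀ i, fderiv ℝ (fun z => Y z i) z (EuclideanSpace.single i 1) =
        ρ (ψ z) * fderiv ℝ (fun z => volDensity x₀ z * coordField x₀ (grad (n := n) f) z i) z
          (EuclideanSpace.single i 1) +
        volDensity x₀ z * (coordField x₀ (grad (n := n) f) z i *
          fderiv ℝ (ρ ∘ ψ) z (EuclideanSpace.single i 1)) := by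
      intro i
      have he : (fun z => Y z i) =ᶠ[𝓝 z] (ρ ∘ ψ) * fun z =>
          volDensity x₀ z * coordField x₀ (grad (n := n) f) z i := by
        filter_upwards [hYT z hz] with w hw
        rw [hw]
        simp only [PiLp.smul_apply, smul_eq_mul, Pi.mul_apply, Function.comp_apply]
        ring
      rw [he.fderiv_eq, fderiv_mul hρd (hXd i)]
      simp only [add_apply, FunLike.coe_smul, Pi.smul_apply, smul_eq_mul,
        Function.comp_apply]
      ring
    simp only [h1]
    rw [inner_grad_eq_fderiv hz (hρ.mdifferentiable (by simp) _),
      map_eucl_eq_sum (fderiv ℝ (ρ ∘ ψ) z), Finset.sum_add_distrib, ← Finset.mul_sum,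
      ← Finset.mul_sum, coordLaplacian]
    have := (volDensity_pos hz).ne'
    simp only [smul_eq_mul]
    field_simp

omit [IsManifold (𝓡 n) ∞ M]
  [IsContMDiffRiemannianBundle (𝓡 n) ∞ (Eucl n) (fun x : M => TangentSpace (𝓡 n) x)] in
theorem grad_eq_zero_of_notMem_tsupport {ρ : M → ℝ} {x : M} (hx : x ∉ tsupport ρ) :
    grad (n := n) ρ x = 0 := by
  have h : ρ =ᶠ[𝓝 x] fun _ => 0 := notMem_tsupport_iff_eventuallyEq.1 hx
  rw [grad, h.mfderiv_eq, mfderiv_const]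
  exact map_zero _

variable [T2Space M] [MeasurableSpace M] [BorelSpace M]

theorem integral_lipschitz_mul_coordLaplacian_source (x₀ : M) {f ρ : M → ℝ}
    (hf : ContMDiff (𝓡 n) 𝓘(ℝ, ℝ) ∞ f) (hρ : ContMDiff (𝓡 n) 𝓘(ℝ, ℝ) ∞ ρ)
    (hρc : HasCompactSupport ρ) (hρs : tsupport ρ ⊆ (extChartAt (𝓡 n) x₀).source)
    {h : Eucl n → ℝ} {K : NNReal} (hh : LipschitzWith K h) :
    ∫ x, h (extChartAt (𝓡 n) x₀ x) * (ρ x * coordLaplacian x₀ f (extChartAt (𝓡 n) x₀ x) +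
        inner ℝ (grad (n := n) ρ x) (grad (n := n) f x)) ∂(riemannianVolume n M) =
      -∫ z in (extChartAt (𝓡 n) x₀).target, volDensity x₀ z *
        (ρ ((extChartAt (𝓡 n) x₀).symm z) *
          fderiv ℝ h z (coordField x₀ (grad (n := n) f) z)) := by
  have hc : ContinuousOn (fun x => h (extChartAt (𝓡 n) x₀ x) *
      (ρ x * coordLaplacian x₀ f (extChartAt (𝓡 n) x₀ x) +
        inner ℝ (grad (n := n) ρ x) (grad (n := n) f x))) (extChartAt (𝓡 n) x₀).source := by
    have h1 := continuousOn_extChartAt (I := 𝓡 n) x₀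
    refine (hh.continuous.comp_continuousOn h1).mul ((hρ.continuous.continuousOn.mul
      ((continuousOn_coordLaplacian hf x₀).comp h1 (extChartAt (𝓡 n) x₀).mapsTo)).add
        (continuous_inner_grad hρ hf).continuousOn)
  rw [← integral_lipschitz_mul_coordLaplacian x₀ hf hρ hρc hρs hh,
    ← setIntegral_eq_integral_of_forall_compl_eq_zero (s := (extChartAt (𝓡 n) x₀).source),
    setIntegral_source_eq x₀
      (hc.aestronglyMeasurable (isOpen_extChartAt_source x₀).measurableSet)]
  · refine setIntegral_congr_fun (isOpen_chart_target x₀).measurableSet fun z hz => ?_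
    simp only [(extChartAt (𝓡 n) x₀).right_inv hz]
  · intro x hx
    have hx' : x ∉ tsupport ρ := fun h => hx (hρs h)
    rw [grad_eq_zero_of_notMem_tsupport hx', image_eq_zero_of_notMem_tsupport hx', inner_zero_left]
    ring

theorem integrable_mul_of_continuousOn_tsupport {g F : M → ℝ} (hg : Continuous g)
    (hgc : HasCompactSupport g) (hF : ContinuousOn F (tsupport g)) :
    Integrable (fun x => g x * F x) (riemannianVolume n M) := by
  rw [← integrableOn_iff_integrable_of_support_subset (s := tsupport g)]
  · exact (hg.continuousOn.mul hF).integrableOn_compact hgc.isCompact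
  · exact (Function.support_mul_subset_left _ _).trans (subset_tsupport g)

omit [IsManifold (𝓡 n) ∞ M]
  [IsContMDiffRiemannianBundle (𝓡 n) ∞ (Eucl n) (fun x : M => TangentSpace (𝓡 n) x)]
  [MeasurableSpace M] [BorelSpace M] in
theorem hasCompactSupport_inner_grad {ρ : M → ℝ} (f : M → ℝ) (hρc : HasCompactSupport ρ) :
    HasCompactSupport fun x => inner ℝ (grad (n := n) ρ x) (grad (n := n) f x) := by
  refine HasCompactSupport.intro hρc.isCompact fun x hx => ?_
  rw [grad_eq_zero_of_notMem_tsupport hx, inner_zero_left]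

/-- The case `h = 1` of the Lipschitz identity. Its right side no longer mentions the chart, which
is what chart independence rests on. -/
theorem integral_mul_coordLaplacian (x₀ : M) {f ρ : M → ℝ}
    (hf : ContMDiff (𝓡 n) 𝓘(ℝ, ℝ) ∞ f) (hρ : ContMDiff (𝓡 n) 𝓘(ℝ, ℝ) ∞ ρ)
    (hρc : HasCompactSupport ρ) (hρs : tsupport ρ ⊆ (extChartAt (𝓡 n) x₀).source) :
    Integrable (fun x => ρ x * coordLaplacian x₀ f (extChartAt (𝓡 n) x₀ x))
      (riemannianVolume n M) ∧
    ∫ x, ρ x * coordLaplacian x₀ f (extChartAt (𝓡 n) x₀ x) ∂(riemannianVolume n M) =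
      -∫ x, inner ℝ (grad (n := n) ρ x) (grad (n := n) f x) ∂(riemannianVolume n M) := by
  have h1 := integral_lipschitz_mul_coordLaplacian_source x₀ hf hρ hρc hρs
    (LipschitzWith.const (1 : ℝ))
  have hi : Integrable (fun x => ρ x * coordLaplacian x₀ f (extChartAt (𝓡 n) x₀ x))
      (riemannianVolume n M) := integrable_mul_of_continuousOn_tsupport hρ.continuous hρc
    ((continuousOn_coordLaplacian hf x₀).comp ((continuousOn_extChartAt x₀).mono hρs)
      fun x hx => (extChartAt (𝓡 n) x₀).map_source (hρs hx))
  refine ⟨hi, ?_⟩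
  simp only [one_mul, fderiv_fun_const, Pi.zero_apply, zero_apply, mul_zero,
    integral_zero, neg_zero] at h1
  rw [integral_add hi ((continuous_inner_grad hρ hf).integrable_of_hasCompactSupport
    (hasCompactSupport_inner_grad f hρc))] at h1
  linarith

/-- Both coordinate expressions have the same integral against every test function supported in the
overlap, so they agree almost everywhere there, and everywhere by continuity. No computation with
second derivatives of the transition map is needed. -/
theorem coordLaplacian_eq_coordLaplacian [SecondCountableTopology M] {f : M → ℝ}
    (hf : ContMDiff (𝓡 n) 𝓘(ℝ, ℝ) ∞ f) {x₀ x₁ y : M}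
    (h₀ : y ∈ (extChartAt (𝓡 n) x₀).source) (h₁ : y ∈ (extChartAt (𝓡 n) x₁).source) :
    coordLaplacian x₀ f (extChartAt (𝓡 n) x₀ y) = coordLaplacian x₁ f (extChartAt (𝓡 n) x₁ y) := by
  set U : Set M := (extChartAt (𝓡 n) x₀).source ∩ (extChartAt (𝓡 n) x₁).source with hU
  have hUo : IsOpen U := (isOpen_extChartAt_source x₀).inter (isOpen_extChartAt_source x₁)
  have hc : ∀ x : M, ContinuousOn (fun y => coordLaplacian x f (extChartAt (𝓡 n) x y))
      (extChartAt (𝓡 n) x).source := fun x =>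
    (continuousOn_coordLaplacian hf x).comp (continuousOn_extChartAt x)
      (extChartAt (𝓡 n) x).mapsTo
  have hc' : ContinuousOn (fun y => coordLaplacian x₀ f (extChartAt (𝓡 n) x₀ y) -
      coordLaplacian x₁ f (extChartAt (𝓡 n) x₁ y)) U :=
    ((hc x₀).mono inter_subset_left).sub ((hc x₁).mono inter_subset_right)
  have hlc : LocallyCompactSpace M := ChartedSpace.locallyCompactSpace (Eucl n) M
  have hae := hUo.ae_eq_zero_of_integral_contMDiff_smul_eq_zero (𝓡 n)
    (μ := riemannianVolume n M) (hc'.locallyIntegrableOn hUo.measurableSet) fun g hg hgc hgU => by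
      obtain ⟨i₀, e₀⟩ := integral_mul_coordLaplacian x₀ hf hg hgc (hgU.trans inter_subset_left)
      obtain ⟨i₁, e₁⟩ := integral_mul_coordLaplacian x₁ hf hg hgc (hgU.trans inter_subset_right)
      simp only [smul_eq_mul, mul_sub]
      rw [integral_sub i₀ i₁, e₀, e₁, sub_self]
  have hz := Measure.eqOn_open_of_ae_eq (μ := riemannianVolume n M) (g := fun _ => 0)
    ((ae_restrict_iff' hUo.measurableSet).2 hae) hUo hc' continuousOn_const ⟨h₀, h₁⟩
  exact sub_eq_zero.1 hz

theorem laplacian_eq_coordLaplacian_of_mem [SecondCountableTopology M] {f : M → ℝ}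
    (hf : ContMDiff (𝓡 n) 𝓘(ℝ, ℝ) ∞ f) {x₀ y : M} (h₀ : y ∈ (extChartAt (𝓡 n) x₀).source) :
    laplacian (n := n) f y = coordLaplacian x₀ f (extChartAt (𝓡 n) x₀ y) := by
  rw [laplacian_eq_coordLaplacian]
  exact coordLaplacian_eq_coordLaplacian hf (mem_extChartAt_source y) h₀

theorem continuous_laplacian [SecondCountableTopology M] {f : M → ℝ}
    (hf : ContMDiff (𝓡 n) 𝓘(ℝ, ℝ) ∞ f) : Continuous (laplacian (n := n) f) := by
  refine continuous_of_comp_chart_symm (n := n) fun x₀ =>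
    (continuousOn_coordLaplacian hf x₀).congr fun z hz => ?_
  rw [Function.comp_apply, laplacian_eq_coordLaplacian_of_mem hf
    ((extChartAt (𝓡 n) x₀).map_target hz), (extChartAt (𝓡 n) x₀).right_inv hz]

theorem integral_lipschitz_mul_laplacian [SecondCountableTopology M] (x₀ : M) {f ρ : M → ℝ}
    (hf : ContMDiff (𝓡 n) 𝓘(ℝ, ℝ) ∞ f) (hρ : ContMDiff (𝓡 n) 𝓘(ℝ, ℝ) ∞ ρ)
    (hρc : HasCompactSupport ρ) (hρs : tsupport ρ ⊆ (extChartAt (𝓡 n) x₀).source)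
    {h : Eucl n → ℝ} {K : NNReal} (hh : LipschitzWith K h) {η : M → ℝ}
    (hη : ∀ x ∈ tsupport ρ, η x = h (extChartAt (𝓡 n) x₀ x)) :
    ∫ x, η x * (ρ x * laplacian (n := n) f x +
        inner ℝ (grad (n := n) ρ x) (grad (n := n) f x)) ∂(riemannianVolume n M) =
      -∫ z in (extChartAt (𝓡 n) x₀).target, volDensity x₀ z *
        (ρ ((extChartAt (𝓡 n) x₀).symm z) *
          fderiv ℝ h z (coordField x₀ (grad (n := n) f) z)) := by
  rw [← integral_lipschitz_mul_coordLaplacian_source x₀ hf hρ hρc hρs hh]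
  refine integral_congr_ae (Eventually.of_forall fun x => ?_)
  by_cases hx : x ∈ tsupport ρ
  · simp only [hη x hx, laplacian_eq_coordLaplacian_of_mem hf (hρs hx)]
  · simp only [grad_eq_zero_of_notMem_tsupport hx, image_eq_zero_of_notMem_tsupport hx,
      inner_zero_left]
    ring

end Laplacian

end DriftHeat

namespace DriftHeat

/-! ### Length spaces and the Hopf–Rinow theorem -/

section Completeness

/-- A Riemannian manifold is a length space. -/
theorem exists_infEDist_le_edist_lt (n : ℕ) {M : Type*} [EMetricSpace M]
    [ChartedSpace (Eucl n) M] [RiemannianBundle (fun x : M => TangentSpace (𝓡 n) x)]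
    [IsRiemannianManifold (𝓡 n) M] {K : Set M} {x : M} {r s : ℝ≥0∞} (hs : 0 < s)
    (h : Metric.infEDist x K < r + s) : ∃ y, Metric.infEDist y K ≤ r ∧ edist y x < s := by
  rcases le_or_gt (Metric.infEDist x K) r with hx | hx
  · exact ⟨x, hx, by simpa using hs⟩
  obtain ⟨p, hp, hxp⟩ := Metric.infEDist_lt_iff.1 h
  rw [edist_comm, IsRiemannianManifold.out (I := 𝓡 n) p x] at hxp
  obtain ⟨γ, h0, h1, hγ, hlen⟩ := exists_lt_of_riemannianEDist_lt hxp
  have hcont : ContinuousOn (fun t => Metric.infEDist (γ t) K) (Icc 0 1) :=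
    Metric.continuous_infEDist.comp_continuousOn hγ.continuousOn
  -- Along an almost shortest path from `K` to `x`, take a point at distance exactly `r` from `K`.
  -- The path up to that point has length at least `r`, so less than `s` remains.
  have hmem : r ∈ Icc (Metric.infEDist (γ 0) K) (Metric.infEDist (γ 1) K) := by
    rw [h0, h1, Metric.infEDist_zero_of_mem hp]
    exact ⟨zero_le, hx.le⟩
  obtain ⟨t, ht, htr⟩ := intermediate_value_Icc zero_le_one hcont hmem
  refine ⟨γ t, htr.le, ?_⟩
  have hA : r ≤ pathELength (𝓡 n) γ 0 t := by
    rw [← htr]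
    refine (Metric.infEDist_le_edist_of_mem hp).trans ?_
    rw [edist_comm, IsRiemannianManifold.out (I := 𝓡 n)]
    exact riemannianEDist_le_pathELength (hγ.mono (Icc_subset_Icc_right ht.2)) h0 rfl ht.1
  have hB : edist (γ t) x ≤ pathELength (𝓡 n) γ t 1 := by
    rw [IsRiemannianManifold.out (I := 𝓡 n)]
    exact riemannianEDist_le_pathELength (hγ.mono (Icc_subset_Icc_left ht.1)) rfl h1 ht.2
  have hsum := pathELength_add (I := 𝓡 n) (γ := γ) ht.1 ht.2
  by_contra hcon
  rw [not_lt] at hcon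
  have : r + s ≤ pathELength (𝓡 n) γ 0 1 := by
    rw [← hsum]
    exact add_le_add hA (hcon.trans hB)
  exact absurd hlen (not_lt.2 this)

/-- The Hopf–Rinow theorem: closed thickenings of compact sets are compact in a complete
Riemannian manifold. -/
theorem isCompact_cthickening (n : ℕ) {M : Type*} [EMetricSpace M]
    [ChartedSpace (Eucl n) M] [RiemannianBundle (fun x : M => TangentSpace (𝓡 n) x)]
    [IsRiemannianManifold (𝓡 n) M] [CompleteSpace M] {K : Set M} (hK : IsCompact K) {δ : ℝ}
    (hδ : 0 ≤ δ) : IsCompact (Metric.cthickening δ K) := by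
  have hlc : LocallyCompactSpace M := ChartedSpace.locallyCompactSpace (Eucl n) M
  set S : Set ℝ := {r | IsCompact (Metric.cthickening r K)} with hS
  have hmono : ∀ r ∈ S, ∀ r' ≤ r, r' ∈ S := fun r hr r' hr' =>
    IsCompact.of_isClosed_subset hr Metric.isClosed_cthickening (Metric.cthickening_mono hr' K)
  have hstep : ∀ r : ℝ, 0 ≤ r → ∀ ε : ℝ, 0 < ε → ∀ x ∈ Metric.cthickening (r + ε) K,
      ∀ ε' > ε, ∃ y ∈ Metric.cthickening r K, edist y x < ENNReal.ofReal ε' := by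
    intro r hr ε hε x hx ε' hε'
    obtain ⟨y, hy, hyx⟩ := exists_infEDist_le_edist_lt n (K := K) (x := x)
      (r := ENNReal.ofReal r) (s := ENNReal.ofReal ε')
      (ENNReal.ofReal_pos.2 (hε.trans hε')) (by
        rw [← ENNReal.ofReal_add hr (hε.trans hε').le]
        refine lt_of_le_of_lt (Metric.mem_cthickening_iff.1 hx) ?_
        exact (ENNReal.ofReal_lt_ofReal_iff (by linarith)).2 (by linarith))
    exact ⟨y, Metric.mem_cthickening_iff.2 hy, hyx⟩
  -- Continuous induction on the radius: the good radii form a closed subset of `[0, δ]` that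
  -- contains `0` and extends to the right of each of its points below `δ`.
  have hmain : Icc 0 δ ⊆ S := by
    refine IsClosed.Icc_subset_of_forall_exists_gt ?_ ?_ ?_
    · rw [← isSeqClosed_iff_isClosed]
      intro u r hu hur
      have hr : r ∈ Icc 0 δ := isClosed_Icc.mem_of_tendsto hur
        (Eventually.of_forall fun k => (hu k).2)
      refine ⟨?_, hr⟩
      -- By completeness, total boundedness is enough. Points of the `r`-thickening lie within `e /
      -- 2` of a compact thickening of radius above `r - e / 4`, and that one has a finite `e /
      -- 2`-net.
      refine TotallyBounded.isCompact_of_isClosed ?_ Metric.isClosed_cthickening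
      rw [EMetric.totallyBounded_iff]
      intro ε hε
      obtain ⟨e, he0, heε⟩ := ENNReal.lt_iff_exists_real_btwn.1 hε
      have he : 0 < e := ENNReal.ofReal_pos.1 heε.1
      obtain ⟨k, hk⟩ := ((tendsto_order.1 hur).1 (r - e / 4) (by linarith)).exists
      obtain ⟨t, htf, ht⟩ := EMetric.totallyBounded_iff.1 (hu k).1.totallyBounded
        (ENNReal.ofReal (e / 2)) (ENNReal.ofReal_pos.2 (by linarith))
      refine ⟨t, htf, fun x hx => ?_⟩
      obtain ⟨y, hy, hyx⟩ := hstep (u k) (hu k).2.1 (e / 4) (by linarith) x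
        (Metric.cthickening_mono (by linarith) K hx) (e / 2) (by linarith)
      obtain ⟨c, hc, hyc⟩ := mem_iUnion₂.1 (ht hy)
      refine mem_iUnion₂.2 ⟨c, hc, ?_⟩
      rw [Metric.mem_eball] at hyc ⊢
      calc edist x c ≤ edist y x + edist y c := by
            rw [edist_comm y x]
            exact edist_triangle _ _ _
        _ < ENNReal.ofReal (e / 2) + ENNReal.ofReal (e / 2) := ENNReal.add_lt_add hyx hyc
        _ = ENNReal.ofReal e := by
            rw [← ENNReal.ofReal_add (by linarith) (by linarith), add_halves]
        _ < ε := heε.2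
    · simp only [hS, mem_ofPred_eq, Metric.cthickening_zero]
      exact hK.closure
    · intro r hr y hy
      -- By local compactness the compact `r`-thickening has itself a compact `e`-thickening, which
      -- contains the thickening of `K` of radius `r + e / 2`. Half of `e` is given up because the
      -- length-space step needs a strict inequality.
      obtain ⟨e, he, hec⟩ := IsCompact.exists_isCompact_cthickening hr.1
      have hy' : r < y := hy
      refine ⟨min y (r + e / 2), ?_, lt_min hy' (by linarith), min_le_left _ _⟩
      refine hmono (r + e / 2) ?_ _ (min_le_right _ _)
      refine IsCompact.of_isClosed_subset hec Metric.isClosed_cthickening fun x hx => ?_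
      obtain ⟨c, hc, hcx⟩ := hstep r hr.2.1 (e / 2) (by linarith) x hx e (by linarith)
      refine Metric.mem_cthickening_of_edist_le x c e _ hc ?_
      rw [edist_comm]
      exact hcx.le
  exact hmain ⟨hδ, le_rfl⟩

end Completeness

/-! ### Riemannian distance and Lipschitz functions in charts -/

section Speed

variable {n : ℕ} {M : Type*} [EMetricSpace M] [ChartedSpace (Eucl n) M]
  [IsManifold (𝓡 n) ∞ M] [RiemannianBundle (fun x : M => TangentSpace (𝓡 n) x)]

/-- The inverse chart maps the segment from `z` to `z'` to a path of speed at most `B` over unit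
time, so its length is at most `B`. -/
theorem edist_chart_symm_le [IsRiemannianManifold (𝓡 n) M] {x₀ : M} {W : Set (Eucl n)}
    (hW : Convex ℝ W)
    (hWT : W ⊆ (extChartAt (𝓡 n) x₀).target) {z z' : Eucl n} (hz : z ∈ W) (hz' : z' ∈ W) {B : ℝ}
    (hB : ∀ w ∈ W, ‖chartDeriv x₀ w (z' - z)‖ ≤ B) :
    edist ((extChartAt (𝓡 n) x₀).symm z) ((extChartAt (𝓡 n) x₀).symm z') ≤ ENNReal.ofReal B := by
  let ℓ : ℝ → Eucl n := fun t => z + t • (z' - z)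
  have hℓ : ∀ t ∈ Icc (0 : ℝ) 1, ℓ t ∈ W := fun t ht => hW.add_smul_sub_mem hz hz' ht
  have hℓs : ContDiff ℝ 1 ℓ := by fun_prop
  have hℓd : ∀ t, HasDerivAt ℓ (z' - z) t := fun t => by
    have h := ((hasDerivAt_id t).smul_const (z' - z)).const_add z
    rw [one_smul] at h
    exact h
  set γ : ℝ → M := fun t => (extChartAt (𝓡 n) x₀).symm (ℓ t) with hγ
  have hγs : ContMDiffOn 𝓘(ℝ, ℝ) (𝓡 n) 1 γ (Icc 0 1) :=
    (contMDiffOn_extChartAt_symm x₀).comp (contMDiffOn_iff_contDiffOn.2 hℓs.contDiffOn)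
      fun t ht => hWT (hℓ t ht)
  rw [IsRiemannianManifold.out (I := 𝓡 n)]
  refine (riemannianEDist_le_pathELength (I := 𝓡 n) (γ := γ) hγs (by simp [hγ, ℓ])
    (by simp [hγ, ℓ]) zero_le_one).trans ?_
  rw [pathELength_eq_lintegral_mfderiv_Icc]
  have hle : ∀ t ∈ Icc (0 : ℝ) 1, ‖mfderiv 𝓘(ℝ, ℝ) (𝓡 n) γ t (1 : ℝ)‖ₑ ≤ ENNReal.ofReal B := by
    intro t ht
    have h1 := mfderiv_comp t (mdifferentiableAt_chart_symm (hWT (hℓ t ht)))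
      (hℓd t).differentiableAt.mdifferentiableAt
    rw [mfderiv_eq_fderiv] at h1
    have h2 : mfderiv 𝓘(ℝ, ℝ) (𝓡 n) γ t (1 : ℝ) = chartDeriv x₀ (ℓ t) (z' - z) := by
      have h3 := congr($h1 (1 : ℝ))
      refine h3.trans (congrArg (chartDeriv x₀ (ℓ t)) ?_)
      exact (fderiv_apply_one_eq_deriv (f := ℓ) (x := t)).trans (hℓd t).deriv
    rw [h2, ← ofReal_norm]
    exact ENNReal.ofReal_le_ofReal (hB _ (hℓ t ht))
  refine (setLIntegral_mono' measurableSet_Icc hle).trans ?_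
  simp

variable [IsContMDiffRiemannianBundle (𝓡 n) ∞ (Eucl n) (fun x : M => TangentSpace (𝓡 n) x)]

theorem continuousOn_norm_chartDeriv (x₀ : M) (v : Eucl n) :
    ContinuousOn (fun z => ‖chartDeriv x₀ z v‖) (extChartAt (𝓡 n) x₀).target := by
  simp only [norm_eq_sqrt_real_inner, inner_chartDeriv]
  refine ContinuousOn.sqrt (continuousOn_finsetSum _ fun i _ => continuousOn_finsetSum _
    fun j _ => continuousOn_const.mul (contDiffOn_gram x₀ i j).continuousOn)

variable [IsRiemannianManifold (𝓡 n) M]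

/-- In a small ball around the centre of a chart, distances are bounded by Euclidean distances. -/
theorem exists_ball_lipschitzOnWith_chart_symm (x₀ : M) :
    ∃ r > 0, Metric.ball (extChartAt (𝓡 n) x₀ x₀) r ⊆ (extChartAt (𝓡 n) x₀).target ∧
      ∃ L : NNReal, LipschitzOnWith L (extChartAt (𝓡 n) x₀).symm
        (Metric.ball (extChartAt (𝓡 n) x₀ x₀) r) := by
  obtain ⟨r, hr, hrT⟩ := Metric.nhds_basis_closedBall.mem_iff.1
    (extChartAt_target_mem_nhds (I := 𝓡 n) x₀)
  have hb : ∀ i : Fin n, ∃ C, ∀ z ∈ Metric.closedBall (extChartAt (𝓡 n) x₀ x₀) r,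
      ‖chartDeriv x₀ z (EuclideanSpace.single i 1)‖ ≤ C := by
    intro i
    obtain ⟨C, hC⟩ := (isCompact_closedBall (extChartAt (𝓡 n) x₀ x₀) r).exists_bound_of_continuousOn
      ((continuousOn_norm_chartDeriv x₀ (EuclideanSpace.single i 1)).mono hrT)
    exact ⟨C, fun z hz => (le_abs_self _).trans (hC z hz)⟩
  choose C hC using hb
  have hsub : Metric.ball (extChartAt (𝓡 n) x₀ x₀) r ⊆
      Metric.closedBall (extChartAt (𝓡 n) x₀ x₀) r := Metric.ball_subset_closedBall
  refine ⟨r, hr, hsub.trans hrT, (∑ i, |C i|).toNNReal, fun z hz z' hz' => ?_⟩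
  have hbound : ∀ w ∈ Metric.ball (extChartAt (𝓡 n) x₀ x₀) r,
      ‖chartDeriv x₀ w (z' - z)‖ ≤ (∑ i, |C i|) * ‖z' - z‖ := by
    intro w hw
    rw [map_eucl_eq_sum (chartDeriv x₀ w) (z' - z), Finset.sum_mul]
    refine (norm_sum_le _ _).trans (Finset.sum_le_sum fun i _ => ?_)
    rw [norm_smul, mul_comm]
    exact mul_le_mul ((hC i w (hsub hw)).trans (le_abs_self _)) (PiLp.norm_apply_le (z' - z) i)
      (norm_nonneg _) (abs_nonneg _)
  refine (edist_chart_symm_le (convex_ball _ _) (hsub.trans hrT) hz hz' hbound).trans ?_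
  rw [ENNReal.ofReal_mul (Finset.sum_nonneg fun i _ => abs_nonneg _), ← dist_eq_norm, dist_comm,
    ← edist_dist]
  exact le_rfl

/-- The derivative of a `1`-Lipschitz function in a chart is bounded by the Riemannian norm. -/
theorem abs_fderiv_le_norm_chartDeriv {x₀ : M} {η : M → ℝ} (hη : LipschitzWith 1 η)
    {h : Eucl n → ℝ} {z : Eucl n} (hz : z ∈ (extChartAt (𝓡 n) x₀).target)
    (hh : h =ᶠ[𝓝 z] η ∘ (extChartAt (𝓡 n) x₀).symm) (hd : DifferentiableAt ℝ h z) (v : Eucl n) :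
    |fderiv ℝ h z v| ≤ ‖chartDeriv x₀ z v‖ := by
  refine le_of_forall_pos_le_add fun ε hε => ?_
  have hev : ∀ᶠ w in 𝓝 z, w ∈ (extChartAt (𝓡 n) x₀).target ∧
      h w = η ((extChartAt (𝓡 n) x₀).symm w) ∧
      ‖chartDeriv x₀ w v‖ < ‖chartDeriv x₀ z v‖ + ε := by
    have hT := (isOpen_chart_target x₀).mem_nhds hz
    exact ((eventually_mem_set.2 hT).and hh).and (((continuousOn_norm_chartDeriv x₀ v).continuousAt
      hT).eventually_lt_const (by linarith)) |>.mono fun w hw => ⟨hw.1.1, hw.1.2, hw.2⟩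
  obtain ⟨r, hr, hball⟩ := Metric.eventually_nhds_iff_ball.1 hev
  have hder : HasDerivAt (fun s : ℝ => h (z + s • v)) (fderiv ℝ h z v) 0 := by
    have h1 : HasDerivAt (fun s : ℝ => z + s • v) v 0 := by
      have h := ((hasDerivAt_id (0 : ℝ)).smul_const v).const_add z
      rw [one_smul] at h
      exact h
    have h2 : HasFDerivAt h (fderiv ℝ h z) (z + (0 : ℝ) • v) := by simpa using hd.hasFDerivAt
    exact h2.comp_hasDerivAt (0 : ℝ) h1
  have hcont : ContinuousAt (fun s : ℝ => z + s • v) 0 := by fun_prop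
  rw [← Real.norm_eq_abs]
  refine hder.le_of_lip' (by positivity) ?_
  have hmem : ∀ᶠ s : ℝ in 𝓝 0, z + s • v ∈ Metric.ball z r :=
    hcont.preimage_mem_nhds (by simpa using Metric.ball_mem_nhds z hr)
  filter_upwards [hmem] with s hs
  have hz0 : z ∈ Metric.ball z r := Metric.mem_ball_self hr
  rw [zero_smul, add_zero, (hball _ hs).2.1, (hball _ hz0).2.1, sub_zero, ← dist_eq_norm]
  -- By continuity the speed in direction `v` stays below its value at `z` plus `ε` on the ball,
  -- which bounds the distance travelled, and hence the change of `η`, over a parameter interval of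
  -- length `|s|`.
  have hed := edist_chart_symm_le (x₀ := x₀) (convex_ball z r) (fun w hw => (hball w hw).1) hz0 hs
    (B := (‖chartDeriv x₀ z v‖ + ε) * ‖s‖) (fun w hw => by
      rw [add_sub_cancel_left, map_smul, norm_smul, mul_comm]
      exact mul_le_mul_of_nonneg_right (hball w hw).2.2.le (norm_nonneg _))
  have h1 := (hη ((extChartAt (𝓡 n) x₀).symm (z + s • v)) ((extChartAt (𝓡 n) x₀).symm z))
  rw [ENNReal.coe_one, one_mul, edist_comm ((extChartAt (𝓡 n) x₀).symm (z + s • v)), edist_dist]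
    at h1
  exact (ENNReal.ofReal_le_ofReal_iff (by positivity)).1 (h1.trans hed)

end Speed

end DriftHeat

namespace DriftHeat

/-! ### Algebraic rules for the gradient -/

section Leibniz

variable {n : ℕ} {M : Type*} [TopologicalSpace M] [ChartedSpace (Eucl n) M]
  [RiemannianBundle (fun x : M => TangentSpace (𝓡 n) x)]

theorem inner_grad_mul {f g : M → ℝ} {x : M} (hf : MDifferentiableAt (𝓡 n) 𝓘(ℝ, ℝ) f x)
    (hg : MDifferentiableAt (𝓡 n) 𝓘(ℝ, ℝ) g x) (v : TangentSpace (𝓡 n) x) :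
    inner ℝ (grad (n := n) (fun y => f y * g y) x) v =
      f x * inner ℝ (grad (n := n) g x) v + g x * inner ℝ (grad (n := n) f x) v := by
  rw [inner_grad, inner_grad, inner_grad]
  exact congr($((hf.hasMFDerivAt.mul hg.hasMFDerivAt).mfderiv) v)

theorem inner_grad_add {f g : M → ℝ} {x : M} (hf : MDifferentiableAt (𝓡 n) 𝓘(ℝ, ℝ) f x)
    (hg : MDifferentiableAt (𝓡 n) 𝓘(ℝ, ℝ) g x) (v : TangentSpace (𝓡 n) x) :
    inner ℝ (grad (n := n) (fun y => f y + g y) x) v =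
      inner ℝ (grad (n := n) f x) v + inner ℝ (grad (n := n) g x) v := by
  rw [inner_grad, inner_grad, inner_grad]
  exact congr($((hf.hasMFDerivAt.add hg.hasMFDerivAt).mfderiv) v)

theorem grad_const (c : ℝ) (x : M) : grad (n := n) (fun _ : M => c) x = 0 := by
  rw [grad, mfderiv_const]
  exact map_zero _

theorem inner_grad_sum {ι : Type*} {f : ι → M → ℝ} {s : Finset ι} {x : M}
    (hf : ∀ i ∈ s, MDifferentiableAt (𝓡 n) 𝓘(ℝ, ℝ) (f i) x) (v : TangentSpace (𝓡 n) x) :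
    MDifferentiableAt (𝓡 n) 𝓘(ℝ, ℝ) (fun y => ∑ i ∈ s, f i y) x ∧
    inner ℝ (grad (n := n) (fun y => ∑ i ∈ s, f i y) x) v =
      ∑ i ∈ s, inner ℝ (grad (n := n) (f i) x) v := by
  classical
  induction s using Finset.induction_on with
  | empty =>
    simp only [Finset.sum_empty]
    exact ⟨mdifferentiableAt_const, by rw [grad_const, inner_zero_left]⟩
  | insert i s hi ih =>
    obtain ⟨h1, h2⟩ := ih fun j hj => hf j (Finset.mem_insert_of_mem hj)
    have h0 := hf i (Finset.mem_insert_self i s)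
    simp only [Finset.sum_insert hi]
    exact ⟨h0.add h1, by rw [inner_grad_add h0 h1, h2]⟩

theorem grad_congr {f g : M → ℝ} {x : M} (h : f =ᶠ[𝓝 x] g) :
    grad (n := n) f x = grad (n := n) g x := by
  rw [grad, grad, h.mfderiv_eq]

theorem inner_grad_exp_neg {φ : M → ℝ} {x : M} (hφ : MDifferentiableAt (𝓡 n) 𝓘(ℝ, ℝ) φ x)
    (v : TangentSpace (𝓡 n) x) :
    inner ℝ (grad (n := n) (fun y => Real.exp (-φ y)) x) v =
      -(Real.exp (-φ x) * inner ℝ (grad (n := n) φ x) v) := by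
  have h1 : HasDerivAt (fun s : ℝ => Real.exp (-s)) (Real.exp (-φ x) * -1) (φ x) :=
    (Real.hasDerivAt_exp _).comp (φ x) (hasDerivAt_neg (φ x))
  have h2 := (h1.hasFDerivAt.hasMFDerivAt.comp x hφ.hasMFDerivAt).mfderiv
  rw [inner_grad, inner_grad]
  refine congr($h2 v).trans ?_
  have h3 : ∀ c w : ℝ, ContinuousLinearMap.toSpanSingleton ℝ (c * -1) w = -(c * w) := by
    intro c w
    rw [ContinuousLinearMap.toSpanSingleton_apply, smul_eq_mul]
    ring
  exact h3 _ _

end Leibniz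

/-! ### Integrating a divergence against a Lipschitz cutoff -/

section Cutoff

variable {n : ℕ} {M : Type*} [EMetricSpace M] [ChartedSpace (Eucl n) M]
  [IsManifold (𝓡 n) ∞ M] [RiemannianBundle (fun x : M => TangentSpace (𝓡 n) x)]
  [IsContMDiffRiemannianBundle (𝓡 n) ∞ (Eucl n) (fun x : M => TangentSpace (𝓡 n) x)]
  [MeasurableSpace M] [BorelSpace M]

omit [MeasurableSpace M] [BorelSpace M] in
theorem continuous_norm_grad {f : M → ℝ} (hf : ContMDiff (𝓡 n) 𝓘(ℝ, ℝ) ∞ f) :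
    Continuous fun x => ‖grad (n := n) f x‖ := by
  simp only [norm_eq_sqrt_real_inner]
  exact (continuous_inner_grad hf hf).sqrt

theorem integrableOn_chart_target (x₀ : M) {F : M → ℝ}
    (hF : Integrable F (riemannianVolume n M)) :
    IntegrableOn (fun z => volDensity x₀ z * F ((extChartAt (𝓡 n) x₀).symm z))
      (extChartAt (𝓡 n) x₀).target := by
  have h := hF.integrableOn (s := (extChartAt (𝓡 n) x₀).source)
  rw [IntegrableOn, riemannianVolume_restrict_source, chartVolume] at h
  have h0 := (aemeasurable_chart_symm (n := n) x₀).mono_ac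
    (withDensity_absolutelyContinuous _ (fun z => ENNReal.ofReal (volDensity x₀ z)))
  rw [integrable_map_measure h.aestronglyMeasurable h0,
    integrable_withDensity_iff_integrable_smul₀' (aemeasurable_ofReal_volDensity x₀)
      (Eventually.of_forall fun _ => ENNReal.ofReal_lt_top)] at h
  refine h.congr (Eventually.of_forall fun z => ?_)
  simp only [smul_eq_mul, Function.comp_apply]
  rw [ENNReal.toReal_ofReal (show 0 ≤ volDensity x₀ z from Real.sqrt_nonneg _)]

variable [SecondCountableTopology M] [IsRiemannianManifold (𝓡 n) M]

/-- The estimate `|∫ η div(ρ ∇f)| ≤ ∫_{A} |ρ| |∇f|` for a `1`-Lipschitz function `η` that is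
locally constant off `A`, when `ρ` is supported in a small coordinate ball. -/
theorem abs_integral_lipschitz_mul_le_of_tsupport (x₀ : M) {r : ℝ} {L : NNReal}
    (hL : LipschitzOnWith L (extChartAt (𝓡 n) x₀).symm (Metric.ball (extChartAt (𝓡 n) x₀ x₀) r))
    {f ρ η : M → ℝ} (hf : ContMDiff (𝓡 n) 𝓘(ℝ, ℝ) ∞ f) (hρ : ContMDiff (𝓡 n) 𝓘(ℝ, ℝ) ∞ ρ)
    (hρc : HasCompactSupport ρ)
    (hρs : tsupport ρ ⊆ (extChartAt (𝓡 n) x₀).source ∩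
      extChartAt (𝓡 n) x₀ ⁻¹' Metric.ball (extChartAt (𝓡 n) x₀ x₀) r)
    (hη : LipschitzWith 1 η) {A : Set M} (hA : MeasurableSet A)
    (hηA : ∀ x ∉ A, η =ᶠ[𝓝 x] fun _ => η x) :
    |∫ x, η x * (ρ x * laplacian (n := n) f x +
        inner ℝ (grad (n := n) ρ x) (grad (n := n) f x)) ∂(riemannianVolume n M)| ≤
      ∫ x in A, |ρ x| * ‖grad (n := n) f x‖ ∂(riemannianVolume n M) := by
  set T := (extChartAt (𝓡 n) x₀).target
  set ψ := (extChartAt (𝓡 n) x₀).symm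
  set W := Metric.ball (extChartAt (𝓡 n) x₀ x₀) r
  -- In coordinates `η` is known to be Lipschitz only on the ball; a Lipschitz extension to the
  -- whole Euclidean space makes the divergence theorem available, and only its values on the
  -- support of `ρ` matter.
  obtain ⟨h, hh, hhη⟩ := (hη.comp_lipschitzOnWith hL).extend_real
  have hρs' : tsupport ρ ⊆ (extChartAt (𝓡 n) x₀).source := hρs.trans inter_subset_left
  have hFi : Integrable (fun x => |ρ x| * ‖grad (n := n) f x‖) (riemannianVolume n M) :=
    integrable_mul_of_continuousOn_tsupport hρ.continuous.abs hρc.abs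
      (continuous_norm_grad hf).continuousOn
  set F : M → ℝ := A.indicator fun x => |ρ x| * ‖grad (n := n) f x‖ with hFdef
  have hFA : Integrable F (riemannianVolume n M) := hFi.indicator hA
  rw [integral_lipschitz_mul_laplacian x₀ hf hρ hρc hρs' hh, abs_neg, ← integral_indicator hA,
    ← setIntegral_eq_integral_of_forall_compl_eq_zero (s := (extChartAt (𝓡 n) x₀).source)
      (f := F), setIntegral_source_eq x₀ hFA.aestronglyMeasurable.restrict, ← Real.norm_eq_abs]
  · refine norm_integral_le_of_norm_le (integrableOn_chart_target x₀ hFA) ?_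
    rw [ae_restrict_iff' (isOpen_chart_target x₀).measurableSet]
    filter_upwards [hh.ae_differentiableAt] with z hz hzT
    rw [norm_mul, Real.norm_of_nonneg (volDensity_pos hzT).le]
    refine mul_le_mul_of_nonneg_left ?_ (volDensity_pos hzT).le
    have hF0 : 0 ≤ F (ψ z) := indicator_nonneg (fun x _ => by positivity) _
    by_cases hzρ : ψ z ∈ tsupport ρ
    · have hzW : z ∈ W := by
        have := (hρs hzρ).2
        rwa [mem_preimage, (extChartAt (𝓡 n) x₀).right_inv hzT] at this
      have hev : h =ᶠ[𝓝 z] η ∘ ψ := by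
        filter_upwards [Metric.isOpen_ball.mem_nhds hzW] with w hw using (hhη hw).symm
      by_cases hzA : ψ z ∈ A
      · rw [hFdef, indicator_of_mem hzA, norm_mul, Real.norm_eq_abs, Real.norm_eq_abs]
        refine mul_le_mul_of_nonneg_left ?_ (abs_nonneg _)
        refine (abs_fderiv_le_norm_chartDeriv hη hzT hev hz _).trans_eq ?_
        rw [chartDeriv_coordField hzT]
      · have hconst : h =ᶠ[𝓝 z] fun _ => η (ψ z) := by
          have hc : ContinuousAt ψ z := (mdifferentiableAt_chart_symm hzT).continuousAt
          exact hev.trans (hc.eventually (hηA _ hzA))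
        rw [hconst.fderiv_eq, fderiv_fun_const, Pi.zero_apply, zero_apply, mul_zero, norm_zero]
        exact hF0
    · rw [image_eq_zero_of_notMem_tsupport hzρ, zero_mul, norm_zero]
      exact hF0
  · intro x hx
    rw [hFdef]
    refine indicator_apply_eq_zero.2 fun _ => ?_
    rw [image_eq_zero_of_notMem_tsupport fun h => hx (hρs' h), abs_zero, zero_mul]
  · intro x hx
    have h1 := hhη (hρs hx).2
    rwa [Function.comp_apply, (extChartAt (𝓡 n) x₀).left_inv (hρs hx).1] at h1

/-- The local estimates are summed over a partition of unity subordinate to small coordinate balls.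
The functions `ρ i` sum to `1` on the support of `η` and to at most `1` elsewhere, so no constant is
lost. -/
theorem abs_integral_lipschitz_mul_le {f P η : M → ℝ} (hf : ContMDiff (𝓡 n) 𝓘(ℝ, ℝ) ∞ f)
    (hP : ContMDiff (𝓡 n) 𝓘(ℝ, ℝ) ∞ P) (hη : LipschitzWith 1 η) (hηc : HasCompactSupport η)
    {A : Set M} (hA : MeasurableSet A) (hηA : ∀ x ∉ A, η =ᶠ[𝓝 x] fun _ => η x)
    (hint : Integrable (fun x => |P x| * ‖grad (n := n) f x‖) (riemannianVolume n M)) :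
    |∫ x, η x * (P x * laplacian (n := n) f x +
        inner ℝ (grad (n := n) P x) (grad (n := n) f x)) ∂(riemannianVolume n M)| ≤
      ∫ x in A, |P x| * ‖grad (n := n) f x‖ ∂(riemannianVolume n M) := by
  have hlc : LocallyCompactSpace M := ChartedSpace.locallyCompactSpace (Eucl n) M
  choose r hr hrT L hL using exists_ball_lipschitzOnWith_chart_symm (n := n) (M := M)
  -- The radius is halved so that the closed ball still lies inside the good ball; this makes each
  -- `ρ i` compactly supported.
  set U : M → Set M := fun x => (extChartAt (𝓡 n) x).source ∩
    extChartAt (𝓡 n) x ⁻¹' Metric.ball (extChartAt (𝓡 n) x x) (r x / 2) with hU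
  have hUo : ∀ x, IsOpen (U x) := fun x =>
    (continuousOn_extChartAt x).isOpen_inter_preimage (isOpen_extChartAt_source x)
      Metric.isOpen_ball
  obtain ⟨ρ, hρU⟩ := SmoothPartitionOfUnity.exists_isSubordinate (𝓡 n) (isClosed_tsupport η) U hUo
    fun x _ => mem_iUnion.2 ⟨x, mem_extChartAt_source x,
      Metric.mem_ball_self (x := extChartAt (𝓡 n) x x) (half_pos (hr x))⟩
  have hcb : ∀ x, Metric.closedBall (extChartAt (𝓡 n) x x) (r x / 2) ⊆
      Metric.ball (extChartAt (𝓡 n) x x) (r x) := fun x =>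
    Metric.closedBall_subset_ball (half_lt_self (hr x))
  have hρc : ∀ i, HasCompactSupport (ρ i) := by
    intro i
    refine HasCompactSupport.of_support_subset_isCompact (K := (extChartAt (𝓡 n) i).symm ''
      Metric.closedBall (extChartAt (𝓡 n) i i) (r i / 2)) ?_ ?_
    · exact (isCompact_closedBall _ _).image_of_continuousOn
        ((continuousOn_extChartAt_symm i).mono ((hcb i).trans (hrT i)))
    · intro y hy
      have hyU := hρU i (subset_tsupport _ hy)
      exact ⟨extChartAt (𝓡 n) i y, Metric.ball_subset_closedBall hyU.2,
        (extChartAt (𝓡 n) i).left_inv hyU.1⟩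
  have hfin := ρ.locallyFinite.finite_nonempty_inter_compact hηc.isCompact
  set J : Finset M := hfin.toFinset with hJ
  have hJsum : ∀ x ∈ tsupport η, ∑ i ∈ J, ρ i x = 1 := by
    intro x hx
    refine ρ.sum_finsupport' x hx fun i hi => ?_
    rw [hJ, Set.Finite.mem_toFinset]
    exact ⟨x, (ρ.mem_finsupport x).1 hi, hx⟩
  have hJle : ∀ x, ∑ i ∈ J, ρ i x ≤ 1 := by
    intro x
    classical
    refine le_trans ?_ (ρ.sum_le_one x)
    rw [finsum_eq_sum_of_support_subset (s := J ∪ ρ.finsupport x)]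
    · exact Finset.sum_le_sum_of_subset_of_nonneg Finset.subset_union_left
        fun i _ _ => ρ.nonneg i x
    · rw [Finset.coe_union, ρ.coe_finsupport]
      exact subset_union_right
  have hρs : ∀ i, ContMDiff (𝓡 n) 𝓘(ℝ, ℝ) ∞ (ρ i) := fun i => (ρ i).contMDiff
  have hρPs : ∀ i, ContMDiff (𝓡 n) 𝓘(ℝ, ℝ) ∞ fun x => ρ i x * P x := fun i => (hρs i).mul hP
  have hρPc : ∀ i, HasCompactSupport fun x => ρ i x * P x := fun i => (hρc i).mul_right
  have hdec : ∀ x, η x * (P x * laplacian (n := n) f x +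
      inner ℝ (grad (n := n) P x) (grad (n := n) f x)) = ∑ i ∈ J, η x *
      ((ρ i x * P x) * laplacian (n := n) f x +
        inner ℝ (grad (n := n) (fun y => ρ i y * P y) x) (grad (n := n) f x)) := by
    intro x
    by_cases hx : η x = 0
    · simp [hx]
    rw [← Finset.mul_sum, Finset.sum_add_distrib, ← Finset.sum_mul, ← Finset.sum_mul,
      hJsum x (subset_tsupport _ hx), one_mul,
      ← (inner_grad_sum (fun i _ => (hρPs i).mdifferentiable (by simp) x) _).2]
    -- Near a point where `η ≠ 0` the partial sum is identically `1`, so the gradients of the pieces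
    -- `ρ i * P` add up to that of `P`.
    congr 3
    refine grad_congr ?_
    filter_upwards [hη.continuous.continuousAt.eventually_ne hx] with y hy
    rw [← Finset.sum_mul, hJsum y (subset_tsupport _ hy), one_mul]
  have hiη : ∀ i, Integrable (fun x => η x * ((ρ i x * P x) * laplacian (n := n) f x +
      inner ℝ (grad (n := n) (fun y => ρ i y * P y) x) (grad (n := n) f x)))
      (riemannianVolume n M) := fun i =>
    integrable_mul_of_continuousOn_tsupport hη.continuous hηc
      (((hρPs i).continuous.mul (continuous_laplacian hf)).add
        (continuous_inner_grad (hρPs i) hf)).continuousOn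
  have hiρ : ∀ i, Integrable (fun x => |ρ i x * P x| * ‖grad (n := n) f x‖)
      (riemannianVolume n M) := fun i =>
    integrable_mul_of_continuousOn_tsupport (hρPs i).continuous.abs (hρPc i).abs
      (continuous_norm_grad hf).continuousOn
  rw [integral_congr_ae (Eventually.of_forall hdec), integral_finsetSum _ fun i _ => hiη i]
  refine (Finset.abs_sum_le_sum_abs _ _).trans ?_
  refine (Finset.sum_le_sum fun i _ => abs_integral_lipschitz_mul_le_of_tsupport i (hL i)
    hf (hρPs i) (hρPc i) ?_ hη hA hηA).trans ?_
  · refine (closure_mono (Function.support_mul_subset_left _ _)).trans ((hρU i).trans ?_)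
    exact fun y hy => ⟨hy.1, hcb i (Metric.ball_subset_closedBall hy.2)⟩
  · rw [← integral_finsetSum _ fun i _ => (hiρ i).integrableOn]
    refine integral_mono (integrable_finsetSum _ fun i _ => (hiρ i).integrableOn)
      hint.integrableOn fun x => ?_
    simp only [abs_mul, abs_of_nonneg (ρ.nonneg _ x), mul_assoc]
    rw [← Finset.sum_mul]
    exact mul_le_of_le_one_left (by positivity) (hJle x)

end Cutoff

/-! ### Green's identity on a complete manifold -/

section Green

variable {n : ℕ} {M : Type*} [EMetricSpace M] [ChartedSpace (Eucl n) M]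
  [IsManifold (𝓡 n) ∞ M] [RiemannianBundle (fun x : M => TangentSpace (𝓡 n) x)]
  [IsContMDiffRiemannianBundle (𝓡 n) ∞ (Eucl n) (fun x : M => TangentSpace (𝓡 n) x)]
  [MeasurableSpace M] [BorelSpace M] [SecondCountableTopology M] [IsRiemannianManifold (𝓡 n) M]
  [CompleteSpace M]

/-- On a complete manifold, `∫ div(P ∇f) = 0` as soon as `P ∇f` and its divergence are
integrable. -/
theorem integral_div_eq_zero {f P : M → ℝ} (hf : ContMDiff (𝓡 n) 𝓘(ℝ, ℝ) ∞ f)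
    (hP : ContMDiff (𝓡 n) 𝓘(ℝ, ℝ) ∞ P)
    (hint : Integrable (fun x => |P x| * ‖grad (n := n) f x‖) (riemannianVolume n M))
    (hdiv : Integrable (fun x => P x * laplacian (n := n) f x +
      inner ℝ (grad (n := n) P x) (grad (n := n) f x)) (riemannianVolume n M)) :
    ∫ x, (P x * laplacian (n := n) f x + inner ℝ (grad (n := n) P x) (grad (n := n) f x))
      ∂(riemannianVolume n M) = 0 := by
  have hlc : LocallyCompactSpace M := ChartedSpace.locallyCompactSpace (Eucl n) M
  let K : CompactExhaustion M := default
  -- Distance cutoffs: `1` on the compact set `K k`, `1`-Lipschitz, and supported in its closed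
  -- `1`-thickening, which is compact by Hopf–Rinow.
  set η : ℕ → M → ℝ := fun k x => (thickenedIndicator one_pos (K k) x : ℝ) with hηdef
  have hηL : ∀ k, LipschitzWith 1 (η k) := by
    intro k
    have h := lipschitzWith_thickenedIndicator one_pos (K k)
    rw [Real.toNNReal_one, inv_one] at h
    have h2 := NNReal.isometry_coe.lipschitz.comp h
    rwa [one_mul] at h2
  have hηc : ∀ k, HasCompactSupport (η k) := fun k =>
    HasCompactSupport.intro (isCompact_cthickening n (K.isCompact k) zero_le_one) fun x hx => by
      rw [hηdef]
      simp only
      rw [thickenedIndicator_zero one_pos _ fun h => hx (Metric.thickening_subset_cthickening _ _ h),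
        NNReal.coe_zero]
  have hη1 : ∀ k, ∀ x ∈ K k, η k x = 1 := fun k x hx => by
    rw [hηdef]
    simp only
    rw [thickenedIndicator_one one_pos _ hx, NNReal.coe_one]
  have hηabs : ∀ k x, |η k x| ≤ 1 := fun k x => by
    rw [abs_of_nonneg (NNReal.coe_nonneg _)]
    exact_mod_cast thickenedIndicator_le_one one_pos (K k) x
  have hev : ∀ x, ∀ᶠ k in atTop, x ∈ interior (K k) := by
    intro x
    obtain ⟨m, hm⟩ := K.exists_mem x
    filter_upwards [eventually_ge_atTop (m + 1)] with k hk
    exact interior_mono (K.subset hk) (K.subset_interior_succ m hm)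
  have hlim : Tendsto (fun k => ∫ x, η k x * (P x * laplacian (n := n) f x +
      inner ℝ (grad (n := n) P x) (grad (n := n) f x)) ∂(riemannianVolume n M)) atTop
      (𝓝 (∫ x, (P x * laplacian (n := n) f x + inner ℝ (grad (n := n) P x) (grad (n := n) f x))
      ∂(riemannianVolume n M))) := by
    refine tendsto_integral_of_dominated_convergence _ (fun k =>
      (hηL k).continuous.aestronglyMeasurable.mul hdiv.aestronglyMeasurable) hdiv.norm
      (fun k => Eventually.of_forall fun x => ?_) (Eventually.of_forall fun x => ?_)
    · rw [norm_mul, Real.norm_eq_abs (η k x)]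
      exact mul_le_of_le_one_left (norm_nonneg _) (hηabs k x)
    · refine tendsto_const_nhds.congr' ?_
      filter_upwards [hev x] with k hk
      rw [hη1 k x (interior_subset hk), one_mul]
  -- The cutoff error is an integral over the complement of the interior of `K k`, the tail of an
  -- integrable function.
  have hlim0 : Tendsto (fun k => ∫ x in (interior (K k))ᶜ, |P x| * ‖grad (n := n) f x‖
      ∂(riemannianVolume n M)) atTop (𝓝 0) := by
    rw [show (0 : ℝ) = ∫ _, 0 ∂(riemannianVolume n M) by simp]
    simp only [← integral_indicator isOpen_interior.measurableSet.compl]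
    refine tendsto_integral_of_dominated_convergence _ (fun k =>
      hint.aestronglyMeasurable.indicator isOpen_interior.measurableSet.compl) hint.norm
      (fun k => Eventually.of_forall fun x => norm_indicator_le_norm_self _ _)
      (Eventually.of_forall fun x => ?_)
    refine tendsto_const_nhds.congr' ?_
    filter_upwards [hev x] with k hk
    rw [indicator_of_notMem (by simpa using hk)]
  have hle := le_of_tendsto_of_tendsto' hlim.abs hlim0 fun k =>
    abs_integral_lipschitz_mul_le hf hP (hηL k) (hηc k) isOpen_interior.measurableSet.compl
      (fun x hx => by
        have hx' : x ∈ interior (K k) := by simpa using hx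
        filter_upwards [isOpen_interior.mem_nhds hx'] with y hy
        rw [hη1 k y (interior_subset hy), hη1 k x (interior_subset hx')]) hint
  exact abs_nonpos_iff.1 hle

/-- Green's identity `∫ (g 𝓛_φ f + ⟨∇g, ∇f⟩) e^{-φ} = 0` on a complete manifold. -/
theorem integral_green {f g φ : M → ℝ} (hf : ContMDiff (𝓡 n) 𝓘(ℝ, ℝ) ∞ f)
    (hg : ContMDiff (𝓡 n) 𝓘(ℝ, ℝ) ∞ g) (hφ : ContMDiff (𝓡 n) 𝓘(ℝ, ℝ) ∞ φ)
    (hint : Integrable (fun x => |g x| * ‖grad (n := n) f x‖ * Real.exp (-φ x))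
      (riemannianVolume n M))
    (hdiv : Integrable (fun x => (g x * (laplacian (n := n) f x -
      inner ℝ (grad (n := n) f x) (grad (n := n) φ x)) +
      inner ℝ (grad (n := n) g x) (grad (n := n) f x)) * Real.exp (-φ x))
      (riemannianVolume n M)) :
    ∫ x, (g x * (laplacian (n := n) f x - inner ℝ (grad (n := n) f x) (grad (n := n) φ x)) +
      inner ℝ (grad (n := n) g x) (grad (n := n) f x)) * Real.exp (-φ x)
      ∂(riemannianVolume n M) = 0 := by
  have he : ContMDiff (𝓡 n) 𝓘(ℝ, ℝ) ∞ fun x => Real.exp (-φ x) :=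
    (Real.contDiff_exp.comp contDiff_neg).contMDiff.comp hφ
  -- The weight is absorbed into the coefficient: `∇(g e^{-φ})` produces both `∇g` and the drift
  -- term.
  have hP : ContMDiff (𝓡 n) 𝓘(ℝ, ℝ) ∞ fun x => g x * Real.exp (-φ x) := hg.mul he
  have heq : ∀ x, (g x * (laplacian (n := n) f x -
      inner ℝ (grad (n := n) f x) (grad (n := n) φ x)) +
      inner ℝ (grad (n := n) g x) (grad (n := n) f x)) * Real.exp (-φ x) =
      (g x * Real.exp (-φ x)) * laplacian (n := n) f x +
      inner ℝ (grad (n := n) (fun y => g y * Real.exp (-φ y)) x) (grad (n := n) f x) := by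
    intro x
    rw [inner_grad_mul (hg.mdifferentiable (by simp) x) (he.mdifferentiable (by simp) x),
      inner_grad_exp_neg (hφ.mdifferentiable (by simp) x), real_inner_comm (grad φ x)]
    ring
  simp only [heq] at hdiv ⊢
  refine integral_div_eq_zero hf hP (hint.congr (Eventually.of_forall fun x => ?_)) hdiv
  simp only [abs_mul, Real.abs_exp]
  ring

end Green

end DriftHeat

namespace DriftHeat

/-! ### Differentiating a squared `L²` norm in time -/

section EnergyDerivative

variable {X : Type*} [MeasurableSpace X] {μ : Measure X}

theorem integrable_and_integral_le_of_lintegral_le {g : X → ℝ} (hg : Measurable g)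
    (h0 : ∀ x, 0 ≤ g x) {K : ℝ≥0∞} (hK : K ≠ ⊤) (h : ∫⁻ x, ENNReal.ofReal (g x) ∂μ ≤ K) :
    Integrable g μ ∧ ∫ x, g x ∂μ ≤ K.toReal := by
  refine ⟨⟨hg.aestronglyMeasurable, ?_⟩, ?_⟩
  · rw [hasFiniteIntegral_iff_ofReal (Eventually.of_forall h0)]
    exact h.trans_lt hK.lt_top
  · rw [integral_eq_lintegral_of_nonneg_ae (Eventually.of_forall h0) hg.aestronglyMeasurable]
    exact ENNReal.toReal_mono hK h

/-- A bounded family in `L²` that tends to `0` pointwise tends weakly to `0`. -/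
theorem tendsto_integral_mul_of_integral_sq_le {ι : Type*} {l : Filter ι} [l.IsCountablyGenerated]
    {f : X → ℝ} {b : ι → X → ℝ} (hf : Measurable f) (hf0 : ∀ x, 0 ≤ f x)
    (hfi : Integrable (fun x => f x ^ 2) μ) (hb : ∀ᶠ s in l, Measurable (b s))
    (hb0 : ∀ s x, 0 ≤ b s x) {K : ℝ}
    (hbK : ∀ᶠ s in l, Integrable (fun x => b s x ^ 2) μ ∧ ∫ x, b s x ^ 2 ∂μ ≤ K)
    (hlim : ∀ x, Tendsto (fun s => b s x) l (𝓝 0)) :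
    Tendsto (fun s => ∫ x, f x * b s x ∂μ) l (𝓝 0) := by
  have hK : ∀ᶠ s in l, 0 ≤ K := hbK.mono fun s hs =>
    (integral_nonneg fun x => sq_nonneg (b s x)).trans hs.2
  -- Truncate `b` at `R f`. The truncated product is dominated by `R f²`, so dominated convergence
  -- applies; where `b > R f`, the product `f b` is at most `b² / R`, whose integral is at most `K /
  -- R`.
  have htr : ∀ R : ℝ, 0 < R →
      Tendsto (fun s => ∫ x, f x * min (b s x) (R * f x) ∂μ) l (𝓝 0) := by
    intro R hR
    rw [show (0 : ℝ) = ∫ _, 0 ∂μ by simp]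
    refine tendsto_integral_filter_of_dominated_convergence (fun x => R * f x ^ 2) ?_ ?_
      (hfi.const_mul R) (Eventually.of_forall fun x => ?_)
    · filter_upwards [hb] with s hs
      exact (hf.mul (hs.min (hf.const_mul R))).aestronglyMeasurable
    · refine Eventually.of_forall fun s => Eventually.of_forall fun x => ?_
      rw [Real.norm_of_nonneg (mul_nonneg (hf0 x)
        (le_min (hb0 s x) (mul_nonneg hR.le (hf0 x))))]
      nlinarith [min_le_right (b s x) (R * f x), hf0 x]
    · refine squeeze_zero (fun s => mul_nonneg (hf0 x)
        (le_min (hb0 s x) (mul_nonneg hR.le (hf0 x)))) (fun s =>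
        mul_le_mul_of_nonneg_left (min_le_left _ _) (hf0 x)) ?_
      simpa using (hlim x).const_mul (f x)
  rw [Metric.tendsto_nhds]
  intro ε hε
  obtain ⟨R, hR, hRε⟩ : ∃ R : ℝ, 0 < R ∧ |K| / R < ε / 2 := by
    refine ⟨2 * (|K| + 1) / ε, by positivity, ?_⟩
    rw [div_lt_iff₀ (by positivity)]
    field_simp
    linarith
  filter_upwards [hb, hbK, hK, (Metric.tendsto_nhds.1 (htr R hR)) (ε / 2) (by linarith)]
    with s hbs hs hK0 hlt
  rw [Real.dist_eq, sub_zero, abs_of_nonneg (integral_nonneg fun x =>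
    mul_nonneg (hf0 x) (hb0 s x))]
  rw [Real.dist_eq, sub_zero] at hlt
  have hi1 : Integrable (fun x => f x * min (b s x) (R * f x)) μ := by
    refine (hfi.const_mul R).mono' (hf.mul (hbs.min (hf.const_mul R))).aestronglyMeasurable
      (Eventually.of_forall fun x => ?_)
    rw [Real.norm_of_nonneg (mul_nonneg (hf0 x)
      (le_min (hb0 s x) (mul_nonneg hR.le (hf0 x))))]
    nlinarith [min_le_right (b s x) (R * f x), hf0 x]
  have hpt : ∀ x, f x * b s x ≤ f x * min (b s x) (R * f x) + R⁻¹ * b s x ^ 2 := by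
    intro x
    rcases le_total (b s x) (R * f x) with h | h
    · rw [min_eq_left h]
      exact le_add_of_nonneg_right (by positivity)
    · rw [min_eq_right h]
      have h1 : f x ≤ R⁻¹ * b s x := by
        rw [inv_mul_eq_div, le_div_iff₀ hR, mul_comm]
        exact h
      nlinarith [hb0 s x, hf0 x, mul_le_mul_of_nonneg_right h1 (hb0 s x),
        mul_nonneg (hf0 x) (mul_nonneg hR.le (hf0 x))]
  calc ∫ x, f x * b s x ∂μ
      ≤ ∫ x, (f x * min (b s x) (R * f x) + R⁻¹ * b s x ^ 2) ∂μ :=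
        integral_mono_of_nonneg (Eventually.of_forall fun x => mul_nonneg (hf0 x) (hb0 s x))
          (hi1.add (hs.1.const_mul _)) (Eventually.of_forall hpt)
    _ = ∫ x, f x * min (b s x) (R * f x) ∂μ + R⁻¹ * ∫ x, b s x ^ 2 ∂μ := by
        rw [integral_add hi1 (hs.1.const_mul _), integral_const_mul]
    _ < ε / 2 + ε / 2 := by
        refine add_lt_add ((le_abs_self _).trans_lt hlt) (lt_of_le_of_lt ?_ hRε)
        rw [div_eq_inv_mul]
        exact mul_le_mul_of_nonneg_left (hs.2.trans (le_abs_self _)) (inv_nonneg.2 hR.le)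
    _ = ε := add_halves ε

/-- Cauchy–Schwarz for `w s - w t = ∫ w'`. Pairing with the fixed vector `d = w s - w t` reduces it
to the scalar fundamental theorem, so `E` need not be complete. -/
theorem norm_sub_sq_le_mul_integral {E : Type*} [NormedAddCommGroup E] [InnerProductSpace ℝ E]
    {a b : ℝ} {w w' : ℝ → E} (hw : ∀ t ∈ Icc a b, HasDerivWithinAt w (w' t) (Icc a b) t)
    (hw' : ContinuousOn w' (Icc a b)) {s t : ℝ} (ht : t ∈ Icc a b) (hs : s ∈ Icc a b)
    (hts : t ≤ s) :
    ‖w s - w t‖ ^ 2 ≤ (s - t) * ∫ τ in Icc t s, ‖w' τ‖ ^ 2 := by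
  rcases hts.eq_or_lt with rfl | hlt
  · simp
  have hsub : Icc t s ⊆ Icc a b := Icc_subset_Icc ht.1 hs.2
  set d := w s - w t with hd
  have hFTC : ∫ τ in t..s, inner ℝ d (w' τ) = inner ℝ d (w s) - inner ℝ d (w t) := by
    refine intervalIntegral.integral_eq_sub_of_hasDerivAt_of_le hts
      (f := fun τ => inner ℝ d (w τ)) ?_ ?_ ?_
    · exact continuousOn_const.inner ((HasDerivWithinAt.continuousOn hw).mono hsub)
    · intro τ hτ
      have h1 : HasDerivAt w (w' τ) τ := (hw τ (hsub (Ioo_subset_Icc_self hτ))).hasDerivAt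
        (Icc_mem_nhds (ht.1.trans_lt hτ.1) (hτ.2.trans_le hs.2))
      simpa using (hasDerivAt_const τ d).inner ℝ h1
    · refine ContinuousOn.intervalIntegrable ?_
      rw [uIcc_of_le hts]
      exact continuousOn_const.inner (hw'.mono hsub)
  rw [← inner_sub_right, ← hd, real_inner_self_eq_norm_sq, intervalIntegral.integral_of_le hts,
    ← integral_Icc_eq_integral_Ioc] at hFTC
  have hc : 0 < s - t := sub_pos.2 hlt
  have hi2 : IntegrableOn (fun τ => ‖w' τ‖ ^ 2) (Icc t s) :=
    ((hw'.mono hsub).norm.pow 2).integrableOn_compact isCompact_Icc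
  have hi1 : IntegrableOn (fun τ => inner ℝ d (w' τ)) (Icc t s) :=
    (continuousOn_const.inner (hw'.mono hsub)).integrableOn_compact isCompact_Icc
  have hi0 : IntegrableOn (fun _ : ℝ => ‖d‖ ^ 2 / 2) (Icc t s) := integrableOn_const (by simp)
  -- Young's inequality `(s - t)⟨d, w'⟩ ≤ ½‖d‖² + ½(s - t)²‖w'‖²`; after integration the `‖d‖²` term
  -- is absorbed on the left.
  have hle : (s - t) * ∫ τ in Icc t s, inner ℝ d (w' τ) ≤
      ∫ τ in Icc t s, (‖d‖ ^ 2 / 2 + (s - t) ^ 2 / 2 * ‖w' τ‖ ^ 2) := by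
    rw [← integral_const_mul]
    refine setIntegral_mono (hi1.const_mul _)
      (hi0.add (hi2.const_mul _)) fun τ => ?_
    have h1 := real_inner_le_norm d (w' τ)
    nlinarith [sq_nonneg (‖d‖ - (s - t) * ‖w' τ‖), mul_le_mul_of_nonneg_left h1 hc.le]
  rw [integral_add hi0 (hi2.const_mul _), integral_const_mul,
    setIntegral_const, hFTC, measureReal_def, Real.volume_Icc, ENNReal.toReal_ofReal hc.le,
    smul_eq_mul] at hle
  refine le_of_mul_le_mul_left ?_ hc
  linarith

variable [SFinite μ] {E : X → Type*} [∀ x, NormedAddCommGroup (E x)]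
  [∀ x, InnerProductSpace ℝ (E x)] {a b : ℝ} {w w' : (x : X) → ℝ → E x}

theorem lintegral_norm_sub_sq_le
    (hw : ∀ x, ∀ t ∈ Icc a b, HasDerivWithinAt (w x) (w' x t) (Icc a b) t)
    (hw' : ∀ x, ContinuousOn (w' x) (Icc a b))
    (hm : ∀ t ∈ Icc a b, Measurable fun x => ‖w' x t‖ ^ 2) {K : ℝ≥0∞}
    (hK : ∀ t ∈ Icc a b, ∫⁻ x, ENNReal.ofReal (‖w' x t‖ ^ 2) ∂μ ≤ K) {s t : ℝ}
    (ht : t ∈ Icc a b) (hs : s ∈ Icc a b) (hts : t ≤ s) :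
    ∫⁻ x, ENNReal.ofReal (‖w x s - w x t‖ ^ 2) ∂μ ≤ ENNReal.ofReal ((s - t) ^ 2) * K := by
  have hab : a ≤ b := ht.1.trans ht.2
  have hsub : Icc t s ⊆ Icc a b := Icc_subset_Icc ht.1 hs.2
  -- Clamping time to `[a, b]` makes the integrand continuous in `τ` on all of `ℝ` and measurable in
  -- `x`, hence jointly measurable, as Tonelli requires.
  have hjoint : Measurable (Function.uncurry fun (τ : ℝ) (x : X) =>
      ‖w' x (projIcc a b hab τ)‖ ^ 2) := by
    refine measurable_uncurry_of_continuous_of_measurable (fun x => ?_) fun τ => hm _ (Subtype.coe_prop _)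
    exact ((continuousOn_iff_continuous_domRestrict.1 (hw' x)).comp continuous_projIcc).norm.pow 2
  calc ∫⁻ x, ENNReal.ofReal (‖w x s - w x t‖ ^ 2) ∂μ
      ≤ ∫⁻ x, (ENNReal.ofReal (s - t) *
          ∫⁻ τ in Icc t s, ENNReal.ofReal (‖w' x (projIcc a b hab τ)‖ ^ 2)) ∂μ := by
        refine lintegral_mono fun x => ?_
        refine (ENNReal.ofReal_le_ofReal
          (norm_sub_sq_le_mul_integral (hw x) (hw' x) ht hs hts)).trans_eq ?_
        have hi : IntegrableOn (fun τ => ‖w' x τ‖ ^ 2) (Icc t s) :=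
          (((hw' x).mono hsub).norm.pow 2).integrableOn_compact isCompact_Icc
        rw [ENNReal.ofReal_mul (sub_nonneg.2 hts), ofReal_integral_eq_lintegral_ofReal hi
          (Eventually.of_forall fun τ => sq_nonneg _)]
        congr 1
        refine setLIntegral_congr_fun measurableSet_Icc fun τ hτ => ?_
        rw [projIcc_of_mem hab (hsub hτ)]
    _ = ENNReal.ofReal (s - t) * ∫⁻ τ in Icc t s,
          ∫⁻ x, ENNReal.ofReal (‖w' x (projIcc a b hab τ)‖ ^ 2) ∂μ := by
        rw [lintegral_const_mul' _ _ ENNReal.ofReal_ne_top, lintegral_lintegral_swap]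
        exact (hjoint.comp measurable_swap).ennreal_ofReal.aemeasurable
    _ ≤ ENNReal.ofReal (s - t) * ∫⁻ _ in Icc t s, K := by
        gcongr with τ
        exact hK _ (Subtype.coe_prop _)
    _ = ENNReal.ofReal ((s - t) ^ 2) * K := by
        rw [setLIntegral_const, Real.volume_Icc, sq, ENNReal.ofReal_mul (sub_nonneg.2 hts)]
        ring

/-- Differentiation of `t ↦ ∫ |w(t)|²` for a family with `L²`-bounded time derivative. -/
theorem hasDerivWithinAt_integral_norm_sq
    (hw : ∀ x, ∀ t ∈ Icc a b, HasDerivWithinAt (w x) (w' x t) (Icc a b) t)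
    (hw' : ∀ x, ContinuousOn (w' x) (Icc a b))
    (hm : ∀ s ∈ Icc a b, ∀ t ∈ Icc a b, Measurable fun x => inner ℝ (w x s) (w x t))
    (hm' : ∀ s ∈ Icc a b, ∀ t ∈ Icc a b, Measurable fun x => inner ℝ (w x s) (w' x t))
    (hm'' : ∀ t ∈ Icc a b, Measurable fun x => ‖w' x t‖ ^ 2) {K : ℝ≥0∞} (hKtop : K ≠ ⊤)
    (hK : ∀ t ∈ Icc a b, ∫⁻ x, ENNReal.ofReal (‖w' x t‖ ^ 2) ∂μ ≤ K)
    (hfin : ∀ t ∈ Icc a b, ∫⁻ x, ENNReal.ofReal (‖w x t‖ ^ 2) ∂μ < ⊤) {t : ℝ}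
    (ht : t ∈ Icc a b) :
    HasDerivWithinAt (fun s => ∫ x, ‖w x s‖ ^ 2 ∂μ) (2 * ∫ x, inner ℝ (w x t) (w' x t) ∂μ)
      (Icc a b) t := by
  have hmsq : ∀ s ∈ Icc a b, Measurable fun x => ‖w x s‖ ^ 2 := fun s hs => by
    simpa only [real_inner_self_eq_norm_sq] using hm s hs s hs
  have hint : ∀ s ∈ Icc a b, Integrable (fun x => ‖w x s‖ ^ 2) μ := fun s hs =>
    (integrable_and_integral_le_of_lintegral_le (hmsq s hs) (fun x => sq_nonneg _)
      (hfin s hs).ne le_rfl).1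
  obtain ⟨hint', hK'⟩ := integrable_and_integral_le_of_lintegral_le (hm'' t ht)
    (fun x => sq_nonneg _) hKtop (hK t ht)
  -- The difference quotients, bounded in `L²` by the same `K` as `w'`.
  set q : (x : X) → ℝ → E x := fun x s => (s - t)⁻¹ • (w x s - w x t) with hq
  have hqm : ∀ s ∈ Icc a b, Measurable fun x => ‖q x s‖ ^ 2 := by
    intro s hs
    have h1 : ∀ x, ‖q x s‖ ^ 2 = ((s - t)⁻¹) ^ 2 *
        (‖w x s‖ ^ 2 - 2 * inner ℝ (w x s) (w x t) + ‖w x t‖ ^ 2) := by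
      intro x
      rw [hq, norm_smul, mul_pow, norm_sub_sq_real, Real.norm_eq_abs, sq_abs]
    simp only [h1]
    exact (((hmsq s hs).sub ((hm s hs t ht).const_mul 2)).add (hmsq t ht)).const_mul _
  have hqK : ∀ s ∈ Icc a b, s ≠ t → Integrable (fun x => ‖q x s‖ ^ 2) μ ∧
      ∫ x, ‖q x s‖ ^ 2 ∂μ ≤ K.toReal := by
    intro s hs hst
    refine integrable_and_integral_le_of_lintegral_le (hqm s hs) (fun x => sq_nonneg _) hKtop ?_
    have hst' : 0 < (s - t) ^ 2 := by
      have := sub_ne_zero.2 hst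
      positivity
    have h1 : ∫⁻ x, ENNReal.ofReal (‖w x s - w x t‖ ^ 2) ∂μ ≤
        ENNReal.ofReal ((s - t) ^ 2) * K := by
      rcases le_total t s with h | h
      · exact lintegral_norm_sub_sq_le hw hw' hm'' hK ht hs h
      · have h2 := lintegral_norm_sub_sq_le hw hw' hm'' hK hs ht h
        simp only [norm_sub_rev (w _ s) (w _ t)]
        rwa [sub_sq_comm s t]
    have h2 : ∀ x, ENNReal.ofReal (‖q x s‖ ^ 2) =
        ENNReal.ofReal (((s - t) ^ 2)⁻¹) * ENNReal.ofReal (‖w x s - w x t‖ ^ 2) := by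
      intro x
      rw [← ENNReal.ofReal_mul (inv_nonneg.2 hst'.le), hq, norm_smul, mul_pow, Real.norm_eq_abs,
        sq_abs, inv_pow]
    simp only [h2]
    rw [lintegral_const_mul' _ _ ENNReal.ofReal_ne_top]
    calc _ ≤ ENNReal.ofReal (((s - t) ^ 2)⁻¹) * (ENNReal.ofReal ((s - t) ^ 2) * K) := by gcongr
      _ = K := by
        rw [← mul_assoc, ← ENNReal.ofReal_mul (inv_nonneg.2 hst'.le), inv_mul_cancel₀ hst'.ne',
          ENNReal.ofReal_one, one_mul]
  set l := 𝓝[Icc a b \ {t}] t with hl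
  have hmem : ∀ᶠ s in l, s ∈ Icc a b ∧ s ≠ t := by
    filter_upwards [self_mem_nhdsWithin] with s hs using ⟨hs.1, hs.2⟩
  have hbm : ∀ s ∈ Icc a b, Measurable fun x => ‖q x s - w' x t‖ := by
    intro s hs
    -- The fibres `E x` vary with `x`, so measurability is only available for scalar quantities;
    -- norms are expanded into inner products.
    have h1 : ∀ x, ‖q x s - w' x t‖ = √(‖q x s‖ ^ 2 - 2 * ((s - t)⁻¹ *
        (inner ℝ (w x s) (w' x t) - inner ℝ (w x t) (w' x t))) + ‖w' x t‖ ^ 2) := by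
      intro x
      rw [← inner_sub_left, ← real_inner_smul_left]
      change _ = √(‖q x s‖ ^ 2 - 2 * inner ℝ (q x s) (w' x t) + ‖w' x t‖ ^ 2)
      rw [← norm_sub_sq_real, Real.sqrt_sq (norm_nonneg _)]
    simp only [h1]
    exact (((hqm s hs).sub ((((hm' s hs t ht).sub (hm' t ht t ht)).const_mul _).const_mul 2)).add
      (hm'' t ht)).sqrt
  have hpar : ∀ s x, ‖q x s - w' x t‖ ^ 2 ≤ 2 * ‖q x s‖ ^ 2 + 2 * ‖w' x t‖ ^ 2 := by
    intro s x
    have := norm_sub_le (q x s) (w' x t)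
    nlinarith [sq_nonneg (‖q x s‖ - ‖w' x t‖), norm_nonneg (q x s - w' x t)]
  have hbi : ∀ s ∈ Icc a b, s ≠ t → Integrable (fun x => ‖q x s - w' x t‖ ^ 2) μ := by
    intro s hs hst
    refine (((hqK s hs hst).1.const_mul 2).add (hint'.const_mul 2)).mono'
      ((hbm s hs).pow_const 2).aestronglyMeasurable (Eventually.of_forall fun x => ?_)
    rw [Real.norm_of_nonneg (sq_nonneg _)]
    exact hpar s x
  have hweak : Tendsto (fun s => ∫ x, ‖w x t‖ * ‖q x s - w' x t‖ ∂μ) l (𝓝 0) := by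
    refine tendsto_integral_mul_of_integral_sq_le (K := 4 * K.toReal) ?_
      (fun x => norm_nonneg _) (hint t ht) ?_ (fun s x => norm_nonneg _) ?_ fun x => ?_
    · simpa only [Real.sqrt_sq (norm_nonneg _)] using (hmsq t ht).sqrt
    · filter_upwards [hmem] with s hs using hbm s hs.1
    · filter_upwards [hmem] with s hs
      refine ⟨hbi s hs.1 hs.2, ?_⟩
      refine (integral_mono (hbi s hs.1 hs.2) (((hqK s hs.1 hs.2).1.const_mul 2).add
        (hint'.const_mul 2)) (hpar s)).trans ?_
      simp only [Pi.add_apply]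
      rw [integral_add ((hqK s hs.1 hs.2).1.const_mul 2) (hint'.const_mul 2), integral_const_mul,
        integral_const_mul]
      linarith [(hqK s hs.1 hs.2).2]
    · have h1 := hasDerivWithinAt_iff_tendsto_slope.1 (hw x t ht)
      have h2 : Tendsto (fun s => slope (w x) t s - w' x t) l (𝓝 (w' x t - w' x t)) :=
        h1.sub_const _
      rw [sub_self] at h2
      have h3 := h2.norm
      rw [norm_zero] at h3
      exact h3
  have hcs : ∀ s ∈ Icc a b, s ≠ t → Integrable (fun x => ‖w x t‖ * ‖q x s - w' x t‖) μ := by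
    intro s hs hst
    refine ((hint t ht).add (hbi s hs hst)).mono' ?_ (Eventually.of_forall fun x => ?_)
    · have : Measurable fun x => ‖w x t‖ := by
        simpa only [Real.sqrt_sq (norm_nonneg _)] using (hmsq t ht).sqrt
      exact (this.mul (hbm s hs)).aestronglyMeasurable
    · rw [Real.norm_of_nonneg (by positivity), Pi.add_apply]
      nlinarith [sq_nonneg (‖w x t‖ - ‖q x s - w' x t‖), sq_nonneg (‖w x t‖),
        sq_nonneg (‖q x s - w' x t‖)]
  have hii : Integrable (fun x => inner ℝ (w x t) (w' x t)) μ := by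
    refine ((hint t ht).add hint').mono' (hm' t ht t ht).aestronglyMeasurable
      (Eventually.of_forall fun x => ?_)
    rw [Pi.add_apply]
    refine (norm_inner_le_norm _ _).trans ?_
    nlinarith [sq_nonneg (‖w x t‖ - ‖w' x t‖), sq_nonneg (‖w x t‖), sq_nonneg (‖w' x t‖)]
  have hiq : ∀ s ∈ Icc a b, s ≠ t →
      Integrable (fun x => inner ℝ (w x t) (q x s - w' x t)) μ := by
    intro s hs hst
    refine (hcs s hs hst).mono' ?_ (Eventually.of_forall fun x => norm_inner_le_norm _ _)
    have h1 : ∀ x, inner ℝ (w x t) (q x s - w' x t) =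
        (s - t)⁻¹ * (inner ℝ (w x t) (w x s) - inner ℝ (w x t) (w x t)) -
          inner ℝ (w x t) (w' x t) := by
      intro x
      rw [inner_sub_right, hq, real_inner_smul_right, inner_sub_right]
    simp only [h1]
    exact ((((hm t ht s hs).sub (hm t ht t ht)).const_mul _).sub (hm' t ht t ht)).aestronglyMeasurable
  rw [hasDerivWithinAt_iff_tendsto_slope]
  -- From `w s = w t + (s - t) q`: the slope is `2⟨w t, q⟩ + (s - t)‖q‖²`. Weak convergence of `q`
  -- handles the first term, the `L²` bound the second.
  have hslope : ∀ s ∈ Icc a b, s ≠ t → slope (fun s => ∫ x, ‖w x s‖ ^ 2 ∂μ) t s =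
      2 * ∫ x, inner ℝ (w x t) (w' x t) ∂μ + (2 * ∫ x, inner ℝ (w x t) (q x s - w' x t) ∂μ +
        (s - t) * ∫ x, ‖q x s‖ ^ 2 ∂μ) := by
    intro s hs hst
    have hst' : s - t ≠ 0 := sub_ne_zero.2 hst
    have hi : Integrable (fun x => 2 * inner ℝ (w x t) (q x s - w' x t) +
        (s - t) * ‖q x s‖ ^ 2) μ :=
      ((hiq s hs hst).const_mul 2).add ((hqK s hs hst).1.const_mul _)
    rw [slope_def_field, ← integral_sub (hint s hs) (hint t ht), div_eq_inv_mul,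
      ← integral_const_mul, ← integral_const_mul, ← integral_const_mul, ← integral_const_mul,
      ← integral_add ((hiq s hs hst).const_mul 2) ((hqK s hs hst).1.const_mul _),
      ← integral_add (hii.const_mul 2) hi]
    refine integral_congr_ae (Eventually.of_forall fun x => ?_)
    simp only
    have h1 : w x s = w x t + (s - t) • q x s := by
      rw [hq, smul_inv_smul₀ hst', add_sub_cancel]
    have h2 : ‖w x s‖ ^ 2 = ‖w x t‖ ^ 2 + 2 * ((s - t) * inner ℝ (w x t) (q x s)) +
        (s - t) ^ 2 * ‖q x s‖ ^ 2 := by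
      rw [h1, norm_add_sq_real, real_inner_smul_right, norm_smul, mul_pow, Real.norm_eq_abs, sq_abs]
    rw [h2, inner_sub_right]
    field_simp
    ring
  have h1 : Tendsto (fun s => ∫ x, inner ℝ (w x t) (q x s - w' x t) ∂μ) l (𝓝 0) := by
    refine squeeze_zero_norm' ?_ hweak
    filter_upwards [hmem] with s hs
    exact norm_integral_le_of_norm_le (hcs s hs.1 hs.2)
      (Eventually.of_forall fun x => norm_inner_le_norm _ _)
  have h2 : Tendsto (fun s => (s - t) * ∫ x, ‖q x s‖ ^ 2 ∂μ) l (𝓝 0) := by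
    have h3 : Tendsto (fun s : ℝ => |s - t| * K.toReal) l (𝓝 0) := by
      have hc : Continuous fun s : ℝ => |s - t| * K.toReal := by fun_prop
      have := (hc.tendsto t).mono_left (nhdsWithin_le_nhds (s := Icc a b \ {t}))
      simpa using this
    refine squeeze_zero_norm' ?_ h3
    filter_upwards [hmem] with s hs
    rw [norm_mul, Real.norm_eq_abs, Real.norm_of_nonneg (integral_nonneg fun x => sq_nonneg _)]
    exact mul_le_mul_of_nonneg_left (hqK s hs.1 hs.2).2 (abs_nonneg _)
  have h3 := ((h1.const_mul 2).add h2).const_add (2 * ∫ x, inner ℝ (w x t) (w' x t) ∂μ)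
  rw [mul_zero, add_zero, add_zero] at h3
  refine h3.congr' ?_
  filter_upwards [hmem] with s hs using (hslope s hs.1 hs.2).symm

end EnergyDerivative

end DriftHeat

namespace DriftHeat

/-! ### Time derivatives of smooth families and of their gradients -/

section TimeDependence

variable {n : ℕ} {M : Type*} [TopologicalSpace M] [ChartedSpace (Eucl n) M]

variable (n) in
/-- A time-dependent function that is smooth on `M × s`, in the coordinates of every chart. -/
def SmoothFamilyOn (f : M → ℝ → ℝ) (s : Set ℝ) : Prop :=
  ∀ x₀ : M, ContDiffOn ℝ ∞ (fun p : Eucl n × ℝ => f ((extChartAt (𝓡 n) x₀).symm p.1) p.2)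
    ((extChartAt (𝓡 n) x₀).target ×ˢ s)

theorem _root_.ContMDiffOn.smoothFamilyOn [IsManifold (𝓡 n) ∞ M] {f : M → ℝ → ℝ} {s : Set ℝ}
    (hf : ContMDiffOn ((𝓡 n).prod 𝓘(ℝ, ℝ)) 𝓘(ℝ, ℝ) ∞ (fun p : M × ℝ => f p.1 p.2)
      (univ ×ˢ s)) : SmoothFamilyOn n f s := by
  intro x₀
  rw [← contMDiffOn_iff_contDiffOn]
  have h1 : ContMDiffOn 𝓘(ℝ, Eucl n × ℝ) (𝓡 n) ∞
      (fun p : Eucl n × ℝ => (extChartAt (𝓡 n) x₀).symm p.1)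
      ((extChartAt (𝓡 n) x₀).target ×ˢ s) :=
    (contMDiffOn_extChartAt_symm x₀).comp contDiff_fst.contMDiff.contMDiffOn fun p hp => hp.1
  have h2 : ContMDiffOn 𝓘(ℝ, Eucl n × ℝ) 𝓘(ℝ, ℝ) ∞ (fun p : Eucl n × ℝ => p.2)
      ((extChartAt (𝓡 n) x₀).target ×ˢ s) := contDiff_snd.contMDiff.contMDiffOn
  exact hf.comp (h1.prodMk h2) fun p hp => ⟨mem_univ _, hp.2⟩

variable {f : M → ℝ → ℝ} {a b : ℝ}

theorem uniqueDiffOn_target_prod_Icc (hab : a < b) (x₀ : M) :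
    UniqueDiffOn ℝ ((extChartAt (𝓡 n) x₀).target ×ˢ Icc a b) :=
  (isOpen_chart_target x₀).uniqueDiffOn.prod (uniqueDiffOn_Icc hab)

theorem SmoothFamilyOn.hasDerivWithinAt_chart {s : Set ℝ} (hf : SmoothFamilyOn n f s) {x₀ : M}
    {z : Eucl n} (hz : z ∈ (extChartAt (𝓡 n) x₀).target) {t : ℝ} (ht : t ∈ s) :
    HasDerivWithinAt (f ((extChartAt (𝓡 n) x₀).symm z))
      (fderivWithin ℝ (fun p : Eucl n × ℝ => f ((extChartAt (𝓡 n) x₀).symm p.1) p.2)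
        ((extChartAt (𝓡 n) x₀).target ×ˢ s) (z, t) (0, 1)) s t := by
  have h1 := (((hf x₀).differentiableOn (by simp)) (z, t) ⟨hz, ht⟩).hasFDerivWithinAt
  have h2 : HasDerivWithinAt (fun τ : ℝ => (z, τ)) ((0 : Eucl n), (1 : ℝ)) s t :=
    (hasDerivWithinAt_const t s z).prodMk (hasDerivWithinAt_id t s)
  exact h1.comp_hasDerivWithinAt t h2 fun τ hτ => ⟨hz, hτ⟩

theorem SmoothFamilyOn.hasDerivWithinAt {s : Set ℝ} (hf : SmoothFamilyOn n f s) (x : M) {t : ℝ}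
    (ht : t ∈ s) : HasDerivWithinAt (f x) (derivWithin (f x) s t) s t := by
  have h := hf.hasDerivWithinAt_chart (mem_extChartAt_target (I := 𝓡 n) x) ht
  rw [extChartAt_to_inv] at h
  exact h.differentiableWithinAt.hasDerivWithinAt

theorem SmoothFamilyOn.derivWithin (hab : a < b) (hf : SmoothFamilyOn n f (Icc a b)) :
    SmoothFamilyOn n (fun x t => derivWithin (f x) (Icc a b) t) (Icc a b) := by
  intro x₀
  have h1 := (hf x₀).fderivWithin (m := ∞) (uniqueDiffOn_target_prod_Icc hab x₀) (by simp)
  refine (h1.clm_apply (contDiffOn_const (c := ((0 : Eucl n), (1 : ℝ))))).congr fun p hp => ?_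
  exact (hf.hasDerivWithinAt_chart hp.1 hp.2).derivWithin (uniqueDiffOn_Icc hab _ hp.2)

theorem SmoothFamilyOn.contDiffOn_slice {s : Set ℝ} (hf : SmoothFamilyOn n f s) (x₀ : M) {t : ℝ}
    (ht : t ∈ s) : ContDiffOn ℝ ∞ ((fun x => f x t) ∘ (extChartAt (𝓡 n) x₀).symm)
      (extChartAt (𝓡 n) x₀).target :=
  (hf x₀).comp (contDiff_id.prodMk contDiff_const).contDiffOn fun _ hz => ⟨hz, ht⟩

theorem SmoothFamilyOn.contMDiff [IsManifold (𝓡 n) ∞ M] {s : Set ℝ} (hf : SmoothFamilyOn n f s)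
    {t : ℝ} (ht : t ∈ s) : ContMDiff (𝓡 n) 𝓘(ℝ, ℝ) ∞ fun x => f x t := by
  intro x
  have h1 : ContDiffAt ℝ ∞ ((fun x => f x t) ∘ (extChartAt (𝓡 n) x).symm)
      (extChartAt (𝓡 n) x x) :=
    (hf.contDiffOn_slice x ht).contDiffAt (extChartAt_target_mem_nhds x)
  refine (h1.contMDiffAt.comp x contMDiffAt_extChartAt).congr_of_eventuallyEq ?_
  filter_upwards [extChartAt_source_mem_nhds (I := 𝓡 n) x] with y hy
  simp only [Function.comp_apply]
  rw [(extChartAt (𝓡 n) x).left_inv hy]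

theorem SmoothFamilyOn.fderiv_slice {s : Set ℝ} (hf : SmoothFamilyOn n f s) {x₀ : M}
    {z : Eucl n} (hz : z ∈ (extChartAt (𝓡 n) x₀).target) {t : ℝ} (ht : t ∈ s) (v : Eucl n) :
    fderiv ℝ ((fun x => f x t) ∘ (extChartAt (𝓡 n) x₀).symm) z v =
      fderivWithin ℝ (fun p : Eucl n × ℝ => f ((extChartAt (𝓡 n) x₀).symm p.1) p.2)
        ((extChartAt (𝓡 n) x₀).target ×ˢ s) (z, t) (v, 0) := by
  have h1 := (((hf x₀).differentiableOn (by simp)) (z, t) ⟨hz, ht⟩).hasFDerivWithinAt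
  have h2 : HasFDerivWithinAt (fun y : Eucl n => (y, t))
      ((ContinuousLinearMap.id ℝ (Eucl n)).prod 0) (extChartAt (𝓡 n) x₀).target z :=
    (hasFDerivWithinAt_id _ _).prodMk (hasFDerivWithinAt_const _ _ _)
  have h3 := (h1.comp z h2 fun y hy => mk_mem_prod hy ht).hasFDerivAt
    ((isOpen_chart_target x₀).mem_nhds hz)
  exact congr($h3.fderiv v)

/-- Space and time derivatives commute, by symmetry of the second derivative of the coordinate
expression on target times `[a, b]`. -/
theorem SmoothFamilyOn.hasDerivWithinAt_fderiv_slice (hab : a < b)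
    (hf : SmoothFamilyOn n f (Icc a b)) {x₀ : M} {z : Eucl n}
    (hz : z ∈ (extChartAt (𝓡 n) x₀).target) {t : ℝ} (ht : t ∈ Icc a b) (v : Eucl n) :
    HasDerivWithinAt
      (fun τ => fderiv ℝ ((fun x => f x τ) ∘ (extChartAt (𝓡 n) x₀).symm) z v)
      (fderiv ℝ ((fun x => _root_.derivWithin (f x) (Icc a b) t) ∘
        (extChartAt (𝓡 n) x₀).symm) z v) (Icc a b) t := by
  set F := fun p : Eucl n × ℝ => f ((extChartAt (𝓡 n) x₀).symm p.1) p.2 with hF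
  set S := (extChartAt (𝓡 n) x₀).target ×ˢ Icc a b with hS
  have hUD : UniqueDiffOn ℝ S := uniqueDiffOn_target_prod_Icc hab x₀
  have hmem : (z, t) ∈ S := ⟨hz, ht⟩
  have hG : HasFDerivWithinAt (fderivWithin ℝ F S) (fderivWithin ℝ (fderivWithin ℝ F S) S (z, t))
      S (z, t) :=
    ((((hf x₀).fderivWithin (m := ∞) hUD (by simp)).differentiableOn (by simp)) (z, t)
      hmem).hasFDerivWithinAt
  -- At the end times symmetry persists because every point of the product lies in the closure of
  -- its interior.
  have hsymm : IsSymmSndFDerivWithinAt ℝ F S (z, t) := by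
    refine ((hf x₀) (z, t) hmem).isSymmSndFDerivWithinAt
      (by rw [minSmoothness_of_isRCLikeNormedField]; exact WithTop.coe_le_coe.2 le_top) hUD ?_ hmem
    rw [interior_prod_eq, (isOpen_chart_target x₀).interior_eq, interior_Icc,
      closure_prod_eq, closure_Ioo hab.ne]
    exact ⟨subset_closure hz, ht⟩
  have h1 : HasDerivWithinAt (fun τ : ℝ => (z, τ)) ((0 : Eucl n), (1 : ℝ)) (Icc a b) t :=
    (hasDerivWithinAt_const t _ z).prodMk (hasDerivWithinAt_id t _)
  have h2 : HasDerivWithinAt (fun τ => fderivWithin ℝ F S (z, τ) (v, 0))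
      (fderivWithin ℝ (fderivWithin ℝ F S) S (z, t) (0, 1) (v, 0)) (Icc a b) t := by
    have h3 := hG.comp_hasDerivWithinAt t h1 fun τ hτ => ⟨hz, hτ⟩
    simpa using h3.clm_apply (hasDerivWithinAt_const t _ ((v, 0) : Eucl n × ℝ))
  have h4 : fderiv ℝ ((fun x => _root_.derivWithin (f x) (Icc a b) t) ∘
      (extChartAt (𝓡 n) x₀).symm) z v =
        fderivWithin ℝ (fderivWithin ℝ F S) S (z, t) (v, 0) (0, 1) := by
    have h5 : HasFDerivWithinAt (fun y : Eucl n => (y, t))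
        ((ContinuousLinearMap.id ℝ (Eucl n)).prod 0) (extChartAt (𝓡 n) x₀).target z :=
      (hasFDerivWithinAt_id _ _).prodMk (hasFDerivWithinAt_const _ _ _)
    have h6 := ((hG.comp z h5 fun y hy => mk_mem_prod hy ht).hasFDerivAt
      ((isOpen_chart_target x₀).mem_nhds hz)).clm_apply
        (hasFDerivAt_const ((0, 1) : Eucl n × ℝ) z)
    have h7 : (fun x => _root_.derivWithin (f x) (Icc a b) t) ∘ (extChartAt (𝓡 n) x₀).symm =ᶠ[𝓝 z]
        fun y => fderivWithin ℝ F S (y, t) (0, 1) := by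
      filter_upwards [(isOpen_chart_target x₀).mem_nhds hz] with y hy
      exact (hf.hasDerivWithinAt_chart hy ht).derivWithin (uniqueDiffOn_Icc hab _ ht)
    rw [h7.fderiv_eq]
    simpa using congr($(h6.fderiv) v)
  rw [h4, hsymm]
  refine h2.congr_of_mem (fun τ hτ => ?_) ht
  exact hf.fderiv_slice hz hτ v

section Gradient

variable [IsManifold (𝓡 n) ∞ M] [RiemannianBundle (fun x : M => TangentSpace (𝓡 n) x)]

omit [RiemannianBundle (fun x : M => TangentSpace (𝓡 n) x)] in
theorem exists_chartDeriv_eq {x₀ : M} {z : Eucl n} (hz : z ∈ (extChartAt (𝓡 n) x₀).target)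
    (v : TangentSpace (𝓡 n) ((extChartAt (𝓡 n) x₀).symm z)) : ∃ e, chartDeriv x₀ z e = v := by
  have h := mfderivWithin_extChartAt_symm_comp_mfderiv_extChartAt'
    ((extChartAt (𝓡 n) x₀).map_target hz)
  rw [(extChartAt (𝓡 n) x₀).right_inv hz, ModelWithCorners.range_eq_univ, mfderivWithin_univ] at h
  exact ⟨_, congr($h v)⟩

theorem hasDerivWithinAt_of_inner {E : Type*} [NormedAddCommGroup E] [InnerProductSpace ℝ E]
    [FiniteDimensional ℝ E] {g : ℝ → E} {g' : E} {s : Set ℝ} {t : ℝ}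
    (h : ∀ v : E, HasDerivWithinAt (fun τ => inner ℝ (g τ) v) (inner ℝ g' v) s t) :
    HasDerivWithinAt g g' s t := by
  have key : ∀ y : E, y = ∑ i, inner ℝ y (stdOrthonormalBasis ℝ E i) •
      stdOrthonormalBasis ℝ E i := by
    intro y
    conv_lhs => rw [← (stdOrthonormalBasis ℝ E).sum_repr y]
    simp only [(stdOrthonormalBasis ℝ E).repr_apply_apply, real_inner_comm]
  rw [key g', show g = fun τ => ∑ i, inner ℝ (g τ) (stdOrthonormalBasis ℝ E i) •
    stdOrthonormalBasis ℝ E i from funext fun τ => key (g τ)]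
  exact HasDerivWithinAt.fun_sum fun i _ => (h _).smul_const _

theorem SmoothFamilyOn.hasDerivWithinAt_grad (hab : a < b)
    (hf : SmoothFamilyOn n f (Icc a b)) (x : M) {t : ℝ} (ht : t ∈ Icc a b) :
    HasDerivWithinAt (fun τ => grad (n := n) (fun y => f y τ) x)
      (grad (n := n) (fun y => _root_.derivWithin (f y) (Icc a b) t) x) (Icc a b) t := by
  have : FiniteDimensional ℝ (TangentSpace (𝓡 n) x) :=
    inferInstanceAs (FiniteDimensional ℝ (Eucl n))
  refine hasDerivWithinAt_of_inner fun v => ?_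
  -- Stated for all `z`, so that the base point `x` can replace the inverse chart at its own
  -- coordinates inside dependent types.
  suffices key : ∀ z ∈ (extChartAt (𝓡 n) x).target,
      ∀ v : TangentSpace (𝓡 n) ((extChartAt (𝓡 n) x).symm z),
      HasDerivWithinAt
        (fun τ => inner ℝ (grad (n := n) (fun y => f y τ) ((extChartAt (𝓡 n) x).symm z)) v)
        (inner ℝ (grad (n := n) (fun y => _root_.derivWithin (f y) (Icc a b) t)
          ((extChartAt (𝓡 n) x).symm z)) v) (Icc a b) t by
    have h := key _ (mem_extChartAt_target (I := 𝓡 n) x)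
    rw [extChartAt_to_inv] at h
    exact h v
  intro z hz v
  obtain ⟨e, rfl⟩ := exists_chartDeriv_eq hz v
  rw [inner_grad_chartDeriv hz ((hf.derivWithin hab).contMDiff ht |>.mdifferentiable (by simp) _)]
  refine (hf.hasDerivWithinAt_fderiv_slice hab hz ht e).congr_of_mem (fun τ hτ => ?_) ht
  exact inner_grad_chartDeriv hz (hf.contMDiff hτ |>.mdifferentiable (by simp) _) e

end Gradient

end TimeDependence

end DriftHeat

namespace DriftHeat

/-! ### The Hilbert space inequality -/

section CauchySchwarz

/-- Polarise both products in `v + l` and `v - l`. Cauchy–Schwarz for `u` and `v + l` makes the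
first part nonnegative, and the square `⟨u, v - l⟩²` is dropped. -/
theorem neg_norm_sub_sq_mul_le {H : Type*} [NormedAddCommGroup H] [InnerProductSpace ℝ H]
    (u v l : H) :
    -(‖v - l‖ ^ 2 * ‖u‖ ^ 2 / 2) ≤
      2 * inner ℝ v l * ‖u‖ ^ 2 - 2 * inner ℝ u l * inner ℝ u v := by
  have h1 := real_inner_mul_inner_self_le u (v + l)
  rw [real_inner_self_eq_norm_sq, real_inner_self_eq_norm_sq, inner_add_right,
    norm_add_sq_real] at h1
  rw [norm_sub_sq_real]
  nlinarith [sq_nonneg (inner ℝ u v - inner ℝ u l)]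

variable {X : Type*} [MeasurableSpace X] {μ : Measure X} {E : Type*} [NormedAddCommGroup E]
  [InnerProductSpace ℝ E]

theorem inner_toLp_eq_integral {f g : X → E} (hf : MemLp f 2 μ) (hg : MemLp g 2 μ) :
    inner ℝ (hf.toLp f) (hg.toLp g) = ∫ x, inner ℝ (f x) (g x) ∂μ := by
  rw [L2.inner_def]
  refine integral_congr_ae ?_
  filter_upwards [hf.coeFn_toLp, hg.coeFn_toLp] with x h1 h2
  rw [h1, h2]

theorem norm_toLp_sq_eq_integral {f : X → E} (hf : MemLp f 2 μ) :
    ‖hf.toLp f‖ ^ 2 = ∫ x, ‖f x‖ ^ 2 ∂μ := by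
  simp only [← real_inner_self_eq_norm_sq]
  exact inner_toLp_eq_integral hf hf

theorem neg_integral_norm_sub_sq_mul_le {u v l : X → E} (hu : MemLp u 2 μ) (hv : MemLp v 2 μ)
    (hl : MemLp l 2 μ) :
    -((∫ x, ‖v x - l x‖ ^ 2 ∂μ) * (∫ x, ‖u x‖ ^ 2 ∂μ) / 2) ≤
      2 * (∫ x, inner ℝ (v x) (l x) ∂μ) * (∫ x, ‖u x‖ ^ 2 ∂μ) -
        2 * (∫ x, inner ℝ (u x) (l x) ∂μ) * (∫ x, inner ℝ (u x) (v x) ∂μ) := by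
  have h := neg_norm_sub_sq_mul_le (hu.toLp u) (hv.toLp v) (hl.toLp l)
  rw [← MemLp.toLp_sub, norm_toLp_sq_eq_integral, norm_toLp_sq_eq_integral,
    inner_toLp_eq_integral, inner_toLp_eq_integral, inner_toLp_eq_integral] at h
  exact h

end CauchySchwarz

/-! ### The weighted measure and integration by parts for the drift Laplacian -/

section Weighted

variable {n : ℕ} {M : Type*} [TopologicalSpace M] [ChartedSpace (Eucl n) M]
  [RiemannianBundle (fun x : M => TangentSpace (𝓡 n) x)] [MeasurableSpace M]

variable (n) in
/-- The weighted volume `e^{-φ} dV`. -/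
noncomputable def weightedVolume (φ : M → ℝ) : Measure M :=
  (riemannianVolume n M).withDensity fun x => ENNReal.ofReal (Real.exp (-φ x))

variable {φ : M → ℝ}

omit [TopologicalSpace M] [ChartedSpace (Eucl n) M]
  [RiemannianBundle (fun x : M => TangentSpace (𝓡 n) x)] in
theorem measurable_exp_neg_ofReal (hφ : Measurable φ) :
    Measurable fun x => ENNReal.ofReal (Real.exp (-φ x)) :=
  (Real.measurable_exp.comp hφ.neg).ennreal_ofReal

theorem lintegral_weightedVolume (hφ : Measurable φ) {F : M → ℝ} :
    ∫⁻ x, ENNReal.ofReal (F x) ∂(weightedVolume n φ) =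
      ∫⁻ x, ENNReal.ofReal (F x * Real.exp (-φ x)) ∂(riemannianVolume n M) := by
  rw [weightedVolume, lintegral_withDensity_eq_lintegral_mul_non_measurable _
    (measurable_exp_neg_ofReal hφ) (Eventually.of_forall fun x => ENNReal.ofReal_lt_top)]
  refine lintegral_congr fun x => ?_
  rw [Pi.mul_apply, mul_comm (F x), ENNReal.ofReal_mul (Real.exp_nonneg _)]

theorem integral_weightedVolume (hφ : Measurable φ) {F : M → ℝ} :
    ∫ x, F x ∂(weightedVolume n φ) = ∫ x, F x * Real.exp (-φ x) ∂(riemannianVolume n M) := by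
  rw [weightedVolume, integral_withDensity_eq_integral_toReal_smul (measurable_exp_neg_ofReal hφ)
    (Eventually.of_forall fun x => ENNReal.ofReal_lt_top)]
  refine integral_congr_ae (Eventually.of_forall fun x => ?_)
  simp only [ENNReal.toReal_ofReal (Real.exp_nonneg _), smul_eq_mul, mul_comm]

theorem integrable_weightedVolume_iff (hφ : Measurable φ) {F : M → ℝ} :
    Integrable F (weightedVolume n φ) ↔
      Integrable (fun x => F x * Real.exp (-φ x)) (riemannianVolume n M) := by
  rw [weightedVolume, integrable_withDensity_iff (measurable_exp_neg_ofReal hφ)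
    (Eventually.of_forall fun x => ENNReal.ofReal_lt_top)]
  simp only [ENNReal.toReal_ofReal (Real.exp_nonneg _)]

end Weighted

section Complete

variable {n : ℕ} {M : Type*} [EMetricSpace M] [ChartedSpace (Eucl n) M]
  [IsManifold (𝓡 n) ∞ M] [SecondCountableTopology M]
  [RiemannianBundle (fun x : M => TangentSpace (𝓡 n) x)]
  [IsContMDiffRiemannianBundle (𝓡 n) ∞ (Eucl n) (fun x : M => TangentSpace (𝓡 n) x)]
  [IsRiemannianManifold (𝓡 n) M] [CompleteSpace M] [MeasurableSpace M] [BorelSpace M] {φ : M → ℝ}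

omit [IsRiemannianManifold (𝓡 n) M] [CompleteSpace M] in
instance sFinite_weightedVolume : SFinite (weightedVolume n φ) := by
  unfold weightedVolume
  infer_instance

omit [SecondCountableTopology M] [IsRiemannianManifold (𝓡 n) M] [CompleteSpace M] in
theorem integral_weightedVolume_pos (hφ : Continuous φ) {F : M → ℝ} (hF : Continuous F)
    (h0 : ∀ x, 0 ≤ F x) (hi : Integrable F (weightedVolume n φ)) {x : M} (hx : F x ≠ 0) :
    0 < ∫ y, F y ∂(weightedVolume n φ) := by
  rw [integral_weightedVolume hφ.measurable]
  rw [integrable_weightedVolume_iff hφ.measurable] at hi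
  have hc : Continuous fun y => F y * Real.exp (-φ y) :=
    hF.mul (Real.continuous_exp.comp hφ.neg)
  exact integral_pos_of_integrable_nonneg_nonzero hc hi
    (fun y => mul_nonneg (h0 y) (Real.exp_nonneg _)) (mul_ne_zero hx (Real.exp_ne_zero _))

/-- Integration by parts for the drift Laplacian in the weighted `L²` space. -/
theorem integral_inner_grad_weightedVolume {f g : M → ℝ} (hf : ContMDiff (𝓡 n) 𝓘(ℝ, ℝ) ∞ f)
    (hg : ContMDiff (𝓡 n) 𝓘(ℝ, ℝ) ∞ g) (hφ : ContMDiff (𝓡 n) 𝓘(ℝ, ℝ) ∞ φ)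
    (hf' : Integrable (fun x => ‖grad (n := n) f x‖ ^ 2) (weightedVolume n φ))
    (hg0 : Integrable (fun x => g x ^ 2) (weightedVolume n φ))
    (hg' : Integrable (fun x => ‖grad (n := n) g x‖ ^ 2) (weightedVolume n φ))
    (hL : Integrable (fun x => (laplacian (n := n) f x -
      inner ℝ (grad (n := n) f x) (grad (n := n) φ x)) ^ 2) (weightedVolume n φ)) :
    ∫ x, inner ℝ (grad (n := n) f x) (grad (n := n) g x) ∂(weightedVolume n φ) =
      -∫ x, g x * (laplacian (n := n) f x -
        inner ℝ (grad (n := n) f x) (grad (n := n) φ x)) ∂(weightedVolume n φ) := by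
  have hm := hφ.continuous.measurable
  have hLc : Continuous fun x => laplacian (n := n) f x -
      inner ℝ (grad (n := n) f x) (grad (n := n) φ x) :=
    (continuous_laplacian hf).sub (continuous_inner_grad hf hφ)
  have hgL : Integrable (fun x => g x * (laplacian (n := n) f x -
      inner ℝ (grad (n := n) f x) (grad (n := n) φ x))) (weightedVolume n φ) :=
    MemLp.integrable_mul ((memLp_two_iff_integrable_sq hg.continuous.aestronglyMeasurable).2 hg0)
      ((memLp_two_iff_integrable_sq hLc.aestronglyMeasurable).2 hL)
  have hfg : Integrable (fun x => ‖grad (n := n) f x‖ * ‖grad (n := n) g x‖)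
      (weightedVolume n φ) :=
    MemLp.integrable_mul
      ((memLp_two_iff_integrable_sq (continuous_norm_grad hf).aestronglyMeasurable).2 hf')
      ((memLp_two_iff_integrable_sq (continuous_norm_grad hg).aestronglyMeasurable).2 hg')
  have hin : Integrable (fun x => inner ℝ (grad (n := n) f x) (grad (n := n) g x))
      (weightedVolume n φ) :=
    hfg.mono' (continuous_inner_grad hf hg).aestronglyMeasurable
      (Eventually.of_forall fun x => norm_inner_le_norm _ _)
  have hgf : Integrable (fun x => |g x| * ‖grad (n := n) f x‖) (weightedVolume n φ) :=
    MemLp.integrable_mul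
      ((memLp_two_iff_integrable_sq hg.continuous.abs.aestronglyMeasurable).2
        (by simpa only [sq_abs] using hg0))
      ((memLp_two_iff_integrable_sq (continuous_norm_grad hf).aestronglyMeasurable).2 hf')
  have hsum := hgL.add hin
  have hgreen := integral_green hf hg hφ ((integrable_weightedVolume_iff hm).1 hgf) (by
    simp only [real_inner_comm (grad f _) (grad g _)]
    exact (integrable_weightedVolume_iff hm).1 hsum)
  rw [← integral_weightedVolume hm] at hgreen
  simp only [real_inner_comm (grad f _) (grad g _)] at hgreen
  rw [integral_add hgL hin] at hgreen
  linarith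

end Complete

end DriftHeat

namespace DriftHeat

/-! ### Sobolev bounds on time slices -/

section Slices

variable {n N : ℕ} {M : Type*} [TopologicalSpace M] [ChartedSpace (Eucl n) M]
  [RiemannianBundle (fun x : M => TangentSpace (𝓡 n) x)]

theorem gradNorm_sq (f : M → Eucl N) (x : M) :
    gradNorm (n := n) f x ^ 2 = ∑ α, ‖grad (n := n) (fun y => f y α) x‖ ^ 2 :=
  Real.sq_sqrt (Finset.sum_nonneg fun _ _ => sq_nonneg _)

variable [MeasurableSpace M] {φ : M → ℝ}

theorem lintegral_norm_sq_le_sobolevSq (hφ : Measurable φ) (f : M → Eucl N) :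
    ∫⁻ x, ENNReal.ofReal (‖f x‖ ^ 2) ∂(weightedVolume n φ) ≤ sobolevSq (n := n) φ f := by
  rw [sobolevSq, ← lintegral_weightedVolume hφ]
  exact lintegral_mono fun x =>
    ENNReal.ofReal_le_ofReal (le_add_of_nonneg_right (sq_nonneg _))

theorem lintegral_norm_apply_sq_le_sobolevSq (hφ : Measurable φ) (f : M → Eucl N) (α : Fin N) :
    ∫⁻ x, ENNReal.ofReal (‖f x α‖ ^ 2) ∂(weightedVolume n φ) ≤ sobolevSq (n := n) φ f := by
  refine (lintegral_mono fun x => ENNReal.ofReal_le_ofReal ?_).trans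
    (lintegral_norm_sq_le_sobolevSq hφ f)
  exact pow_le_pow_left₀ (norm_nonneg _) (PiLp.norm_apply_le (f x) α) 2

theorem lintegral_norm_grad_sq_le_sobolevSq (hφ : Measurable φ) (f : M → Eucl N) (α : Fin N) :
    ∫⁻ x, ENNReal.ofReal (‖grad (n := n) (fun y => f y α) x‖ ^ 2) ∂(weightedVolume n φ) ≤
      sobolevSq (n := n) φ f := by
  rw [sobolevSq, ← lintegral_weightedVolume hφ]
  refine lintegral_mono fun x => ENNReal.ofReal_le_ofReal ?_
  rw [gradNorm_sq]
  exact (Finset.single_le_sum (fun β _ => sq_nonneg ‖grad (n := n) (fun y => f y β) x‖)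
    (Finset.mem_univ α)).trans (le_add_of_nonneg_left (sq_nonneg _))

theorem sliceI_eq (hφ : Measurable φ) (f : M → Eucl N) :
    sliceI (n := n) φ f = ∫ x, ‖f x‖ ^ 2 ∂(weightedVolume n φ) :=
  (integral_weightedVolume hφ).symm

theorem sliceD_eq (hφ : Measurable φ) (f : M → Eucl N) :
    sliceD (n := n) φ f = -∫ x, gradNorm (n := n) f x ^ 2 ∂(weightedVolume n φ) :=
  congrArg Neg.neg (integral_weightedVolume hφ).symm

end Slices

section SmoothSlices

variable {n N : ℕ} {M : Type*} [EMetricSpace M] [ChartedSpace (Eucl n) M]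
  [IsManifold (𝓡 n) ∞ M]
  [RiemannianBundle (fun x : M => TangentSpace (𝓡 n) x)]
  [IsContMDiffRiemannianBundle (𝓡 n) ∞ (Eucl n) (fun x : M => TangentSpace (𝓡 n) x)]
  [MeasurableSpace M] [BorelSpace M] {φ : M → ℝ} {f : M → Eucl N}

theorem integrable_norm_grad_sq (hφ : Measurable φ)
    (hf : ∀ α, ContMDiff (𝓡 n) 𝓘(ℝ, ℝ) ∞ fun x => f x α)
    (hW : sobolevSq (n := n) φ f < ⊤) (α : Fin N) :
    Integrable (fun x => ‖grad (n := n) (fun y => f y α) x‖ ^ 2) (weightedVolume n φ) :=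
  (integrable_and_integral_le_of_lintegral_le ((continuous_norm_grad (hf α)).pow 2).measurable
    (fun _ => sq_nonneg _) hW.ne (lintegral_norm_grad_sq_le_sobolevSq hφ f α)).1

omit [IsManifold (𝓡 n) ∞ M]
  [IsContMDiffRiemannianBundle (𝓡 n) ∞ (Eucl n) (fun x : M => TangentSpace (𝓡 n) x)] in
theorem integrable_norm_sq (hφ : Measurable φ) (hf : Continuous f)
    (hW : sobolevSq (n := n) φ f < ⊤) :
    Integrable (fun x => ‖f x‖ ^ 2) (weightedVolume n φ) :=
  (integrable_and_integral_le_of_lintegral_le (hf.norm.pow 2).measurable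
    (fun _ => sq_nonneg _) hW.ne (lintegral_norm_sq_le_sobolevSq hφ f)).1

omit [IsManifold (𝓡 n) ∞ M]
  [IsContMDiffRiemannianBundle (𝓡 n) ∞ (Eucl n) (fun x : M => TangentSpace (𝓡 n) x)] in
theorem integrable_norm_apply_sq (hφ : Measurable φ) (hf : Continuous f)
    (hW : sobolevSq (n := n) φ f < ⊤) (α : Fin N) :
    Integrable (fun x => ‖f x α‖ ^ 2) (weightedVolume n φ) :=
  (integrable_and_integral_le_of_lintegral_le
    (((EuclideanSpace.proj (𝕜 := ℝ) α).continuous.comp hf).norm.pow 2).measurable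
    (fun _ => sq_nonneg _) hW.ne (lintegral_norm_apply_sq_le_sobolevSq hφ f α)).1

theorem sliceD_eq_sum (hφ : Measurable φ)
    (hf : ∀ α, ContMDiff (𝓡 n) 𝓘(ℝ, ℝ) ∞ fun x => f x α)
    (hW : sobolevSq (n := n) φ f < ⊤) :
    sliceD (n := n) φ f =
      -∑ α, ∫ x, ‖grad (n := n) (fun y => f y α) x‖ ^ 2 ∂(weightedVolume n φ) := by
  rw [sliceD_eq hφ]
  simp only [gradNorm_sq]
  rw [integral_finsetSum _ fun α _ => integrable_norm_grad_sq hφ hf hW α]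

omit [IsManifold (𝓡 n) ∞ M]
  [IsContMDiffRiemannianBundle (𝓡 n) ∞ (Eucl n) (fun x : M => TangentSpace (𝓡 n) x)] in
theorem sliceI_eq_sum (hφ : Measurable φ) (hf : Continuous f)
    (hW : sobolevSq (n := n) φ f < ⊤) :
    sliceI (n := n) φ f = ∑ α, ∫ x, ‖f x α‖ ^ 2 ∂(weightedVolume n φ) := by
  rw [sliceI_eq hφ]
  simp only [EuclideanSpace.norm_sq_eq]
  rw [integral_finsetSum _ fun α _ => integrable_norm_apply_sq hφ hf hW α]

end SmoothSlices

/-! ### Derivatives of `I` and `D` -/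

section Families

variable {n N : ℕ} {M : Type*} [EMetricSpace M] [ChartedSpace (Eucl n) M]
  [IsManifold (𝓡 n) ∞ M] {u : M → ℝ → Eucl N} {a b : ℝ}

omit [IsManifold (𝓡 n) ∞ M] in
theorem hasDerivWithinAt_of_smoothFamilyOn
    (hu : ∀ α, SmoothFamilyOn n (fun x t => u x t α) (Icc a b)) (x : M) {t : ℝ}
    (ht : t ∈ Icc a b) :
    HasDerivWithinAt (u x) (derivWithin (u x) (Icc a b) t) (Icc a b) t :=
  (differentiableWithinAt_euclidean.2 fun α =>
    ((hu α).hasDerivWithinAt x ht).differentiableWithinAt).hasDerivWithinAt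

omit [IsManifold (𝓡 n) ∞ M] in
theorem derivWithin_apply_of_smoothFamilyOn (hab : a < b)
    (hu : ∀ α, SmoothFamilyOn n (fun x t => u x t α) (Icc a b)) (x : M) {t : ℝ}
    (ht : t ∈ Icc a b) (α : Fin N) :
    derivWithin (u x) (Icc a b) t α = derivWithin (fun s => u x s α) (Icc a b) t := by
  have h := (EuclideanSpace.proj (𝕜 := ℝ) α).hasFDerivAt.comp_hasDerivWithinAt t
    (hasDerivWithinAt_of_smoothFamilyOn hu x ht)
  exact (h.derivWithin (uniqueDiffOn_Icc hab _ ht)).symm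

omit [IsManifold (𝓡 n) ∞ M] in
theorem smoothFamilyOn_derivWithin_apply (hab : a < b)
    (hu : ∀ α, SmoothFamilyOn n (fun x t => u x t α) (Icc a b)) (α : Fin N) :
    SmoothFamilyOn n (fun x t => derivWithin (u x) (Icc a b) t α) (Icc a b) := by
  intro x₀
  exact ((hu α).derivWithin hab x₀).congr fun p hp =>
    derivWithin_apply_of_smoothFamilyOn hab hu _ hp.2 α

theorem continuous_slice (hu : ∀ α, SmoothFamilyOn n (fun x t => u x t α) (Icc a b)) {t : ℝ}
    (ht : t ∈ Icc a b) : Continuous fun x => u x t :=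
  (PiLp.continuous_toLp 2 _).comp (continuous_pi fun α => ((hu α).contMDiff ht).continuous)

variable [SecondCountableTopology M]
  [RiemannianBundle (fun x : M => TangentSpace (𝓡 n) x)]
  [IsContMDiffRiemannianBundle (𝓡 n) ∞ (Eucl n) (fun x : M => TangentSpace (𝓡 n) x)]
  [MeasurableSpace M] [BorelSpace M] {φ : M → ℝ}

theorem hasDerivWithinAt_sliceI (hφ : Measurable φ) (hab : a < b)
    (hu : ∀ α, SmoothFamilyOn n (fun x t => u x t α) (Icc a b))
    (hW : ∀ t ∈ Icc a b, sobolevSq (n := n) φ (fun x => u x t) < ⊤)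
    (hWt : (⨆ t ∈ Icc a b,
      sobolevSq (n := n) φ (fun x => derivWithin (u x) (Icc a b) t)) < ⊤) {t : ℝ}
    (ht : t ∈ Icc a b) :
    HasDerivWithinAt (fun s => sliceI (n := n) φ fun x => u x s)
      (∑ α, 2 * ∫ x, inner ℝ (u x t α) (derivWithin (u x) (Icc a b) t α) ∂(weightedVolume n φ))
      (Icc a b) t := by
  have hv := smoothFamilyOn_derivWithin_apply hab hu
  have hc : ∀ s ∈ Icc a b, ∀ α, Continuous fun x => u x s α := fun s hs α =>
    ((hu α).contMDiff hs).continuous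
  have hc' : ∀ s ∈ Icc a b, ∀ α, Continuous fun x => derivWithin (u x) (Icc a b) s α :=
    fun s hs α => ((hv α).contMDiff hs).continuous
  refine HasDerivWithinAt.congr_of_mem (f := fun s => ∑ α, ∫ x, ‖u x s α‖ ^ 2
    ∂(weightedVolume n φ)) ?_ (fun s hs => sliceI_eq_sum hφ (continuous_slice hu hs) (hW s hs)) ht
  refine HasDerivWithinAt.fun_sum fun α _ => ?_
  refine hasDerivWithinAt_integral_norm_sq (w := fun x s => u x s α)
    (w' := fun x s => derivWithin (u x) (Icc a b) s α)
    (fun x s hs => ?_) (fun x s hs => ((hv α).hasDerivWithinAt x hs).continuousWithinAt)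
    (fun s hs r hr => ((hc s hs α).inner (hc r hr α)).measurable)
    (fun s hs r hr => ((hc s hs α).inner (hc' r hr α)).measurable)
    (fun s hs => ((hc' s hs α).norm.pow 2).measurable) hWt.ne
    (fun s hs => (lintegral_norm_apply_sq_le_sobolevSq hφ _ α).trans
      (le_iSup₂ (f := fun t (_ : t ∈ Icc a b) => sobolevSq (n := n) φ
        (fun x => derivWithin (u x) (Icc a b) t)) s hs))
    (fun s hs => (lintegral_norm_apply_sq_le_sobolevSq hφ _ α).trans_lt (hW s hs)) ht
  rw [derivWithin_apply_of_smoothFamilyOn hab hu x hs]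
  exact (hu α).hasDerivWithinAt x hs

/-- The metric is constant in time, so `∂_t ∇u = ∇ ∂_t u`; this family is bounded in `L²` by the
Sobolev bound on `∂_t u`. -/
theorem hasDerivWithinAt_sliceD (hφ : Measurable φ) (hab : a < b)
    (hu : ∀ α, SmoothFamilyOn n (fun x t => u x t α) (Icc a b))
    (hW : ∀ t ∈ Icc a b, sobolevSq (n := n) φ (fun x => u x t) < ⊤)
    (hWt : (⨆ t ∈ Icc a b,
      sobolevSq (n := n) φ (fun x => derivWithin (u x) (Icc a b) t)) < ⊤) {t : ℝ}
    (ht : t ∈ Icc a b) :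
    HasDerivWithinAt (fun s => sliceD (n := n) φ fun x => u x s)
      (-∑ α, 2 * ∫ x, inner ℝ (grad (n := n) (fun y => u y t α) x)
        (grad (n := n) (fun y => derivWithin (u y) (Icc a b) t α) x) ∂(weightedVolume n φ))
      (Icc a b) t := by
  have hv := smoothFamilyOn_derivWithin_apply hab hu
  have hc : ∀ s ∈ Icc a b, ∀ α, ContMDiff (𝓡 n) 𝓘(ℝ, ℝ) ∞ fun x => u x s α := fun s hs α =>
    (hu α).contMDiff hs
  have hc' : ∀ s ∈ Icc a b, ∀ α,
      ContMDiff (𝓡 n) 𝓘(ℝ, ℝ) ∞ fun x => derivWithin (u x) (Icc a b) s α :=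
    fun s hs α => (hv α).contMDiff hs
  refine HasDerivWithinAt.congr_of_mem (f := fun s => -∑ α, ∫ x,
    ‖grad (n := n) (fun y => u y s α) x‖ ^ 2 ∂(weightedVolume n φ)) ?_
    (fun s hs => sliceD_eq_sum hφ (hc s hs) (hW s hs)) ht
  refine HasDerivWithinAt.neg (HasDerivWithinAt.fun_sum fun α _ => ?_)
  refine hasDerivWithinAt_integral_norm_sq (E := fun x : M => TangentSpace (𝓡 n) x)
    (w := fun x s => grad (n := n) (fun y => u y s α) x)
    (w' := fun x s => grad (n := n) (fun y => derivWithin (u y) (Icc a b) s α) x)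
    (fun x s hs => ?_)
    (fun x s hs => ((hv α).hasDerivWithinAt_grad hab x hs).continuousWithinAt)
    (fun s hs r hr => (continuous_inner_grad (hc s hs α) (hc r hr α)).measurable)
    (fun s hs r hr => (continuous_inner_grad (hc s hs α) (hc' r hr α)).measurable)
    (fun s hs => ((continuous_norm_grad (hc' s hs α)).pow 2).measurable) hWt.ne
    (fun s hs => (lintegral_norm_grad_sq_le_sobolevSq hφ _ α).trans
      (le_iSup₂ (f := fun t (_ : t ∈ Icc a b) => sobolevSq (n := n) φ
        (fun x => derivWithin (u x) (Icc a b) t)) s hs))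
    (fun s hs => (lintegral_norm_grad_sq_le_sobolevSq hφ _ α).trans_lt (hW s hs)) ht
  simp only [fun y => derivWithin_apply_of_smoothFamilyOn hab hu y hs α]
  exact (hu α).hasDerivWithinAt_grad hab x hs

end Families

end DriftHeat

namespace DriftHeat

/-! ### The differential inequality for the frequency -/

section Energy

variable {n N : ℕ} {M : Type*} [EMetricSpace M] [ChartedSpace (Eucl n) M]
  [IsManifold (𝓡 n) ∞ M] [SecondCountableTopology M]
  [RiemannianBundle (fun x : M => TangentSpace (𝓡 n) x)]
  [IsContMDiffRiemannianBundle (𝓡 n) ∞ (Eucl n) (fun x : M => TangentSpace (𝓡 n) x)]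
  [IsRiemannianManifold (𝓡 n) M] [MeasurableSpace M] [BorelSpace M]
  {φ : M → ℝ} {f g : M → Eucl N}

omit [IsRiemannianManifold (𝓡 n) M] in
theorem continuous_driftLaplacian (hφ : ContMDiff (𝓡 n) 𝓘(ℝ, ℝ) ∞ φ)
    (hf : ∀ α, ContMDiff (𝓡 n) 𝓘(ℝ, ℝ) ∞ fun x => f x α) :
    Continuous (driftLaplacian (n := n) φ f) :=
  (PiLp.continuous_toLp 2 _).comp (continuous_pi fun α =>
    (continuous_laplacian (hf α)).sub (continuous_inner_grad (hf α) hφ))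

/-- Used twice: with `g = u` it gives `D = ⟨u, 𝓛_φ u⟩`, with `g = ∂_t u` it gives `D' = 2⟨∂_t u, 𝓛_φ
u⟩`. -/
theorem sum_integral_inner_grad [CompleteSpace M] (hφ : ContMDiff (𝓡 n) 𝓘(ℝ, ℝ) ∞ φ)
    (hf : ∀ α, ContMDiff (𝓡 n) 𝓘(ℝ, ℝ) ∞ fun x => f x α)
    (hg : ∀ α, ContMDiff (𝓡 n) 𝓘(ℝ, ℝ) ∞ fun x => g x α)
    (hfW : sobolevSq (n := n) φ f < ⊤) (hgW : sobolevSq (n := n) φ g < ⊤)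
    (hL : MemLp (driftLaplacian (n := n) φ f) 2 (weightedVolume n φ)) :
    ∑ α, ∫ x, inner ℝ (grad (n := n) (fun y => f y α) x) (grad (n := n) (fun y => g y α) x)
      ∂(weightedVolume n φ) =
      -∫ x, inner ℝ (g x) (driftLaplacian (n := n) φ f x) ∂(weightedVolume n φ) := by
  have hm := hφ.continuous.measurable
  have hgc : Continuous g :=
    (PiLp.continuous_toLp 2 _).comp (continuous_pi fun α => (hg α).continuous)
  have hLα : ∀ α, MemLp (fun x => driftLaplacian (n := n) φ f x α) 2 (weightedVolume n φ) :=
    fun α => hL.of_le (((EuclideanSpace.proj (𝕜 := ℝ) α).continuous.comp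
      (continuous_driftLaplacian hφ hf)).aestronglyMeasurable)
        (Eventually.of_forall fun x => PiLp.norm_apply_le _ α)
  have hgα : ∀ α, Integrable (fun x => g x α ^ 2) (weightedVolume n φ) := fun α => by
    simpa only [Real.norm_eq_abs, sq_abs] using integrable_norm_apply_sq hm hgc hgW α
  have hprod : ∀ α, Integrable (fun x => g x α * driftLaplacian (n := n) φ f x α)
      (weightedVolume n φ) := fun α => MemLp.integrable_mul
    ((memLp_two_iff_integrable_sq (hg α).continuous.aestronglyMeasurable).2 (hgα α)) (hLα α)
  have hin : ∀ x, inner ℝ (g x) (driftLaplacian (n := n) φ f x) =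
      ∑ α, g x α * driftLaplacian (n := n) φ f x α := fun x => by
    simp only [PiLp.inner_apply, RCLike.inner_apply, conj_trivial, mul_comm]
  simp only [hin]
  rw [integral_finsetSum _ fun α _ => hprod α, ← Finset.sum_neg_distrib]
  exact Finset.sum_congr rfl fun α _ => integral_inner_grad_weightedVolume (hf α) (hg α) hφ
    (integrable_norm_grad_sq hm hf hfW α) (hgα α) (integrable_norm_grad_sq hm hg hgW α)
    ((hLα α).integrable_sq)

omit [SecondCountableTopology M] [IsRiemannianManifold (𝓡 n) M] in
theorem integrable_gradNorm_sq (hφ : Measurable φ)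
    (hf : ∀ α, ContMDiff (𝓡 n) 𝓘(ℝ, ℝ) ∞ fun x => f x α)
    (hW : sobolevSq (n := n) φ f < ⊤) :
    Integrable (fun x => gradNorm (n := n) f x ^ 2) (weightedVolume n φ) := by
  simp only [gradNorm_sq]
  exact integrable_finsetSum _ fun α _ => integrable_norm_grad_sq hφ hf hW α

omit [IsRiemannianManifold (𝓡 n) M] in
/-- The `L²` norm of the error `v - 𝓛_φ f` is controlled by `I` and `D`. -/
theorem memLp_driftLaplacian_and_integral_le (hφ : ContMDiff (𝓡 n) 𝓘(ℝ, ℝ) ∞ φ)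
    (hf : ∀ α, ContMDiff (𝓡 n) 𝓘(ℝ, ℝ) ∞ fun x => f x α) (hfc : Continuous f)
    (hfW : sobolevSq (n := n) φ f < ⊤) {v : M → Eucl N} (hvc : Continuous v)
    (hv : MemLp v 2 (weightedVolume n φ)) {c : ℝ}
    (hc : ∀ x, ‖v x - driftLaplacian (n := n) φ f x‖ ≤ c * (‖f x‖ + gradNorm (n := n) f x)) :
    MemLp (driftLaplacian (n := n) φ f) 2 (weightedVolume n φ) ∧
      ∫ x, ‖v x - driftLaplacian (n := n) φ f x‖ ^ 2 ∂(weightedVolume n φ) ≤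
        2 * c ^ 2 * (sliceI (n := n) φ f - sliceD (n := n) φ f) := by
  have hm := hφ.continuous.measurable
  have hi : Integrable (fun x => ‖f x‖ ^ 2) (weightedVolume n φ) := integrable_norm_sq hm hfc hfW
  have hd : Integrable (fun x => gradNorm (n := n) f x ^ 2) (weightedVolume n φ) :=
    integrable_gradNorm_sq hm hf hfW
  have hsum : Integrable (fun x => 2 * c ^ 2 * (‖f x‖ ^ 2 + gradNorm (n := n) f x ^ 2))
      (weightedVolume n φ) := (hi.add hd).const_mul _
  have hpt : ∀ x, ‖v x - driftLaplacian (n := n) φ f x‖ ^ 2 ≤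
      2 * c ^ 2 * (‖f x‖ ^ 2 + gradNorm (n := n) f x ^ 2) := fun x => by
    refine (pow_le_pow_left₀ (norm_nonneg _) (hc x) 2).trans ?_
    rw [mul_pow]
    nlinarith [mul_nonneg (sq_nonneg c) (sq_nonneg (‖f x‖ - gradNorm (n := n) f x))]
  have hEc : Continuous fun x => v x - driftLaplacian (n := n) φ f x :=
    hvc.sub (continuous_driftLaplacian hφ hf)
  have hE : Integrable (fun x => ‖v x - driftLaplacian (n := n) φ f x‖ ^ 2)
      (weightedVolume n φ) :=
    hsum.mono' (hEc.norm.pow 2).aestronglyMeasurable (Eventually.of_forall fun x => by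
      rw [Real.norm_of_nonneg (sq_nonneg _)]
      exact hpt x)
  constructor
  · have hmem := hv.sub
      ((memLp_two_iff_integrable_sq_norm hEc.aestronglyMeasurable).2 hE)
    refine hmem.congr_norm (continuous_driftLaplacian hφ hf).aestronglyMeasurable
      (Eventually.of_forall fun x => ?_)
    simp
  · refine (integral_mono hE hsum hpt).trans_eq ?_
    rw [integral_const_mul, integral_add hi hd, sliceI_eq hm, sliceD_eq hm, sub_neg_eq_add]

/-- The frequency of a solution of the drift heat inequality is differentiable, and its derivative
is bounded from below. -/
theorem exists_hasDerivWithinAt_frequency [CompleteSpace M]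
    (hφ : ContMDiff (𝓡 n) 𝓘(ℝ, ℝ) ∞ φ) {a b : ℝ} (hab : a < b) {u : M → ℝ → Eucl N}
    (hu : ∀ α, SmoothFamilyOn n (fun x t => u x t α) (Icc a b))
    (hW : ∀ t ∈ Icc a b, sobolevSq (n := n) φ (fun x => u x t) < ⊤)
    (hWt : (⨆ t ∈ Icc a b,
      sobolevSq (n := n) φ (fun x => derivWithin (u x) (Icc a b) t)) < ⊤) {c t : ℝ}
    (ht : t ∈ Icc a b)
    (hc : ∀ x : M,
      ‖derivWithin (u x) (Icc a b) t - driftLaplacian (n := n) φ (fun y => u y t) x‖ ≤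
        c * (‖u x t‖ + gradNorm (n := n) (fun y => u y t) x))
    (hne : ∃ x, u x t ≠ 0) :
    ∃ U' : ℝ, HasDerivWithinAt (frequency (n := n) φ u) U' (Icc a b) t ∧
      c ^ 2 * (frequency (n := n) φ u t - 1) ≤ U' := by
  have hm := hφ.continuous.measurable
  have hv := smoothFamilyOn_derivWithin_apply hab hu
  have hus : ∀ α, ContMDiff (𝓡 n) 𝓘(ℝ, ℝ) ∞ fun x => u x t α := fun α => (hu α).contMDiff ht
  have hvs : ∀ α, ContMDiff (𝓡 n) 𝓘(ℝ, ℝ) ∞ fun x => derivWithin (u x) (Icc a b) t α :=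
    fun α => (hv α).contMDiff ht
  have huc : Continuous fun x => u x t := continuous_slice hu ht
  have hvc : Continuous fun x => derivWithin (u x) (Icc a b) t := continuous_slice hv ht
  have hvW : sobolevSq (n := n) φ (fun x => derivWithin (u x) (Icc a b) t) < ⊤ :=
    (le_iSup₂ (f := fun t (_ : t ∈ Icc a b) => sobolevSq (n := n) φ
      (fun x => derivWithin (u x) (Icc a b) t)) t ht).trans_lt hWt
  have hui := integrable_norm_sq hm huc (hW t ht)
  have huL := (memLp_two_iff_integrable_sq_norm huc.aestronglyMeasurable).2 hui
  have hvL := (memLp_two_iff_integrable_sq_norm hvc.aestronglyMeasurable).2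
    (integrable_norm_sq hm hvc hvW)
  obtain ⟨hLL, hE⟩ := memLp_driftLaplacian_and_integral_le hφ hus huc (hW t ht) hvc hvL hc
  have hcs := neg_integral_norm_sub_sq_mul_le huL hvL hLL
  have hI : HasDerivWithinAt (fun s => sliceI (n := n) φ fun x => u x s)
      (2 * ∫ x, inner ℝ (u x t) (derivWithin (u x) (Icc a b) t) ∂(weightedVolume n φ))
      (Icc a b) t := by
    refine (hasDerivWithinAt_sliceI hm hab hu hW hWt ht).congr_deriv ?_
    rw [← Finset.mul_sum]
    simp only [PiLp.inner_apply]
    rw [integral_finsetSum _ fun α _ => ?_]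
    exact MemLp.integrable_mul (𝕜 := ℝ) (f := fun x => derivWithin (u x) (Icc a b) t α)
      (hvL.of_le (hvs α).continuous.aestronglyMeasurable
        (Eventually.of_forall fun x => PiLp.norm_apply_le _ α))
      (huL.of_le (hus α).continuous.aestronglyMeasurable
        (Eventually.of_forall fun x => PiLp.norm_apply_le _ α))
  have hD : HasDerivWithinAt (fun s => sliceD (n := n) φ fun x => u x s)
      (2 * ∫ x, inner ℝ (derivWithin (u x) (Icc a b) t)
        (driftLaplacian (n := n) φ (fun y => u y t) x) ∂(weightedVolume n φ))
      (Icc a b) t := by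
    refine (hasDerivWithinAt_sliceD hm hab hu hW hWt ht).congr_deriv ?_
    rw [← Finset.mul_sum, sum_integral_inner_grad hφ hus hvs (hW t ht) hvW hLL]
    ring
  have hDt : sliceD (n := n) φ (fun x => u x t) = ∫ x, inner ℝ (u x t)
      (driftLaplacian (n := n) φ (fun y => u y t) x) ∂(weightedVolume n φ) := by
    have h := sum_integral_inner_grad hφ hus hus (hW t ht) (hW t ht) hLL
    simp only [real_inner_self_eq_norm_sq] at h
    rw [sliceD_eq_sum hm hus (hW t ht), h, neg_neg]
  have hpos : 0 < sliceI (n := n) φ fun x => u x t := by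
    obtain ⟨x, hx⟩ := hne
    rw [sliceI_eq hm]
    exact integral_weightedVolume_pos hφ.continuous (huc.norm.pow 2) (fun x => sq_nonneg _) hui
      (x := x) (pow_ne_zero 2 (norm_ne_zero_iff.2 hx))
  refine ⟨_, hD.div hI hpos.ne', ?_⟩
  rw [← hDt, ← sliceI_eq hm fun x => u x t] at hcs
  set I := sliceI (n := n) φ fun x => u x t
  set D := sliceD (n := n) φ fun x => u x t
  have hf : frequency (n := n) φ u t = D / I := rfl
  rw [hf, le_div_iff₀ (pow_pos hpos 2)]
  -- The factor `2` from squaring the sum cancels the `½` from polarisation, which leaves the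
  -- constant `c ^ 2`.
  have h1 : c ^ 2 * (D / I - 1) * I ^ 2 = -(2 * c ^ 2 * (I - D) * I / 2) := by
    field_simp
    ring
  rw [h1]
  have h2 := mul_le_mul_of_nonneg_right hE hpos.le
  linarith

omit [IsManifold (𝓡 n) ∞ M] [SecondCountableTopology M]
  [IsContMDiffRiemannianBundle (𝓡 n) ∞ (Eucl n) (fun x : M => TangentSpace (𝓡 n) x)]
  [IsRiemannianManifold (𝓡 n) M] [BorelSpace M] in
theorem frequency_nonpos (φ : M → ℝ) (u : M → ℝ → Eucl N) (t : ℝ) :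
    frequency (n := n) φ u t ≤ 0 :=
  div_nonpos_of_nonpos_of_nonneg
    (neg_nonpos.2 (integral_nonneg fun _ => mul_nonneg (sq_nonneg _) (Real.exp_nonneg _)))
    (integral_nonneg fun _ => mul_nonneg (sq_nonneg _) (Real.exp_nonneg _))

end Energy

end DriftHeat

/-! ### The main theorem -/

open DriftHeat in
theorem theorem3p1 {n N : ℕ} {M : Type*} [EMetricSpace M] [ChartedSpace (Eucl n) M]
    [IsManifold (𝓡 n) ∞ M] [SecondCountableTopology M]
    [RiemannianBundle (fun x : M => TangentSpace (𝓡 n) x)]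
    [IsContMDiffRiemannianBundle (𝓡 n) ∞ (Eucl n) (fun x : M => TangentSpace (𝓡 n) x)]
    [IsRiemannianManifold (𝓡 n) M] [CompleteSpace M] [MeasurableSpace M] [BorelSpace M]
    (φ : M → ℝ) (hφ : ContMDiff (𝓡 n) 𝓘(ℝ, ℝ) ∞ φ)
    (a b : ℝ) (hab : a < b) (u : M → ℝ → Eucl N)
    (hu : ContMDiffOn ((𝓡 n).prod 𝓘(ℝ, ℝ)) 𝓘(ℝ, Eucl N) ∞
      (fun p : M × ℝ => u p.1 p.2) (univ ×ˢ Icc a b))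
    (hW : ∀ t ∈ Icc a b, sobolevSq (n := n) φ (fun x => u x t) < ⊤)
    (hWt : (⨆ t ∈ Icc a b,
      sobolevSq (n := n) φ (fun x => derivWithin (u x) (Icc a b) t)) < ⊤)
    (C : ℝ → ℝ)
    (hC : ∀ t ∈ Icc a b, ∀ x : M,
      ‖derivWithin (u x) (Icc a b) t - driftLaplacian (n := n) φ (fun y => u y t) x‖ ≤
        C t * (‖u x t‖ + gradNorm (n := n) (fun y => u y t) x)) :
    ∀ t ∈ Icc a b, (∃ x, u x t ≠ 0) →
      DifferentiableWithinAt ℝ (frequency (n := n) φ u) (Icc a b) t ∧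
      C t ^ 2 * (frequency (n := n) φ u t - 1) ≤
        derivWithin (frequency (n := n) φ u) (Icc a b) t ∧
      DifferentiableWithinAt ℝ
        (fun s => Real.log (1 - frequency (n := n) φ u s)) (Icc a b) t ∧
      derivWithin (fun s => Real.log (1 - frequency (n := n) φ u s)) (Icc a b) t ≤ C t ^ 2 := by
  intro t ht hne
  have hsm : ∀ α, SmoothFamilyOn n (fun x t => u x t α) (Icc a b) := fun α =>
    ((EuclideanSpace.proj (𝕜 := ℝ) α).contMDiff.comp_contMDiffOn hu).smoothFamilyOn
  obtain ⟨U', hU, hle⟩ :=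
    exists_hasDerivWithinAt_frequency hφ hab hsm hW hWt ht (hC t ht) hne
  have hUD := uniqueDiffOn_Icc hab t ht
  -- `U ≤ 0` keeps the argument of the logarithm at least `1`; its derivative is `-U' / (1 - U)`.
  have h1 : 0 < 1 - frequency (n := n) φ u t := by
    linarith [frequency_nonpos (n := n) φ u t]
  have hlog := (hU.const_sub 1).log h1.ne'
  refine ⟨hU.differentiableWithinAt, ?_, hlog.differentiableWithinAt, ?_⟩
  · rwa [hU.derivWithin hUD]
  · rw [hlog.derivWithin hUD, div_le_iff₀ h1]
    linarith
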